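/- Let $\mathcal H$ be a separable complex Hilbert space, $\mathcal D$ the set of density operators on $\mathcal H$, and let $(e^{t\mathcal L})_{t\ge 0}$ be the solution semigroup of a Lindblad equation $\frac{d}{dt}\rho(t)=\mathcal L(\rho(t))$, i.e. a trace-norm strongly continuous semigroup of completely positive trace-preserving maps on the trace-class operators. Write $\omega(t)=e^{t\mathcal L}(\omega)$. Let $\dot Q:\mathcal D\to\mathbb R\cup\{\infty\}$ be linear on the convex set $\mathcal D$ (that is, $\dot Q((1-s)\omega_0+s\omega_1)=(1-s)\dot Q(\omega_0)+s\dot Q(\omega_1)$ for $0<s<1$), and define the entropy production (EP) rate $$\dot\Sigma(\omega)=\tfrac{d}{dt}S(\omega(t))\big|_{t=0^+}+\dot Q(\omega),\qquad S(\omega)=-\mathrm{tr}\{\omega\ln\omega\},$$ where the derivative is a right derivative with values in $[-\infty,\infty]$, and is taken to be $\infty$ if $S(\omega)=\infty$ or if it does not exist. Let $S(\rho\Vert\varphi)=\mathrm{tr}\{\rho(\ln\rho-\ln\varphi)\}$ if $\mathrm{supp}\,\rho\subseteq\mathrm{supp}\,\varphi$ and $S(\rho\Vert\varphi)=\infty$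 otherwise. Let $P$ be a set of mutually orthogonal projections and $\mathcal D_P=\{\rho\in\mathcal D:\rho=\sum_{\Pi\in P}\Pi\rho\Pi\}$. Let $\varphi\in\arg\min_{\omega\in\mathcal D_P}\dot\Sigma(\omega)$, let $\rho\in\mathcal D_P$, and put $\varphi(\lambda)=(1-\lambda)\varphi+\lambda\rho$. (a) Suppose that $\dot\Sigma(\rho)<\infty$, that $\varphi\ge\alpha\rho$ for some $\alpha>0$, and that the following two conditions hold. Condition 1: the one-sided derivatives at $\lambda=0$, $t=0$ in $$\partial_\lambda^+\dot\Sigma(\varphi(\lambda))=\partial_t^+\partial_\lambda^+\int_0^t\dot\Sigma\big(e^{t'\mathcal L}(\varphi(\lambda))\big)\,dt'$$ exist (with the EP rates and integrals involved finite for small $\lambda,t\ge 0$, the EP rate inside the integral for almost every $t'$) and are equal. Condition 2: if $\varphi\ge\alpha\rho$ for some $\alpha>0$, then $\lambda\mapsto\dot\Sigma(\varphi(\lambda))$ is finite and continuously differentiable in some neighborhood of $\lambda=0$. Then $\dot\Sigma(\rho)$ and $\dot\Sigma(\varphi)$ are finite, the right derivative of $S(\rho(t)\Vert\varphi(t))$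 at $t=0$ exists, and $$\dot\Sigma(\rho)-\dot\Sigma(\varphi)=-\tfrac{d}{dt}S(\rho(t)\Vert\varphi(t))\big|_{t=0^+}.$$ (b) Suppose that $\dim\mathcal H<\infty$. Then $\varphi\ge\alpha\rho$ for some $\alpha>0$ if and only if $S(\rho\Vert\varphi)<\infty$. If $\dot\Sigma(\varphi)<\infty$ and $S(\rho\Vert\varphi)<\infty$, then $\dot\Sigma(\varphi)$ is finite and the same identity holds without Conditions 1 and 2 (both sides being $+\infty$ if $\dot\Sigma(\rho)=\infty$). -/

import Mathlib

noncomputable section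

open Filter Topology Set
open scoped ENNReal InnerProductSpace

namespace EPRate

section TraceClass

variable (H : Type*) [NormedAddCommGroup H] [InnerProductSpace ℂ H] [CompleteSpace H]

/-- Index set of a fixed orthonormal (Hilbert) basis of `H`. -/
def basisIndex : Set H := (exists_hilbertBasis ℂ H).choose

/-- A fixed orthonormal (Hilbert) basis of `H`; the traces below do not depend on it. -/
def basis : HilbertBasis (basisIndex H) ℂ H := (exists_hilbertBasis ℂ H).choose_spec.choose

variable {H}

/-- The trace `∑ᵢ ⟨bᵢ, A bᵢ⟩ ∈ [0, ∞]` of a positive bounded operator `A`. -/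
def posTrace (A : H →L[ℂ] H) : ℝ≥0∞ :=
  ∑' i, ENNReal.ofReal (⟪basis H i, A (basis H i)⟫_ℂ).re

/-- The trace norm `tr |A| ∈ [0, ∞]`. -/
def traceNorm (A : H →L[ℂ] H) : ℝ≥0∞ := posTrace (CFC.abs A)

variable (H) in
/-- The trace-class operators: the complex span of the positive operators with finite trace. -/
def traceClass : Submodule ℂ (H →L[ℂ] H) :=
  Submodule.span ℂ {A | A.IsPositive ∧ posTrace A < ⊤}

/-- The trace of a trace-class operator. -/
def trace (A : traceClass H) : ℂ := ∑' i, ⟪basis H i, (A : H →L[ℂ] H) (basis H i)⟫_ℂ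

/-- Density operators (states). -/
def IsState (ρ : traceClass H) : Prop := (ρ : H →L[ℂ] H).IsPositive ∧ trace ρ = 1

/-- The linear mixture `(1 - s) φ + s ρ`, for an arbitrary real `s`. -/
def mix (φ ρ : traceClass H) (s : ℝ) : traceClass H := ((1 - s : ℝ) : ℂ) • φ + ((s : ℝ) : ℂ) • ρ

/-- `P` is a set of mutually orthogonal orthogonal projections (not necessarily complete). -/
def IsOrthogonalProjectionSet (P : Set (H →L[ℂ] H)) : Prop :=
  (∀ p ∈ P, IsStarProjection p) ∧ ∀ p ∈ P, ∀ q ∈ P, p ≠ q → p * q = 0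

/-- The states `ρ` with `ρ = ∑_{Π ∈ P} Π ρ Π`, the sum converging strongly. -/
def statesOf (P : Set (H →L[ℂ] H)) : Set (traceClass H) :=
  {ρ | IsState ρ ∧ ∀ v : H, HasSum
    (fun p : P => (p : H →L[ℂ] H) ((ρ : H →L[ℂ] H) ((p : H →L[ℂ] H) v))) ((ρ : H →L[ℂ] H) v)}

end TraceClass

section Entropy

variable {H : Type*} [NormedAddCommGroup H] [InnerProductSpace ℂ H] [CompleteSpace H]

/-- The von Neumann entropy `-tr (ρ ln ρ) ∈ [0, ∞]`. -/
def entropy (ρ : traceClass H) : ℝ≥0∞ := posTrace (cfc Real.negMulLog (ρ : H →L[ℂ] H))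

/-- The support of an operator: the orthogonal complement of its kernel. -/
def supp (A : H →L[ℂ] H) : Submodule ℂ H := (LinearMap.ker (A : H →ₗ[ℂ] H))ᗮ

/-- The orthogonal projection onto the eigenspace `ker (A - p)`. -/
def eigenProj (A : H →L[ℂ] H) (p : ℝ) : H →L[ℂ] H :=
  (A - (p : ℂ) • (1 : H →L[ℂ] H)).ker.starProjection

open scoped Classical in
/-- The quantum relative entropy `tr (ρ (ln ρ - ln φ))` if `supp ρ ⊆ supp φ`, and `∞` otherwise.
As `ln φ` is unbounded in infinite dimensions, the trace is, as usual, evaluated in the spectral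
decompositions `ρ = ∑ p Eₚ`, `φ = ∑ r Fᵣ`, namely as
`∑_{p, r} tr (Eₚ Fᵣ) (p ln p - p ln r + r - p)`. All terms are nonnegative, and the summands
`r - p` contribute `tr φ - tr ρ = 0` for states. -/
def relEntropy (ρ φ : traceClass H) : ℝ≥0∞ :=
  if supp (ρ : H →L[ℂ] H) ≤ supp (φ : H →L[ℂ] H) then
    ∑' (p : ℝ) (r : ℝ),
      posTrace (eigenProj (ρ : H →L[ℂ] H) p * eigenProj (φ : H →L[ℂ] H) r *
          eigenProj (ρ : H →L[ℂ] H) p) *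
        ENNReal.ofReal (p * Real.log p - p * Real.log r + r - p)
  else ⊤

end Entropy

section Dynamics

variable {H : Type*} [NormedAddCommGroup H] [InnerProductSpace ℂ H] [CompleteSpace H]

open scoped ComplexOrder in
/-- Positivity of an operator matrix `(A i j)` as an operator on `Hⁿ`. -/
def BlockPositive {n : ℕ} (A : Fin n → Fin n → traceClass H) : Prop :=
  ∀ v : Fin n → H, 0 ≤ ∑ i, ∑ j, ⟪v i, (A i j : H →L[ℂ] H) (v j)⟫_ℂ

/-- Complete positivity of a linear map on the trace-class operators. -/
def CompletelyPositive (Φ : traceClass H →ₗ[ℂ] traceClass H) : Prop :=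
  ∀ (n : ℕ) (A : Fin n → Fin n → traceClass H),
    BlockPositive A → BlockPositive fun i j => Φ (A i j)

/-- `T t = e^{tℒ}`, `t ≥ 0`, is the solution semigroup of a Lindblad equation `dρ/dt = ℒ(ρ)`, i.e.
a quantum dynamical semigroup: a one-parameter semigroup of completely positive trace-preserving
maps on the trace-class operators, strongly continuous in trace norm. The Lindbladian `ℒ` is its
(possibly unbounded) generator. Values of `T` at negative times are irrelevant. -/
structure IsLindbladSemigroup (T : ℝ → traceClass H →ₗ[ℂ] traceClass H) : Prop where
  zero : T 0 = LinearMap.id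
  add : ∀ s t : ℝ, 0 ≤ s → 0 ≤ t → T (s + t) = T s ∘ₗ T t
  completelyPositive : ∀ t : ℝ, 0 ≤ t → CompletelyPositive (T t)
  tracePreserving : ∀ t : ℝ, 0 ≤ t → ∀ A, trace (T t A) = trace A
  continuous : ∀ A : traceClass H,
    Tendsto (fun t : ℝ => traceNorm ((T t A - A : traceClass H) : H →L[ℂ] H)) (𝓝[>] 0) (𝓝 0)

/-- `Q` is a linear functional with values in `ℝ ∪ {∞}` on the convex set of states
(its values at other operators are irrelevant). -/
def IsLinearOnStates (Q : traceClass H → EReal) : Prop :=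
  (∀ ω, IsState ω → Q ω ≠ ⊥) ∧
  ∀ ω₀ ω₁, IsState ω₀ → IsState ω₁ → ∀ s : ℝ, 0 < s → s < 1 →
    Q (mix ω₀ ω₁ s) = ((1 - s : ℝ) : EReal) * Q ω₀ + (s : EReal) * Q ω₁

/-- `f` is finite at `0` and has there the right derivative `e ∈ [-∞, ∞]`. -/
def HasRightDerivAtZero (f : ℝ → EReal) (e : EReal) : Prop :=
  f 0 ≠ ⊥ ∧ f 0 ≠ ⊤ ∧ Tendsto (fun t : ℝ => (f t - f 0) / (t : EReal)) (𝓝[>] 0) (𝓝 e)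

open scoped Classical in
/-- The rate `d/dt S(ω(t))` at `t = 0`, where `ω(t) = T t ω`. It is `∞` by convention when
`S(ω) = ∞` or when the rate does not exist in `[-∞, ∞]`. -/
def entropyRate (T : ℝ → traceClass H →ₗ[ℂ] traceClass H) (ω : traceClass H) : EReal :=
  if h : ∃ e, HasRightDerivAtZero (fun t => (entropy (T t ω) : EReal)) e then h.choose else ⊤

/-- The EP rate `d/dt S(ω(t)) + Q ω`. -/
def epRate (T : ℝ → traceClass H →ₗ[ℂ] traceClass H) (Q : traceClass H → EReal)
    (ω : traceClass H) : EReal :=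
  entropyRate T ω + Q ω

/-- `φ` minimizes the EP rate over the set of states `D`. -/
def IsEPRateMinimizer (T : ℝ → traceClass H →ₗ[ℂ] traceClass H) (Q : traceClass H → EReal)
    (D : Set (traceClass H)) (φ : traceClass H) : Prop :=
  φ ∈ D ∧ ∀ ω ∈ D, epRate T Q φ ≤ epRate T Q ω

/-- An extended real is finite. -/
def IsFinite (x : EReal) : Prop := x ≠ ⊥ ∧ x ≠ ⊤

/-- The EP rate along the trajectory of `ω` is a.e. finite and integrable on `[0, t]`. -/
def HasIntegratedEP (T : ℝ → traceClass H →ₗ[ℂ] traceClass H) (Q : traceClass H → EReal)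
    (ω : traceClass H) (t : ℝ) : Prop :=
  (∀ᵐ s : ℝ, s ∈ Ioc 0 t → IsFinite (epRate T Q (T s ω))) ∧
  IntervalIntegrable (fun s => (epRate T Q (T s ω)).toReal) MeasureTheory.volume 0 t

/-- The integrated EP, `∫₀ᵗ (EP rate at e^{sℒ}(ω)) ds`. -/
def integratedEP (T : ℝ → traceClass H →ₗ[ℂ] traceClass H) (Q : traceClass H → EReal)
    (ω : traceClass H) (t : ℝ) : ℝ :=
  ∫ s in (0 : ℝ)..t, (epRate T Q (T s ω)).toReal

/-- Symmetry of partial derivatives: with `φ(l) = (1 - l) φ + l ρ`, the one-sided derivative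
`∂ₗ⁺` of the EP rate at `φ(l)` and the iterated one-sided derivative `∂ₜ⁺ ∂ₗ⁺` of the integrated
EP of `φ(l)` up to time `t` exist at `l = 0`, `t = 0` and agree. -/
def SymmetricDerivatives (T : ℝ → traceClass H →ₗ[ℂ] traceClass H) (Q : traceClass H → EReal)
    (φ ρ : traceClass H) : Prop :=
  ∃ (d : ℝ) (g : ℝ → ℝ),
    (∀ᶠ l in 𝓝[≥] (0 : ℝ), IsFinite (epRate T Q (mix φ ρ l))) ∧
    HasDerivWithinAt (fun l => (epRate T Q (mix φ ρ l)).toReal) d (Ici 0) 0 ∧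
    (∀ᶠ t in 𝓝[≥] (0 : ℝ),
      (∀ᶠ l in 𝓝[≥] (0 : ℝ), HasIntegratedEP T Q (mix φ ρ l) t) ∧
      HasDerivWithinAt (fun l => integratedEP T Q (mix φ ρ l) t) (g t) (Ici 0) 0) ∧
    HasDerivWithinAt g d (Ici 0) 0

/-- `φ ≥ α ρ` for some `α > 0`. -/
def Dominates (φ ρ : traceClass H) : Prop :=
  ∃ α : ℝ, 0 < α ∧ (α : ℂ) • (ρ : H →L[ℂ] H) ≤ (φ : H →L[ℂ] H)

/-- If `φ ≥ α ρ` for some `α > 0`, then the EP rate at `(1 - l) φ + l ρ` is finite and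
continuously differentiable in `l` in some neighborhood of `l = 0`. -/
def SmoothNearMinimizer (T : ℝ → traceClass H →ₗ[ℂ] traceClass H) (Q : traceClass H → EReal)
    (φ ρ : traceClass H) : Prop :=
  Dominates φ ρ → ∃ ε : ℝ, 0 < ε ∧
    (∀ l ∈ Ioo (-ε) ε, IsFinite (epRate T Q (mix φ ρ l))) ∧
    ContDiffOn ℝ 1 (fun l => (epRate T Q (mix φ ρ l)).toReal) (Ioo (-ε) ε)

/-- The instantaneous mismatch cost identity: the right derivative at `t = 0` of
`S(ρ(t) ‖ φ(t))` exists, and the EP rate of `ρ` minus that of `φ` is its negative. -/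
def MismatchCostIdentity (T : ℝ → traceClass H →ₗ[ℂ] traceClass H) (Q : traceClass H → EReal)
    (φ ρ : traceClass H) : Prop :=
  ∃ d : EReal, HasRightDerivAtZero (fun t => (relEntropy (T t ρ) (T t φ) : EReal)) d ∧
    epRate T Q ρ - epRate T Q φ = -d

end Dynamics

end EPRate

end

noncomputable section

set_option linter.unusedSectionVars false

open Filter Topology Set
open scoped ENNReal InnerProductSpace

namespace EPRate

universe u

variable {H : Type u} [NormedAddCommGroup H] [InnerProductSpace ℂ H] [CompleteSpace H]

/-! ### Traces of positive operators -/

section Trace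

variable {ι κ : Type*}

/-! Write φ(l) for the mixture, e(l) for the entropy rate at φ(l), D for the relative entropy, and
F(t) = D(ρ(t)‖φ(t)) + S(ρ(t)). Formally F(t) is the cross entropy -tr ρ(t) ln φ(t), which is affine
in its first argument (`relEntropy_add_entropy`, `relEntropy_add_entropy_mix`). Comparing times 0
and t, and using D(φ(l)(t)‖φ(t)) ≤ D(φ(l)‖φ), one gets l (F(t) - F(0)) ≤ ΔS(φ(l)) - (1 - l) ΔS(φ),
where ΔS is the entropy gained up to time t (`entropyGain_mix`). Because φ ≥ αρ, φ(l) is still a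
state for small negative l, so the inequality holds for both signs of l. Dividing by l t, then
letting t → 0 and l → 0 from either side, squeezes F'(0) = e(0) + e'(0)
(`tendsto_div_of_forall_slope_le`).

Minimality enters once: Q is affine along the segment, also for l < 0, so e(l) + Q(φ(l)) has an
interior minimum at l = 0 and e'(0) = Q(φ) - Q(ρ). Subtracting the entropy rate of ρ from F'(0)
gives the EP rate of φ minus that of ρ (`mismatchCostIdentity_of_entropyRates`). What remains is
differentiability of e at 0. In (a) it is read off from the smoothness condition; in (b) it is
proved.

The data-processing inequality `relEntropy_map_le` is proved in any separable dimension. The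
relative entropy is an integral over s > 0 of the quadratic quantities `quadRelEntropy`, and each of
these decreases under a channel: it is the maximum of 2 Re tr((φ - ρ)Y) - tr(φYY*) - s tr(ρY*Y) up
to ordering conventions, and a finite-rank test operator after the channel pulls back to one before
it, at no larger quadratic cost by the Schwarz inequalities of the dual map.

In finite dimensions the semigroup has a bounded generator G. Klein's inequality with ln(σ + t²) in
place of ln σ pins down the entropy rate: it is -tr(G(ω) ln ω) if the block of G(ω) on ker ω
vanishes, and +∞ otherwise. A finite EP rate at φ kills the block there, and positivity of the
semigroup then kills it for all φ(l) near l = 0. Near l = 0 the nonzero spectrum of φ(l) stays away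
from 0, so ln φ(l) is differentiable at l = 0, and hence so is e. -/

lemma exists_isSelfAdjoint_mul_self {A : H →L[ℂ] H} (hA : A.IsPositive) :
    ∃ B : H →L[ℂ] H, IsSelfAdjoint B ∧ A = B * B := by
  have h0 : 0 ≤ A := (ContinuousLinearMap.nonneg_iff_isPositive A).2 hA
  exact ⟨CFC.sqrt A, (CFC.sqrt_nonneg A).isSelfAdjoint, (CFC.sqrt_mul_sqrt_self A h0).symm⟩

lemma inner_apply_comm {B : H →L[ℂ] H} (hB : IsSelfAdjoint B) (u v : H) :
    ⟪u, B v⟫_ℂ = ⟪B u, v⟫_ℂ := by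
  rw [← ContinuousLinearMap.adjoint_inner_left, hB.adjoint_eq]

lemma inner_mul_self_apply {B : H →L[ℂ] H} (hB : IsSelfAdjoint B) (v : H) :
    ⟪v, (B * B) v⟫_ℂ = ((‖B v‖ ^ 2 : ℝ) : ℂ) := by
  change ⟪v, B (B v)⟫_ℂ = _
  rw [inner_apply_comm hB, inner_self_eq_norm_sq_to_K]
  norm_cast

lemma isPositive_inner_eq_re {A : H →L[ℂ] H} (hA : A.IsPositive) (v : H) :
    ⟪v, A v⟫_ℂ = (((⟪v, A v⟫_ℂ).re : ℝ) : ℂ) := by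
  obtain ⟨B, hB, rfl⟩ := exists_isSelfAdjoint_mul_self hA
  rw [inner_mul_self_apply hB, Complex.ofReal_re]

lemma isPositive_re_nonneg {A : H →L[ℂ] H} (hA : A.IsPositive) (v : H) :
    0 ≤ (⟪v, A v⟫_ℂ).re := hA.re_inner_nonneg_right v

lemma isPositive_of_forall_eq_re {A : H →L[ℂ] H}
    (h : ∀ v, ∃ x : ℝ, 0 ≤ x ∧ ⟪v, A v⟫_ℂ = x) : A.IsPositive := by
  rw [ContinuousLinearMap.isPositive_iff_complex]
  intro v
  obtain ⟨x, hx, hv⟩ := h v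
  have : ⟪A v, v⟫_ℂ = x := by
    rw [← inner_conj_symm, hv, Complex.conj_ofReal]
  rw [this]
  simp [hx]

lemma hasSum_norm_inner_sq (b : HilbertBasis ι ℂ H) (v : H) :
    HasSum (fun i => ‖⟪b i, v⟫_ℂ‖ ^ 2) (‖v‖ ^ 2) := by
  have h := Complex.hasSum_re (b.hasSum_inner_mul_inner v v)
  convert h using 1
  · ext i
    rw [← inner_conj_symm v (b i), mul_comm, Complex.mul_conj, Complex.ofReal_re,
      Complex.normSq_eq_norm_sq]
  · rw [inner_self_eq_norm_sq_to_K]; norm_cast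

lemma tsum_ofReal_norm_inner_sq (b : HilbertBasis ι ℂ H) (v : H) :
    ∑' i, ENNReal.ofReal (‖⟪b i, v⟫_ℂ‖ ^ 2) = ENNReal.ofReal (‖v‖ ^ 2) := by
  rw [← ENNReal.ofReal_tsum_of_nonneg (fun _ => by positivity) (hasSum_norm_inner_sq b v).summable,
    (hasSum_norm_inner_sq b v).tsum_eq]

/-- With A = B², both sides are the squared Hilbert–Schmidt norm of B: Parseval in the other basis,
then Tonelli. -/
lemma tsum_ofReal_inner_eq {A : H →L[ℂ] H} (hA : A.IsPositive) (b : HilbertBasis ι ℂ H)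
    (c : HilbertBasis κ ℂ H) :
    ∑' i, ENNReal.ofReal (⟪b i, A (b i)⟫_ℂ).re = ∑' j, ENNReal.ofReal (⟪c j, A (c j)⟫_ℂ).re := by
  obtain ⟨B, hB, rfl⟩ := exists_isSelfAdjoint_mul_self hA
  simp only [inner_mul_self_apply hB, Complex.ofReal_re]
  calc ∑' i, ENNReal.ofReal (‖B (b i)‖ ^ 2)
      = ∑' i, ∑' j, ENNReal.ofReal (‖⟪c j, B (b i)⟫_ℂ‖ ^ 2) := by
        simp only [tsum_ofReal_norm_inner_sq]
    _ = ∑' j, ∑' i, ENNReal.ofReal (‖⟪c j, B (b i)⟫_ℂ‖ ^ 2) := ENNReal.tsum_comm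
    _ = ∑' j, ∑' i, ENNReal.ofReal (‖⟪b i, B (c j)⟫_ℂ‖ ^ 2) := by
        refine tsum_congr fun j => tsum_congr fun i => ?_
        rw [inner_apply_comm hB, ← inner_conj_symm, RCLike.norm_conj]
    _ = ∑' j, ENNReal.ofReal (‖B (c j)‖ ^ 2) := by simp only [tsum_ofReal_norm_inner_sq]

lemma posTrace_eq_tsum {A : H →L[ℂ] H} (hA : A.IsPositive) (b : HilbertBasis ι ℂ H) :
    posTrace A = ∑' i, ENNReal.ofReal (⟪b i, A (b i)⟫_ℂ).re :=
  tsum_ofReal_inner_eq hA _ b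

lemma ofReal_re_inner_le_posTrace {A : H →L[ℂ] H} (hA : A.IsPositive) (v : H) :
    ENNReal.ofReal (⟪v, A v⟫_ℂ).re ≤ posTrace A * ENNReal.ofReal (‖v‖ ^ 2) := by
  obtain ⟨B, hB, rfl⟩ := exists_isSelfAdjoint_mul_self hA
  simp only [posTrace, inner_mul_self_apply hB, Complex.ofReal_re]
  rw [← tsum_ofReal_norm_inner_sq (basis H), ← ENNReal.tsum_mul_right]
  refine ENNReal.tsum_le_tsum fun i => ?_
  rw [← ENNReal.ofReal_mul (by positivity), inner_apply_comm hB, ← mul_pow]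
  exact ENNReal.ofReal_le_ofReal (by gcongr; exact norm_inner_le_norm _ _)

lemma norm_le_of_re_inner_le {A : H →L[ℂ] H} (hA : A.IsPositive) {M : ℝ} (hM : 0 ≤ M)
    (h : ∀ v, (⟪v, A v⟫_ℂ).re ≤ M * ‖v‖ ^ 2) : ‖A‖ ≤ M := by
  obtain ⟨B, hB, rfl⟩ := exists_isSelfAdjoint_mul_self hA
  simp only [inner_mul_self_apply hB, Complex.ofReal_re] at h
  have hB' : ‖B‖ ≤ √M := by
    refine B.opNorm_le_bound (Real.sqrt_nonneg _) fun v => ?_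
    refine (sq_le_sq₀ (norm_nonneg _) (by positivity)).1 ?_
    rw [mul_pow, Real.sq_sqrt hM]; exact h v
  calc ‖B * B‖ ≤ ‖B‖ * ‖B‖ := norm_mul_le _ _
    _ ≤ √M * √M := by gcongr
    _ = M := Real.mul_self_sqrt hM

lemma norm_le_toReal_posTrace {A : H →L[ℂ] H} (hA : A.IsPositive) (h : posTrace A ≠ ⊤) :
    ‖A‖ ≤ (posTrace A).toReal := by
  refine norm_le_of_re_inner_le hA ENNReal.toReal_nonneg fun v => ?_
  have := ofReal_re_inner_le_posTrace hA v
  rwa [← ENNReal.ofReal_toReal h, ← ENNReal.ofReal_mul ENNReal.toReal_nonneg,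
    ENNReal.ofReal_le_ofReal_iff (by positivity)] at this

lemma hasSum_inner_posTrace {A : H →L[ℂ] H} (hA : A.IsPositive) (h : posTrace A ≠ ⊤)
    (b : HilbertBasis ι ℂ H) :
    HasSum (fun i => ⟪b i, A (b i)⟫_ℂ) ((posTrace A).toReal : ℂ) := by
  have h1 : HasSum (fun i => (⟪b i, A (b i)⟫_ℂ).re) (posTrace A).toReal := by
    rw [posTrace_eq_tsum hA b] at h ⊢
    have := ENNReal.hasSum_toReal h
    rw [ENNReal.tsum_toReal_eq (fun _ => ENNReal.ofReal_ne_top)]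
    simpa only [ENNReal.toReal_ofReal (isPositive_re_nonneg hA _)] using this
  have h2 := Complex.hasSum_ofReal.2 h1
  simpa only [← isPositive_inner_eq_re hA] using h2

/-- `trace` is a `tsum`, which defaults to 0, so convergence has to be shown along with basis
independence. Both pass from positive operators to their span. -/
lemma hasSum_inner_trace (A : traceClass H) (b : HilbertBasis ι ℂ H) :
    HasSum (fun i => ⟪b i, (A : H →L[ℂ] H) (b i)⟫_ℂ) (trace A) := by
  have key : ∀ A ∈ traceClass H, ∃ x : ℂ, (HasSum (fun i => ⟪b i, A (b i)⟫_ℂ) x) ∧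
      HasSum (fun i => ⟪basis H i, A (basis H i)⟫_ℂ) x := by
    intro A hA
    induction hA using Submodule.span_induction with
    | mem A hA => exact ⟨_, hasSum_inner_posTrace hA.1 hA.2.ne b, hasSum_inner_posTrace hA.1 hA.2.ne _⟩
    | zero => exact ⟨0, by simp [hasSum_zero], by simp [hasSum_zero]⟩
    | add A B _ _ hA hB =>
      obtain ⟨x, h1, h2⟩ := hA
      obtain ⟨y, h3, h4⟩ := hB
      exact ⟨x + y, by simpa [inner_add_right] using h1.add h3,
        by simpa [inner_add_right] using h2.add h4⟩
    | smul c A _ hA =>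
      obtain ⟨x, h1, h2⟩ := hA
      exact ⟨c * x, by simpa [inner_smul_right] using h1.mul_left c,
        by simpa [inner_smul_right] using h2.mul_left c⟩
  obtain ⟨x, h1, h2⟩ := key A A.2
  have : trace A = x := h2.tsum_eq
  rwa [this]

lemma trace_add (A B : traceClass H) : trace (A + B) = trace A + trace B := by
  refine (hasSum_inner_trace (A + B) (basis H)).unique ?_
  simpa [inner_add_right] using (hasSum_inner_trace A (basis H)).add (hasSum_inner_trace B (basis H))

lemma trace_smul (c : ℂ) (A : traceClass H) : trace (c • A) = c * trace A := by
  refine (hasSum_inner_trace (c • A) (basis H)).unique ?_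
  simpa [inner_smul_right] using (hasSum_inner_trace A (basis H)).mul_left c

lemma trace_sub (A B : traceClass H) : trace (A - B) = trace A - trace B := by
  rw [sub_eq_add_neg, trace_add, ← neg_one_smul ℂ B, trace_smul]; ring

lemma trace_sum (s : Finset ι) (A : ι → traceClass H) :
    trace (∑ i ∈ s, A i) = ∑ i ∈ s, trace (A i) := by
  classical
  induction s using Finset.induction_on with
  | empty => simpa using trace_smul (0 : ℂ) (0 : traceClass H)
  | insert i s hi ih => rw [Finset.sum_insert hi, Finset.sum_insert hi, trace_add, ih]

lemma posTrace_eq_ofReal_trace (A : traceClass H) (hA : (A : H →L[ℂ] H).IsPositive) :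
    posTrace (A : H →L[ℂ] H) = ENNReal.ofReal (trace A).re := by
  have h := Complex.hasSum_re (hasSum_inner_trace A (basis H))
  rw [posTrace, ← h.tsum_eq, ENNReal.ofReal_tsum_of_nonneg (fun i => isPositive_re_nonneg hA _)
    h.summable]

lemma posTrace_ne_top (A : traceClass H) (hA : (A : H →L[ℂ] H).IsPositive) :
    posTrace (A : H →L[ℂ] H) ≠ ⊤ := by
  rw [posTrace_eq_ofReal_trace A hA]; exact ENNReal.ofReal_ne_top

lemma trace_re_nonneg (A : traceClass H) (hA : (A : H →L[ℂ] H).IsPositive) :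
    0 ≤ (trace A).re :=
  (Complex.hasSum_re (hasSum_inner_trace A (basis H))).nonneg fun _ => isPositive_re_nonneg hA _

lemma norm_le_trace_re (A : traceClass H) (hA : (A : H →L[ℂ] H).IsPositive) :
    ‖(A : H →L[ℂ] H)‖ ≤ (trace A).re := by
  have := norm_le_toReal_posTrace hA (posTrace_ne_top A hA)
  rwa [posTrace_eq_ofReal_trace A hA, ENNReal.toReal_ofReal (trace_re_nonneg A hA)] at this

lemma IsState.posTrace_eq_one {ω : traceClass H} (hω : IsState ω) :
    posTrace (ω : H →L[ℂ] H) = 1 := by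
  rw [posTrace_eq_ofReal_trace ω hω.1, hω.2]; simp

lemma IsState.norm_le_one {ω : traceClass H} (hω : IsState ω) : ‖(ω : H →L[ℂ] H)‖ ≤ 1 := by
  simpa [hω.2] using norm_le_trace_re ω hω.1

end Trace

/-! ### Compactness and eigenbases -/

section Eigenbasis

variable {ι κ : Type*}

lemma isCompactOperator_sum_rankOne (s : Finset ι) (x y : ι → H) :
    IsCompactOperator (∑ i ∈ s, InnerProductSpace.rankOne ℂ (x i) (y i) : H →L[ℂ] H) := by
  classical
  have h1 : ∀ i, IsCompactOperator (InnerProductSpace.rankOne ℂ (x i) (y i) : H →L[ℂ] H) := by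
    intro i
    rw [InnerProductSpace.rankOne_def']
    exact ((isCompactOperator_of_locallyCompactSpace_rng
      (ContinuousLinearMap.toSpanSingleton ℂ (x i))).comp_clm (innerSL ℂ (y i)) :)
  induction s using Finset.induction_on with
  | empty => simpa using! (isCompactOperator_zero : IsCompactOperator (0 : H → H))
  | insert i s hi ih => rw [Finset.sum_insert hi]; exact (h1 i).add ih

/-- The square root B of A is Hilbert–Schmidt, hence a norm limit of finite-rank operators; A = B²
inherits compactness. -/
lemma isCompactOperator_of_posTrace {A : H →L[ℂ] H} (hA : A.IsPositive) (h : posTrace A ≠ ⊤) :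
    IsCompactOperator A := by
  classical
  obtain ⟨B, hB, rfl⟩ := exists_isSelfAdjoint_mul_self hA
  have hs : Summable fun i => ‖B (basis H i)‖ ^ 2 := by
    have := (Complex.hasSum_re (hasSum_inner_posTrace hA h (basis H))).summable
    simpa only [inner_mul_self_apply hB, Complex.ofReal_re] using this
  let b := basis H
  suffices hBc : IsCompactOperator B from hBc.clm_comp B
  -- `F s` is B followed by the projection onto the span of the `b i`, `i ∈ s`; the error is
  -- controlled by the tail of ∑ ‖B bᵢ‖².
  let F : Finset (basisIndex H) → H →L[ℂ] H := fun s =>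
    ∑ i ∈ s, InnerProductSpace.rankOne ℂ (b i) (B (b i))
  have hF : ∀ s v, ‖(B - F s) v‖ ^ 2 ≤ (∑' i : {i // i ∉ s}, ‖B (b i)‖ ^ 2) * ‖v‖ ^ 2 := by
    intro s v
    have hcoef : ∀ i, ⟪b i, (B - F s) v⟫_ℂ = if i ∈ s then 0 else ⟪B (b i), v⟫_ℂ := by
      intro i
      simp only [F, sub_apply, inner_sub_right, sum_apply,
        inner_sum, InnerProductSpace.rankOne_apply, inner_smul_right,
        orthonormal_iff_ite.1 b.orthonormal, mul_ite, mul_one, mul_zero,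
        Finset.sum_ite_eq, inner_apply_comm hB]
      split_ifs <;> simp
    have h1 := hasSum_norm_inner_sq b ((B - F s) v)
    have h2 : Summable fun i => (if i ∈ s then 0 else ‖B (b i)‖ ^ 2) * ‖v‖ ^ 2 := by
      refine Summable.mul_right _ (Summable.of_nonneg_of_le (fun i => ?_) (fun i => ?_) hs)
      · split_ifs <;> positivity
      · split_ifs
        · positivity
        · exact le_rfl
    rw [← h1.tsum_eq]
    calc _ ≤ ∑' i, (if i ∈ s then 0 else ‖B (b i)‖ ^ 2) * ‖v‖ ^ 2 := by
          refine h1.summable.tsum_le_tsum (fun i => ?_) h2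
          rw [hcoef]
          split_ifs
          · simp
          · rw [← mul_pow]; gcongr; exact norm_inner_le_norm _ _
      _ = _ := by
          rw [tsum_mul_right]
          congr 1
          refine Eq.trans ?_ (tsum_subtype {i | i ∉ s} (fun i => ‖B (b i)‖ ^ 2)).symm
          refine tsum_congr fun i => ?_
          by_cases hi : i ∈ s <;> simp [hi]
  have hlim := tendsto_tsum_compl_atTop_zero (fun i => ‖B (b i)‖ ^ 2)
  have hFB : Tendsto F atTop (𝓝 B) := by
    rw [tendsto_iff_norm_sub_tendsto_zero]
    have hsq : Tendsto (fun s : Finset (basisIndex H) => √(∑' i : {i // i ∉ s}, ‖B (b i)‖ ^ 2))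
        atTop (𝓝 0) := by simpa using hlim.sqrt
    refine squeeze_zero (fun _ => norm_nonneg _) (fun s => ?_) hsq
    rw [norm_sub_rev]
    refine ContinuousLinearMap.opNorm_le_bound _ (Real.sqrt_nonneg _) fun v => ?_
    refine (sq_le_sq₀ (norm_nonneg _) (by positivity)).1 ?_
    rw [mul_pow, Real.sq_sqrt (tsum_nonneg fun _ => by positivity)]
    exact hF s v
  exact isCompactOperator_of_tendsto hFB (Eventually.of_forall fun s =>
    isCompactOperator_sum_rankOne s _ _)

/-- `b` is an orthonormal eigenbasis of `A` with eigenvalues `p`. -/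
def IsEigenbasis (A : H →L[ℂ] H) (b : HilbertBasis ι ℂ H) (p : ι → ℝ) : Prop :=
  ∀ i, A (b i) = (p i : ℂ) • b i

theorem exists_isEigenbasis {A : H →L[ℂ] H} (hA : A.IsPositive) (h : posTrace A ≠ ⊤) :
    ∃ (ι : Type u) (b : HilbertBasis ι ℂ H) (p : ι → ℝ), IsEigenbasis A b p := by
  have hc := isCompactOperator_of_posTrace hA h
  have hs : (A : H →ₗ[ℂ] H).IsSymmetric := hA.isSymmetric
  have horth := hs.orthogonalFamily_eigenspaces
  have hclosed : ∀ μ : ℂ, CompleteSpace (Module.End.eigenspace (A : H →ₗ[ℂ] H) μ) := by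
    intro μ
    have : IsClosed ((Module.End.eigenspace (A : H →ₗ[ℂ] H) μ : Submodule ℂ H) : Set H) := by
      have : ((Module.End.eigenspace (A : H →ₗ[ℂ] H) μ : Submodule ℂ H) : Set H) =
          {v | A v = μ • v} := by
        ext v; simp
      rw [this]
      exact isClosed_eq A.continuous (continuous_const_smul μ)
    exact this.completeSpace_coe
  choose w b hb using fun μ : ℂ =>
    exists_hilbertBasis ℂ (Module.End.eigenspace (A : H →ₗ[ℂ] H) μ)
  have hon := horth.orthonormal_sigma_orthonormal (v_family := fun μ => (b μ : w μ → _))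
    (fun μ => (b μ).orthonormal)
  have hperp : (Submodule.span ℂ (Set.range fun a : Σ μ, w μ => ((b a.1 a.2 :
      Module.End.eigenspace (A : H →ₗ[ℂ] H) a.1) : H)))ᗮ = ⊥ := by
    -- Eigenspaces of a compact self-adjoint operator are total, so gluing orthonormal bases of all
    -- of them, kernel included, gives a basis of H.
    rw [eq_bot_iff, ← ContinuousLinearMap.orthogonalComplement_iSup_eigenspaces_eq_bot hc hs]
    intro v hv
    rw [Submodule.mem_orthogonal] at hv ⊢
    have hle : (⨆ μ, Module.End.eigenspace (A : H →ₗ[ℂ] H) μ) ≤ (ℂ ∙ v)ᗮ := by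
      refine iSup_le fun μ u hu => ?_
      rw [Submodule.mem_orthogonal_singleton_iff_inner_left]
      have h1 := (b μ).hasSum_repr ⟨u, hu⟩
      have h2 := (h1.mapL (Submodule.subtypeL _)).mapL (innerSL ℂ v)
      have h3 : ∀ i, (innerSL ℂ v) ((Submodule.subtypeL _)
          ((b μ).repr ⟨u, hu⟩ i • (b μ i))) = 0 := by
        intro i
        have := hv _ (Submodule.subset_span ⟨⟨μ, i⟩, rfl⟩)
        simp only [map_smul, Submodule.subtypeL_apply, innerSL_apply_apply, smul_eq_mul]
        rw [← inner_conj_symm, this]; simp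
      simp only [h3] at h2
      have := h2.unique hasSum_zero
      simpa [inner_eq_zero_symm] using this
    intro u hu
    have := hle hu
    rwa [Submodule.mem_orthogonal_singleton_iff_inner_left] at this
  let B := HilbertBasis.mkOfOrthogonalEqBot hon hperp
  have hB : ∀ a, B a = ((b a.1 a.2 : Module.End.eigenspace (A : H →ₗ[ℂ] H) a.1) : H) := fun a =>
    congrFun (HilbertBasis.coe_mkOfOrthogonalEqBot hon hperp) a
  refine ⟨_, B, fun a => a.1.re, ?_⟩
  rintro ⟨μ, j⟩
  rw [hB]
  have hmem := (b μ j).2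
  rw [Module.End.mem_eigenspace_iff] at hmem
  have hne : ((b μ j : Module.End.eigenspace (A : H →ₗ[ℂ] H) μ) : H) ≠ 0 := by
    rw [← hB ⟨μ, j⟩]; exact B.orthonormal.ne_zero _
  have hev : Module.End.HasEigenvalue (A : H →ₗ[ℂ] H) μ :=
    Module.End.hasEigenvalue_of_hasEigenvector ⟨by rw [Module.End.mem_eigenspace_iff]; exact hmem, hne⟩
  have hμ := hs.conj_eigenvalue_eq_self hev
  rw [Complex.conj_eq_iff_re.1 hμ]
  exact hmem

lemma IsState.exists_isEigenbasis {ω : traceClass H} (hω : IsState ω) :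
    ∃ (ι : Type u) (b : HilbertBasis ι ℂ H) (p : ι → ℝ), IsEigenbasis (ω : H →L[ℂ] H) b p :=
  EPRate.exists_isEigenbasis hω.1 (posTrace_ne_top ω hω.1)

end Eigenbasis

/-! ### Functional calculus, entropy and relative entropy in eigenbases -/

section EigenbasisFormulas

variable {ι κ : Type*}

lemma mem_spectrum_of_eigenvector {A : H →L[ℂ] H} {v : H} (hv0 : v ≠ 0) {p : ℝ}
    (hv : A v = (p : ℂ) • v) : p ∈ spectrum ℝ A := by
  rw [spectrum.mem_iff]
  intro hu
  obtain ⟨B, hB⟩ := hu.exists_left_inv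
  have h1 : (algebraMap ℝ (H →L[ℂ] H) p - A) v = 0 := by
    rw [sub_apply, hv, Algebra.algebraMap_eq_smul_one]
    simp
  apply hv0
  calc v = (B * (algebraMap ℝ (H →L[ℂ] H) p - A)) v := by rw [hB]; rfl
    _ = B ((algebraMap ℝ (H →L[ℂ] H) p - A) v) := rfl
    _ = 0 := by rw [h1, map_zero]

/-- The functions with this property form a closed subalgebra of C(spectrum) containing the
identity, so Stone–Weierstrass applies. -/
lemma cfc_apply_eigenvector {A : H →L[ℂ] H} (hA : IsSelfAdjoint A) {f : ℝ → ℝ}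
    (hf : ContinuousOn f (spectrum ℝ A)) {v : H} {p : ℝ} (hv : A v = (p : ℂ) • v) :
    cfc f A v = (f p : ℂ) • v := by
  by_cases hv0 : v = 0
  · simp [hv0]
  have hp := mem_spectrum_of_eigenvector hv0 hv
  have key : ∀ g : C(spectrum ℝ A, ℝ), cfcHom hA g v = ((g ⟨p, hp⟩ : ℝ) : ℂ) • v := by
    intro g
    have := ContinuousFunctionalCalculus.isCompact_spectrum (R := ℝ) A
    have : CompactSpace (spectrum ℝ A) := isCompact_iff_compactSpace.1 this
    induction g using ContinuousMap.induction_on_of_compact with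
    | const c =>
      have : (ContinuousMap.const (spectrum ℝ A) c) = algebraMap ℝ C(spectrum ℝ A, ℝ) c := rfl
      rw [this, AlgHomClass.commutes, Algebra.algebraMap_eq_smul_one]
      simp
    | id => rw [cfcHom_id hA]; simpa using hv
    | star_id => rw [map_star, cfcHom_id hA, hA.star_eq]; simpa using hv
    | add f g hf hg => rw [map_add, add_apply, hf, hg]; simp [add_smul]
    | mul f g hf hg =>
      rw [map_mul]
      change cfcHom hA f (cfcHom hA g v) = _
      rw [hg, map_smul, hf, smul_smul]
      simp [mul_comm]
    | frequently f hf =>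
      have hcl : IsClosed {g : C(spectrum ℝ A, ℝ) | cfcHom hA g v = ((g ⟨p, hp⟩ : ℝ) : ℂ) • v} := by
        refine isClosed_eq ?_ ?_
        · exact (ContinuousLinearMap.apply ℂ H v).continuous.comp (cfcHom_continuous hA)
        · exact (Complex.continuous_ofReal.comp (continuous_eval_const _)).smul
            continuous_const
      exact hcl.mem_of_frequently_of_tendsto hf tendsto_id
  rw [cfc_apply f A hA hf, key]
  rfl

lemma isPositive_cfc {A : H →L[ℂ] H} {f : ℝ → ℝ} (h : ∀ x ∈ spectrum ℝ A, 0 ≤ f x) :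
    (cfc f A).IsPositive :=
  (ContinuousLinearMap.nonneg_iff_isPositive _).1 (cfc_nonneg h)

lemma IsState.spectrum_subset {ω : traceClass H} (hω : IsState ω) :
    spectrum ℝ (ω : H →L[ℂ] H) ⊆ Icc 0 1 := by
  intro x hx
  refine ⟨spectrum_nonneg_of_nonneg ((ContinuousLinearMap.nonneg_iff_isPositive _).2 hω.1) hx, ?_⟩
  have h1 := spectrum.norm_le_norm_mul_of_mem hx
  rw [ContinuousLinearMap.one_def] at h1
  have h2 : ‖ContinuousLinearMap.id ℂ H‖ ≤ 1 := ContinuousLinearMap.norm_id_le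
  have h3 := hω.norm_le_one
  calc x ≤ ‖x‖ := Real.le_norm_self x
    _ ≤ _ := h1
    _ ≤ 1 * 1 := by gcongr
    _ = 1 := one_mul 1

lemma IsEigenbasis.re_inner_self {A : H →L[ℂ] H} {b : HilbertBasis ι ℂ H} {p : ι → ℝ}
    (hb : IsEigenbasis A b p) (i : ι) : (⟪b i, A (b i)⟫_ℂ).re = p i := by
  rw [hb i, inner_smul_right, inner_self_eq_norm_sq_to_K, b.orthonormal.1 i]
  simp

lemma IsEigenbasis.nonneg {A : H →L[ℂ] H} (hA : A.IsPositive) {b : HilbertBasis ι ℂ H} {p : ι → ℝ}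
    (hb : IsEigenbasis A b p) (i : ι) : 0 ≤ p i := by
  rw [← hb.re_inner_self i]; exact isPositive_re_nonneg hA _

lemma IsEigenbasis.le_one {ω : traceClass H} (hω : IsState ω) {b : HilbertBasis ι ℂ H} {p : ι → ℝ}
    (hb : IsEigenbasis (ω : H →L[ℂ] H) b p) (i : ι) : p i ≤ 1 := by
  exact (hω.spectrum_subset (mem_spectrum_of_eigenvector (b.orthonormal.ne_zero i) (hb i))).2

lemma IsEigenbasis.tsum_eq_one {ω : traceClass H} (hω : IsState ω) {b : HilbertBasis ι ℂ H}
    {p : ι → ℝ} (hb : IsEigenbasis (ω : H →L[ℂ] H) b p) : ∑' i, ENNReal.ofReal (p i) = 1 := by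
  rw [← hω.posTrace_eq_one, posTrace_eq_tsum hω.1 b]
  simp only [hb.re_inner_self]

lemma IsEigenbasis.hasSum_one {ω : traceClass H} (hω : IsState ω) {b : HilbertBasis ι ℂ H}
    {p : ι → ℝ} (hb : IsEigenbasis (ω : H →L[ℂ] H) b p) : HasSum p 1 := by
  have h := Complex.hasSum_re (hasSum_inner_trace ω b)
  rw [hω.2] at h
  simpa only [hb.re_inner_self, Complex.one_re] using h

lemma IsEigenbasis.inner_apply {A : H →L[ℂ] H} (hA : A.IsPositive) {b : HilbertBasis ι ℂ H}
    {p : ι → ℝ} (hb : IsEigenbasis A b p) (i : ι) (v : H) :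
    ⟪b i, A v⟫_ℂ = p i * ⟪b i, v⟫_ℂ := by
  rw [inner_apply_comm hA.isSelfAdjoint, hb i, inner_smul_left]
  simp

lemma IsEigenbasis.hasSum_re_inner {A : H →L[ℂ] H} (hA : A.IsPositive) {b : HilbertBasis ι ℂ H}
    {p : ι → ℝ} (hb : IsEigenbasis A b p) (v : H) :
    HasSum (fun i => p i * ‖⟪b i, v⟫_ℂ‖ ^ 2) (⟪v, A v⟫_ℂ).re := by
  have h := Complex.hasSum_re (b.hasSum_inner_mul_inner v (A v))
  convert h using 1
  ext i
  rw [hb.inner_apply hA, ← inner_conj_symm v (b i), mul_left_comm, Complex.re_ofReal_mul,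
    mul_comm (starRingEnd ℂ _), Complex.mul_conj, Complex.normSq_eq_norm_sq, Complex.ofReal_re]

lemma IsEigenbasis.tsum_ofReal_mul {A : H →L[ℂ] H} (hA : A.IsPositive) {b : HilbertBasis ι ℂ H}
    {p : ι → ℝ} (hb : IsEigenbasis A b p) (v : H) :
    ∑' i, ENNReal.ofReal (p i) * ENNReal.ofReal (‖⟪b i, v⟫_ℂ‖ ^ 2) =
      ENNReal.ofReal (⟪v, A v⟫_ℂ).re := by
  have h := hb.hasSum_re_inner hA v
  rw [← h.tsum_eq, ENNReal.ofReal_tsum_of_nonneg (fun i => mul_nonneg (hb.nonneg hA i)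
    (by positivity)) h.summable]
  exact tsum_congr fun i => (ENNReal.ofReal_mul (hb.nonneg hA i)).symm

theorem entropy_eq_tsum {ω : traceClass H} (hω : IsState ω) {b : HilbertBasis ι ℂ H} {p : ι → ℝ}
    (hb : IsEigenbasis (ω : H →L[ℂ] H) b p) :
    entropy ω = ∑' i, ENNReal.ofReal (Real.negMulLog (p i)) := by
  have hpos : (cfc Real.negMulLog (ω : H →L[ℂ] H)).IsPositive := isPositive_cfc fun x hx =>
    Real.negMulLog_nonneg (hω.spectrum_subset hx).1 (hω.spectrum_subset hx).2
  rw [entropy, posTrace_eq_tsum hpos b]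
  refine tsum_congr fun i => ?_
  rw [cfc_apply_eigenvector hω.1.isSelfAdjoint Real.continuous_negMulLog.continuousOn (hb i),
    inner_smul_right, inner_self_eq_norm_sq_to_K, b.orthonormal.1 i]
  simp

lemma eigenProj_apply_eq_self {A : H →L[ℂ] H} {v : H} {p : ℝ} (hv : A v = (p : ℂ) • v) :
    eigenProj A p v = v := by
  rw [eigenProj, Submodule.starProjection_eq_self_iff]
  simp [hv]

lemma eigenProj_apply_eq_zero {A : H →L[ℂ] H} (hA : IsSelfAdjoint A) {v : H} {p q : ℝ}
    (hv : A v = (p : ℂ) • v) (hpq : p ≠ q) : eigenProj A q v = 0 := by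
  rw [eigenProj, Submodule.starProjection_apply_eq_zero_iff, Submodule.mem_orthogonal]
  intro u hu
  have hu' : A u = (q : ℂ) • u := by
    have : A u - (q : ℂ) • u = 0 := by simpa using hu
    exact sub_eq_zero.1 this
  have h1 := inner_apply_comm hA u v
  rw [hv, hu', inner_smul_left, inner_smul_right, Complex.conj_ofReal, ← sub_eq_zero,
    ← sub_mul] at h1
  refine (mul_eq_zero.1 h1).resolve_left ?_
  rw [← Complex.ofReal_sub]
  exact_mod_cast sub_ne_zero.2 hpq

lemma eigenProj_isSelfAdjoint (A : H →L[ℂ] H) (p : ℝ) : IsSelfAdjoint (eigenProj A p) :=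
  isSelfAdjoint_starProjection _

lemma eigenProj_mul_self (A : H →L[ℂ] H) (p : ℝ) : eigenProj A p * eigenProj A p = eigenProj A p :=
  (Submodule.isIdempotentElem_starProjection _)

open scoped Classical in
lemma IsEigenbasis.eigenProj_apply {A : H →L[ℂ] H} (hA : IsSelfAdjoint A)
    {b : HilbertBasis ι ℂ H} {p : ι → ℝ} (hb : IsEigenbasis A b p) (q : ℝ) (i : ι) :
    eigenProj A q (b i) = if q = p i then b i else 0 := by
  split_ifs with h
  · rw [h]; exact eigenProj_apply_eq_self (hb i)
  · exact eigenProj_apply_eq_zero hA (hb i) (Ne.symm h)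

open scoped Classical in
lemma posTrace_eigenProj {A B : H →L[ℂ] H} (hA : IsSelfAdjoint A) (hB : IsSelfAdjoint B)
    {e : HilbertBasis ι ℂ H} {p : ι → ℝ} (he : IsEigenbasis A e p)
    {f : HilbertBasis κ ℂ H} {r : κ → ℝ} (hf : IsEigenbasis B f r) (x y : ℝ) :
    posTrace (eigenProj A x * eigenProj B y * eigenProj A x) =
      ∑' i, ∑' j, if x = p i then
        (if y = r j then ENNReal.ofReal (‖⟪f j, e i⟫_ℂ‖ ^ 2) else 0) else 0 := by
  have hform : ∀ v, ⟪v, (eigenProj A x * eigenProj B y * eigenProj A x) v⟫_ℂ =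
      ((‖eigenProj B y (eigenProj A x v)‖ ^ 2 : ℝ) : ℂ) := by
    intro v
    change ⟪v, eigenProj A x (eigenProj B y (eigenProj A x v))⟫_ℂ = _
    rw [inner_apply_comm (eigenProj_isSelfAdjoint A x), ← inner_mul_self_apply
      (eigenProj_isSelfAdjoint B y), eigenProj_mul_self]
  have hpos : (eigenProj A x * eigenProj B y * eigenProj A x).IsPositive :=
    isPositive_of_forall_eq_re fun v => ⟨_, by positivity, hform v⟩
  rw [posTrace_eq_tsum hpos e]
  refine tsum_congr fun i => ?_
  rw [hform, Complex.ofReal_re, he.eigenProj_apply hA]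
  split_ifs with h
  · rw [← tsum_ofReal_norm_inner_sq f]
    refine tsum_congr fun j => ?_
    rw [inner_apply_comm (eigenProj_isSelfAdjoint B y), hf.eigenProj_apply hB]
    split_ifs <;> simp
  · simp

/-- The summand `p ln p - p ln r + r - p` of the relative entropy. -/
def klTerm (p r : ℝ) : ℝ := p * Real.log p - p * Real.log r + r - p

lemma supp_le_iff {A B : H →L[ℂ] H} : supp A ≤ supp B ↔ ∀ v, B v = 0 → A v = 0 := by
  have hcl : ∀ C : H →L[ℂ] H, (LinearMap.ker (C : H →ₗ[ℂ] H)).HasOrthogonalProjection := fun C => by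
    have : CompleteSpace (LinearMap.ker (C : H →ₗ[ℂ] H)) := C.isClosed_ker.completeSpace_coe
    infer_instance
  have := hcl A
  have := hcl B
  rw [supp, supp, Submodule.orthogonal_le_orthogonal_iff]
  rfl

/-- Makes the convention `Real.log 0 = 0` harmless: wherever r = 0, either the weight or p vanishes.
-/
lemma mul_norm_inner_eq_zero {A B : H →L[ℂ] H} (hA : A.IsPositive)
    (hker : ∀ v, B v = 0 → A v = 0) {e : HilbertBasis ι ℂ H} {p : ι → ℝ}
    (he : IsEigenbasis A e p) {f : HilbertBasis κ ℂ H} {r : κ → ℝ} (hf : IsEigenbasis B f r)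
    (i : ι) (j : κ) (hr : r j = 0) : p i = 0 ∨ ‖⟪f j, e i⟫_ℂ‖ = 0 := by
  have h1 : A (f j) = 0 := hker _ (by rw [hf j, hr]; simp)
  have h2 := inner_apply_comm hA.isSelfAdjoint (f j) (e i)
  rw [h1, he i, inner_zero_left, inner_smul_right] at h2
  rcases mul_eq_zero.1 h2 with h | h
  · exact Or.inl (by exact_mod_cast h)
  · exact Or.inr (by rw [h, norm_zero])

/-- Sums over all reals and eigenprojections regroup into sums over eigenvectors. Only indices with
x = pᵢ and y = rⱼ survive, so degenerate eigenvalues need no separate treatment, and nonnegativity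
allows every interchange. -/
theorem relEntropy_eq_tsum {ρ φ : traceClass H}
    (hρ : (ρ : H →L[ℂ] H).IsPositive) (hφ : (φ : H →L[ℂ] H).IsPositive)
    (hker : ∀ v, (φ : H →L[ℂ] H) v = 0 → (ρ : H →L[ℂ] H) v = 0)
    {e : HilbertBasis ι ℂ H} {p : ι → ℝ} (he : IsEigenbasis (ρ : H →L[ℂ] H) e p)
    {f : HilbertBasis κ ℂ H} {r : κ → ℝ} (hf : IsEigenbasis (φ : H →L[ℂ] H) f r) :
    relEntropy ρ φ = ∑' i, ∑' j, ENNReal.ofReal (‖⟪f j, e i⟫_ℂ‖ ^ 2) *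
      ENNReal.ofReal (klTerm (p i) (r j)) := by
  classical
  rw [relEntropy, if_pos (supp_le_iff.2 hker)]
  simp only [posTrace_eigenProj hρ.isSelfAdjoint hφ.isSelfAdjoint he hf, ← ENNReal.tsum_mul_right]
  calc _ = ∑' (x : ℝ) (i : ι) (y : ℝ) (j : κ), (if x = p i then
        (if y = r j then ENNReal.ofReal (‖⟪f j, e i⟫_ℂ‖ ^ 2) else 0) else 0) *
          ENNReal.ofReal (klTerm x y) := by
        refine tsum_congr fun x => ?_
        rw [ENNReal.tsum_comm]
        rfl
    _ = ∑' (x : ℝ) (i : ι) (j : κ) (y : ℝ), (if x = p i then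
        (if y = r j then ENNReal.ofReal (‖⟪f j, e i⟫_ℂ‖ ^ 2) else 0) else 0) *
          ENNReal.ofReal (klTerm x y) :=
        tsum_congr fun x => tsum_congr fun i => ENNReal.tsum_comm
    _ = ∑' (x : ℝ) (i : ι), if x = p i then ∑' j, ENNReal.ofReal (‖⟪f j, e i⟫_ℂ‖ ^ 2) *
          ENNReal.ofReal (klTerm x (r j)) else 0 := by
        refine tsum_congr fun x => tsum_congr fun i => ?_
        split_ifs with h
        · refine tsum_congr fun j => ?_
          simp only [ite_mul, zero_mul]
          exact tsum_ite_eq (r j) (fun y => ENNReal.ofReal (‖⟪f j, e i⟫_ℂ‖ ^ 2) *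
            ENNReal.ofReal (klTerm x y))
        · simp
    _ = _ := by
        rw [ENNReal.tsum_comm]
        refine tsum_congr fun i => ?_
        exact tsum_ite_eq (p i) (fun x => ∑' j, ENNReal.ofReal (‖⟪f j, e i⟫_ℂ‖ ^ 2) *
          ENNReal.ofReal (klTerm x (r j)))

/-! ### Cross entropy -/

/-- The cross entropy `-tr (ω ln φ)`, evaluated in an eigenbasis `f` of `φ` with eigenvalues `r`. -/
def crossEntropy (ω : H →L[ℂ] H) (f : HilbertBasis κ ℂ H) (r : κ → ℝ) : ℝ≥0∞ :=
  ∑' j, ENNReal.ofReal (-Real.log (r j)) * ENNReal.ofReal (⟪f j, ω (f j)⟫_ℂ).re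

lemma klTerm_nonneg {p r : ℝ} (hp : 0 ≤ p) (hr : 0 ≤ r) (h : r = 0 → p = 0) : 0 ≤ klTerm p r := by
  rcases hp.eq_or_lt with rfl | hp
  · simpa [klTerm] using hr
  · have hr' : 0 < r := hr.lt_of_ne fun h0 => hp.ne' (h h0.symm)
    have h1 := Real.log_le_sub_one_of_pos (div_pos hr' hp)
    rw [Real.log_div hr'.ne' hp.ne'] at h1
    have h2 : p * (Real.log r - Real.log p) ≤ p * (r / p - 1) := by gcongr
    have h3 : p * (r / p - 1) = r - p := by field_simp
    rw [klTerm]; linarith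

/-- Stated as a sum in [0, ∞], so that it also holds when entropies are infinite and no subtraction
is needed. -/
theorem relEntropy_add_entropy {ω φ : traceClass H} (hω : IsState ω) (hφ : IsState φ)
    (hker : ∀ v, (φ : H →L[ℂ] H) v = 0 → (ω : H →L[ℂ] H) v = 0)
    {f : HilbertBasis κ ℂ H} {r : κ → ℝ} (hf : IsEigenbasis (φ : H →L[ℂ] H) f r) :
    relEntropy ω φ + entropy ω = crossEntropy (ω : H →L[ℂ] H) f r := by
  obtain ⟨ι, e, p, he⟩ := hω.exists_isEigenbasis
  have hwi : ∀ i, ∑' j, ENNReal.ofReal (‖⟪f j, e i⟫_ℂ‖ ^ 2) = 1 := fun i => by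
    rw [tsum_ofReal_norm_inner_sq, e.orthonormal.1 i]; simp
  have hwj : ∀ j, ∑' i, ENNReal.ofReal (‖⟪f j, e i⟫_ℂ‖ ^ 2) = 1 := fun j => by
    have := tsum_ofReal_norm_inner_sq e (f j)
    rw [f.orthonormal.1 j] at this
    simp only [norm_inner_symm (f j)]
    simpa using this
  have hS : entropy ω = ∑' i, ∑' j, ENNReal.ofReal (‖⟪f j, e i⟫_ℂ‖ ^ 2) *
      ENNReal.ofReal (Real.negMulLog (p i)) := by
    simp only [ENNReal.tsum_mul_right, hwi, one_mul]
    exact entropy_eq_tsum hω he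
  have h1 : (1 : ℝ≥0∞) = ∑' i, ∑' j, ENNReal.ofReal (‖⟪f j, e i⟫_ℂ‖ ^ 2) *
      ENNReal.ofReal (p i) := by
    simp only [ENNReal.tsum_mul_right, hwi, one_mul]
    exact (he.tsum_eq_one hω).symm
  have h2 : (1 : ℝ≥0∞) = ∑' i, ∑' j, ENNReal.ofReal (‖⟪f j, e i⟫_ℂ‖ ^ 2) *
      ENNReal.ofReal (r j) := by
    rw [ENNReal.tsum_comm]
    simp only [ENNReal.tsum_mul_right, hwj, one_mul]
    exact (hf.tsum_eq_one hφ).symm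
  have hC : crossEntropy (ω : H →L[ℂ] H) f r = ∑' i, ∑' j, ENNReal.ofReal (‖⟪f j, e i⟫_ℂ‖ ^ 2) *
      ENNReal.ofReal (p i * -Real.log (r j)) := by
    rw [ENNReal.tsum_comm, crossEntropy]
    refine tsum_congr fun j => ?_
    rw [← he.tsum_ofReal_mul hω.1, ← ENNReal.tsum_mul_left]
    refine tsum_congr fun i => ?_
    rw [ENNReal.ofReal_mul (he.nonneg hω.1 i), norm_inner_symm (f j)]
    ring
  -- The added 1 is written as ∑ w p on the left and ∑ w r on the right. Then the terms match one by
  -- one, since `klTerm p r` - p ln p + p = -p ln r + r.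
  refine (ENNReal.add_left_inj ENNReal.one_ne_top).1 ?_
  calc relEntropy ω φ + entropy ω + 1 = crossEntropy (ω : H →L[ℂ] H) f r + 1 := by
        nth_rewrite 1 [h1]
        nth_rewrite 1 [h2]
        rw [hC, hS, relEntropy_eq_tsum hω.1 hφ.1 hker he hf]
        simp only [← ENNReal.tsum_add]
        refine tsum_congr fun i => tsum_congr fun j => ?_
        simp only [← mul_add]
        have hp0 := he.nonneg hω.1 i
        have hp1 := he.le_one hω i
        have hr0 := hf.nonneg hφ.1 j
        have hr1 := hf.le_one hφ j
        by_cases hz : ‖⟪f j, e i⟫_ℂ‖ = 0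
        · simp [hz]
        have hz' : r j = 0 → p i = 0 := fun h =>
          (mul_norm_inner_eq_zero hω.1 hker he hf i j h).resolve_right hz
        have hlog : Real.log (r j) ≤ 0 := Real.log_nonpos hr0 hr1
        rw [← ENNReal.ofReal_add (klTerm_nonneg hp0 hr0 hz') (Real.negMulLog_nonneg hp0 hp1),
          ← ENNReal.ofReal_add (add_nonneg (klTerm_nonneg hp0 hr0 hz')
            (Real.negMulLog_nonneg hp0 hp1)) hp0,
          ← ENNReal.ofReal_add (mul_nonneg hp0 (by linarith)) hr0]
        congr 2
        rw [klTerm, Real.negMulLog]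
        ring

lemma crossEntropy_self {φ : traceClass H} (hφ : IsState φ) {f : HilbertBasis κ ℂ H} {r : κ → ℝ}
    (hf : IsEigenbasis (φ : H →L[ℂ] H) f r) :
    crossEntropy (φ : H →L[ℂ] H) f r = entropy φ := by
  rw [crossEntropy, entropy_eq_tsum hφ hf]
  refine tsum_congr fun j => ?_
  rw [hf.re_inner_self, mul_comm, ← ENNReal.ofReal_mul (hf.nonneg hφ.1 j), Real.negMulLog]
  congr 1; ring

lemma crossEntropy_add {A B : H →L[ℂ] H} (hA : A.IsPositive) (hB : B.IsPositive)
    (f : HilbertBasis κ ℂ H) (r : κ → ℝ) :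
    crossEntropy (A + B) f r = crossEntropy A f r + crossEntropy B f r := by
  simp only [crossEntropy, ← ENNReal.tsum_add, ← mul_add, add_apply, inner_add_right,
    Complex.add_re]
  refine tsum_congr fun j => ?_
  rw [ENNReal.ofReal_add (isPositive_re_nonneg hA _) (isPositive_re_nonneg hB _)]

lemma crossEntropy_smul {A : H →L[ℂ] H} {c : ℝ} (hc : 0 ≤ c)
    (f : HilbertBasis κ ℂ H) (r : κ → ℝ) :
    crossEntropy ((c : ℂ) • A) f r = ENNReal.ofReal c * crossEntropy A f r := by
  simp only [crossEntropy, ← ENNReal.tsum_mul_left]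
  refine tsum_congr fun j => ?_
  rw [smul_apply, inner_smul_right, Complex.re_ofReal_mul, ENNReal.ofReal_mul hc]
  ring

lemma crossEntropy_mono {A B : H →L[ℂ] H} (hAB : A ≤ B) (f : HilbertBasis κ ℂ H) (r : κ → ℝ) :
    crossEntropy A f r ≤ crossEntropy B f r := by
  refine ENNReal.tsum_le_tsum fun j => ?_
  refine mul_le_mul_right (ENNReal.ofReal_le_ofReal ?_) _
  have := isPositive_re_nonneg ((ContinuousLinearMap.le_def A B).1 hAB) (f j)
  rw [sub_apply, inner_sub_right, Complex.sub_re] at this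
  linarith

lemma Dominates.ker_le {φ ρ : traceClass H} (h : Dominates φ ρ) (hρ : (ρ : H →L[ℂ] H).IsPositive)
    (v : H) (hv : (φ : H →L[ℂ] H) v = 0) : (ρ : H →L[ℂ] H) v = 0 := by
  obtain ⟨α, hα, hle⟩ := h
  have h1 := isPositive_re_nonneg ((ContinuousLinearMap.le_def _ _).1 hle) v
  rw [sub_apply, inner_sub_right, hv, smul_apply, inner_smul_right, Complex.sub_re,
    Complex.re_ofReal_mul, inner_zero_right, Complex.zero_re] at h1
  obtain ⟨B, hB, hBB⟩ := exists_isSelfAdjoint_mul_self hρ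
  rw [hBB, inner_mul_self_apply hB, Complex.ofReal_re] at h1
  have h2 : ‖B v‖ ^ 2 = 0 := by
    have : 0 ≤ ‖B v‖ ^ 2 := by positivity
    nlinarith
  have h3 : B v = 0 := by simpa using h2
  rw [hBB]
  change B (B v) = 0
  rw [h3, map_zero]

end EigenbasisFormulas

/-! ### Rank-one operators and completely positive maps -/

section RankOne

lemma posTrace_rankOne_self_lt_top (x : H) :
    posTrace (InnerProductSpace.rankOne ℂ x x : H →L[ℂ] H) < ⊤ := by
  have : posTrace (InnerProductSpace.rankOne ℂ x x : H →L[ℂ] H) = ENNReal.ofReal (‖x‖ ^ 2) := by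
    rw [← tsum_ofReal_norm_inner_sq (basis H), posTrace]
    refine tsum_congr fun i => ?_
    rw [InnerProductSpace.rankOne_apply, inner_smul_right, ← inner_conj_symm x, mul_comm,
      Complex.mul_conj, Complex.ofReal_re, Complex.normSq_eq_norm_sq]
  rw [this]; exact ENNReal.ofReal_lt_top

/-- Polarization, as `traceClass` is spanned by positive operators. -/
lemma rankOne_mem_traceClass (x y : H) :
    (InnerProductSpace.rankOne ℂ x y : H →L[ℂ] H) ∈ traceClass H := by
  have hself : ∀ z : H, (InnerProductSpace.rankOne ℂ z z : H →L[ℂ] H) ∈ traceClass H := fun z =>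
    Submodule.subset_span ⟨InnerProductSpace.isPositive_rankOne_self z,
      posTrace_rankOne_self_lt_top z⟩
  have key : (InnerProductSpace.rankOne ℂ x y : H →L[ℂ] H) = (1 / 4 : ℂ) •
      (InnerProductSpace.rankOne ℂ (x + y) (x + y) - InnerProductSpace.rankOne ℂ (x - y) (x - y) +
        Complex.I • InnerProductSpace.rankOne ℂ (x + Complex.I • y) (x + Complex.I • y) -
        Complex.I • InnerProductSpace.rankOne ℂ (x - Complex.I • y) (x - Complex.I • y)) := by
    ext v
    simp only [InnerProductSpace.rankOne_apply, smul_apply, add_apply, sub_apply, inner_add_left,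
      inner_sub_left, inner_smul_left, Complex.conj_I]
    match_scalars
    · linear_combination (1 / 2) * ⟪y, v⟫_ℂ * Complex.I_sq
    · linear_combination (-1 / 2) * ⟪x, v⟫_ℂ * Complex.I_sq
  rw [key]
  exact (traceClass H).smul_mem _ (sub_mem (add_mem (sub_mem (hself _) (hself _))
    ((traceClass H).smul_mem _ (hself _))) ((traceClass H).smul_mem _ (hself _)))

/-- The rank-one operator `|x⟩⟨y|` as a trace-class operator. -/
def ketbra (x y : H) : traceClass H := ⟨InnerProductSpace.rankOne ℂ x y, rankOne_mem_traceClass x y⟩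

lemma ketbra_apply (x y v : H) : (ketbra x y : H →L[ℂ] H) v = ⟪y, v⟫_ℂ • x := rfl

lemma ketbra_isPositive (x : H) : (ketbra x x : H →L[ℂ] H).IsPositive :=
  InnerProductSpace.isPositive_rankOne_self x

lemma ketbra_add_left (x x' y : H) : ketbra (x + x') y = ketbra x y + ketbra x' y := by
  ext v; simp [ketbra_apply]

lemma ketbra_add_right (x y y' : H) : ketbra x (y + y') = ketbra x y + ketbra x y' := by
  ext v; simp [ketbra_apply, add_smul]

lemma ketbra_smul_left (c : ℂ) (x y : H) : ketbra (c • x) y = c • ketbra x y := by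
  ext v; simp [ketbra_apply, smul_smul, mul_comm]

lemma ketbra_smul_right (c : ℂ) (x y : H) :
    ketbra x (c • y) = (starRingEnd ℂ c) • ketbra x y := by
  ext v; simp [ketbra_apply, smul_smul, mul_comm]

lemma trace_ketbra (x y : H) : trace (ketbra x y) = ⟪y, x⟫_ℂ := by
  refine (hasSum_inner_trace (ketbra x y) (basis H)).unique ?_
  simpa [ketbra_apply, inner_smul_right] using (basis H).hasSum_inner_mul_inner y x

end RankOne

/-! ### Schwarz inequalities, dual maps and normality of channels -/

section CompletelyPositive

variable {Φ : traceClass H →ₗ[ℂ] traceClass H}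

lemma CompletelyPositive.isPositive (hΦ : CompletelyPositive Φ) {A : traceClass H}
    (hA : (A : H →L[ℂ] H).IsPositive) : (Φ A : H →L[ℂ] H).IsPositive := by
  have h := hΦ 1 (fun _ _ => A) (fun v => by simpa using hA.inner_nonneg_right (v 0))
  refine isPositive_of_forall_eq_re fun v => ?_
  have := h fun _ => v
  simp only [Finset.univ_unique, Finset.sum_singleton] at this
  refine ⟨_, (Complex.le_def.1 this).1, Complex.ext rfl ?_⟩
  exact (Complex.le_def.1 this).2.symm

lemma CompletelyPositive.isState (hΦ : CompletelyPositive Φ)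
    (htr : ∀ A, trace (Φ A) = trace A) {ω : traceClass H} (hω : IsState ω) : IsState (Φ ω) :=
  ⟨hΦ.isPositive hω.1, by rw [htr, hω.2]⟩

lemma blockPositive_ketbra {n : ℕ} (v : Fin n → H) :
    BlockPositive fun i j => ketbra (v i) (v j) := by
  intro x
  have : ∑ i, ∑ j, ⟪x i, (ketbra (v i) (v j) : H →L[ℂ] H) (x j)⟫_ℂ =
      (∑ i, ⟪x i, v i⟫_ℂ) * starRingEnd ℂ (∑ i, ⟪x i, v i⟫_ℂ) := by
    rw [map_sum, Finset.sum_mul_sum]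
    refine Finset.sum_congr rfl fun i _ => Finset.sum_congr rfl fun j _ => ?_
    rw [ketbra_apply, inner_smul_right, inner_conj_symm, mul_comm]
  rw [this, Complex.mul_conj]
  exact_mod_cast Complex.normSq_nonneg _

/-- Cauchy–Schwarz for a 2×2 form not assumed Hermitian: reality at c = 1 and c = i already forces
τ' to be the conjugate of τ. -/
lemma norm_sq_le_mul_of_forall_nonneg {a d : ℝ} (ha : 0 ≤ a) (hd : 0 ≤ d) {τ τ' : ℂ}
    (h : ∀ c : ℂ, ∃ x : ℝ, 0 ≤ x ∧ (a : ℂ) + c * τ + starRingEnd ℂ c * τ' +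
      (Complex.normSq c : ℂ) * d = x) : ‖τ‖ ^ 2 ≤ a * d := by
  have hτ : τ' = starRingEnd ℂ τ := by
    obtain ⟨x, -, hx⟩ := h 1
    obtain ⟨y, -, hy⟩ := h Complex.I
    have h1 := congrArg Complex.im hx
    have h2 := congrArg Complex.im hy
    simp at h1 h2
    apply Complex.ext <;> simp <;> linarith
  subst hτ
  have hre : ∀ x : ℝ, 0 ≤ (‖τ‖ ^ 2 * d) * (x * x) + (-2 * ‖τ‖ ^ 2) * x + a := by
    intro x
    -- This phase of c makes both cross terms equal to -x‖τ‖², leaving a real quadratic in x whose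
    -- discriminant is nonpositive.
    obtain ⟨y, hy0, hy⟩ := h (-(x : ℂ) * starRingEnd ℂ τ)
    have h1 := congrArg Complex.re hy
    have e1 : (-(x : ℂ) * starRingEnd ℂ τ) * τ = ((-x * ‖τ‖ ^ 2 : ℝ) : ℂ) := by
      rw [mul_assoc, mul_comm (starRingEnd ℂ τ), Complex.mul_conj, Complex.normSq_eq_norm_sq]
      push_cast; ring
    have e2 : starRingEnd ℂ (-(x : ℂ) * starRingEnd ℂ τ) * starRingEnd ℂ τ =
        ((-x * ‖τ‖ ^ 2 : ℝ) : ℂ) := by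
      rw [map_mul, map_neg, Complex.conj_ofReal, Complex.conj_conj, mul_assoc, Complex.mul_conj,
        Complex.normSq_eq_norm_sq]
      push_cast; ring
    have e3 : Complex.normSq (-(x : ℂ) * starRingEnd ℂ τ) = x ^ 2 * ‖τ‖ ^ 2 := by
      rw [Complex.normSq_mul, Complex.normSq_neg, Complex.normSq_conj, Complex.normSq_ofReal,
        Complex.normSq_eq_norm_sq]; ring
    rw [e1, e2, e3, ← Complex.ofReal_add, ← Complex.ofReal_add, ← Complex.ofReal_mul,
      ← Complex.ofReal_add, Complex.ofReal_re, Complex.ofReal_re] at h1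
    nlinarith
  have hdisc := discrim_le_zero hre
  rw [discrim] at hdisc
  by_cases h0 : ‖τ‖ ^ 2 = 0
  · rw [h0]; positivity
  · have hpos : 0 < ‖τ‖ ^ 2 := lt_of_le_of_ne (by positivity) (Ne.symm h0)
    have : ‖τ‖ ^ 2 * ‖τ‖ ^ 2 ≤ ‖τ‖ ^ 2 * (a * d) := by nlinarith
    exact le_of_mul_le_mul_left this hpos

/-- The 2×2 block operator built from |v⟩⟨v|, |v⟩⟨u|, |u⟩⟨v|, |u⟩⟨u| is positive. Apply
2-positivity, test on the vectors (zᵢ, c wᵢ), sum over i, and use Cauchy–Schwarz in c. -/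
lemma CompletelyPositive.norm_sq_sum_le (hΦ : CompletelyPositive Φ) {α : Type*} (s : Finset α)
    (z w : α → H) (v u : H) :
    ‖∑ i ∈ s, ⟪z i, (Φ (ketbra v u) : H →L[ℂ] H) (w i)⟫_ℂ‖ ^ 2 ≤
      (∑ i ∈ s, ⟪z i, (Φ (ketbra v v) : H →L[ℂ] H) (z i)⟫_ℂ).re *
      (∑ i ∈ s, ⟪w i, (Φ (ketbra u u) : H →L[ℂ] H) (w i)⟫_ℂ).re := by
  have hnn : ∀ (x : H) (y : α → H),
      0 ≤ (∑ i ∈ s, ⟪y i, (Φ (ketbra x x) : H →L[ℂ] H) (y i)⟫_ℂ).re := fun x y => by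
    rw [Complex.re_sum]
    exact Finset.sum_nonneg fun i _ =>
      isPositive_re_nonneg (hΦ.isPositive (ketbra_isPositive x)) _
  refine norm_sq_le_mul_of_forall_nonneg (hnn v z) (hnn u w)
    (τ' := ∑ i ∈ s, ⟪w i, (Φ (ketbra u v) : H →L[ℂ] H) (z i)⟫_ℂ) fun c => ?_
  have hblock := hΦ 2 _ (blockPositive_ketbra ![v, u])
  have hi : ∀ i, (0 : ℝ) ≤ (⟪z i, (Φ (ketbra v v) : H →L[ℂ] H) (z i)⟫_ℂ +
      c * ⟪z i, (Φ (ketbra v u) : H →L[ℂ] H) (w i)⟫_ℂ +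
      starRingEnd ℂ c * ⟪w i, (Φ (ketbra u v) : H →L[ℂ] H) (z i)⟫_ℂ +
      (Complex.normSq c : ℂ) * ⟪w i, (Φ (ketbra u u) : H →L[ℂ] H) (w i)⟫_ℂ).re ∧
      (⟪z i, (Φ (ketbra v v) : H →L[ℂ] H) (z i)⟫_ℂ +
      c * ⟪z i, (Φ (ketbra v u) : H →L[ℂ] H) (w i)⟫_ℂ +
      starRingEnd ℂ c * ⟪w i, (Φ (ketbra u v) : H →L[ℂ] H) (z i)⟫_ℂ +
      (Complex.normSq c : ℂ) * ⟪w i, (Φ (ketbra u u) : H →L[ℂ] H) (w i)⟫_ℂ).im = 0 := by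
    intro i
    have h := hblock ![z i, c • w i]
    simp only [Fin.sum_univ_two, Matrix.cons_val_zero, Matrix.cons_val_one, map_smul,
      inner_smul_left, inner_smul_right] at h
    have h' : ∀ a b d e : ℂ, a + c * b + (starRingEnd ℂ c * d + c * (starRingEnd ℂ c * e)) =
        a + c * b + starRingEnd ℂ c * d + (Complex.normSq c : ℂ) * e := by
      intro a b d e; rw [← Complex.mul_conj]; ring
    rw [h'] at h
    exact ⟨(Complex.le_def.1 h).1, (Complex.le_def.1 h).2.symm⟩
  refine ⟨_, Finset.sum_nonneg (s := s) fun i _ => (hi i).1, ?_⟩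
  have hr1 : (((∑ i ∈ s, ⟪z i, (Φ (ketbra v v) : H →L[ℂ] H) (z i)⟫_ℂ).re : ℝ) : ℂ) =
      ∑ i ∈ s, ⟪z i, (Φ (ketbra v v) : H →L[ℂ] H) (z i)⟫_ℂ := by
    rw [Complex.re_sum, Complex.ofReal_sum]
    exact Finset.sum_congr rfl fun i _ =>
      (isPositive_inner_eq_re (hΦ.isPositive (ketbra_isPositive v)) _).symm
  have hr2 : (((∑ i ∈ s, ⟪w i, (Φ (ketbra u u) : H →L[ℂ] H) (w i)⟫_ℂ).re : ℝ) : ℂ) =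
      ∑ i ∈ s, ⟪w i, (Φ (ketbra u u) : H →L[ℂ] H) (w i)⟫_ℂ := by
    rw [Complex.re_sum, Complex.ofReal_sum]
    exact Finset.sum_congr rfl fun i _ =>
      (isPositive_inner_eq_re (hΦ.isPositive (ketbra_isPositive u)) _).symm
  rw [hr1, hr2, Finset.mul_sum, Finset.mul_sum, Finset.mul_sum, ← Finset.sum_add_distrib,
    ← Finset.sum_add_distrib, ← Finset.sum_add_distrib, Complex.ofReal_sum]
  exact Finset.sum_congr rfl fun i _ => Complex.ext rfl (hi i).2

lemma sum_re_inner_le_trace {α : Type*} (e : HilbertBasis α ℂ H) (s : Finset α) (A : traceClass H)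
    (hA : (A : H →L[ℂ] H).IsPositive) :
    (∑ i ∈ s, ⟪e i, (A : H →L[ℂ] H) (e i)⟫_ℂ).re ≤ (trace A).re := by
  rw [Complex.re_sum]
  exact sum_le_hasSum s (fun i _ => isPositive_re_nonneg hA _)
    (Complex.hasSum_re (hasSum_inner_trace A e))

lemma trace_ketbra_self_re (u : H) : (trace (ketbra u u)).re = ‖u‖ ^ 2 := by
  rw [trace_ketbra, inner_self_eq_norm_sq_to_K]; norm_cast

/-- The dual map of a completely positive trace-preserving map, at the finite-rank operator `Y`
with `tr (A Y) = ∑ᵢ ⟨zᵢ, A eᵢ⟩ = ∑ⱼ ⟨fⱼ, A yⱼ⟩`, together with its Schwarz inequalities. -/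
lemma CompletelyPositive.exists_dual (hΦ : CompletelyPositive Φ)
    (htr : ∀ A, trace (Φ A) = trace A) {α β : Type*} (s : Finset α) (t : Finset β)
    (e : HilbertBasis α ℂ H) (f : HilbertBasis β ℂ H) (z : α → H) (y : β → H)
    (hτ : ∀ A : traceClass H, ∑ i ∈ s, ⟪z i, (A : H →L[ℂ] H) (e i)⟫_ℂ =
      ∑ j ∈ t, ⟪f j, (A : H →L[ℂ] H) (y j)⟫_ℂ) :
    ∃ X : H →L[ℂ] H,
      (∀ u v, ⟪u, X v⟫_ℂ = ∑ i ∈ s, ⟪z i, (Φ (ketbra v u) : H →L[ℂ] H) (e i)⟫_ℂ) ∧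
      (∀ v, ‖X v‖ ^ 2 ≤ (∑ i ∈ s, ⟪z i, (Φ (ketbra v v) : H →L[ℂ] H) (z i)⟫_ℂ).re) ∧
      ∀ u, ‖ContinuousLinearMap.adjoint X u‖ ^ 2 ≤
        (∑ j ∈ t, ⟪y j, (Φ (ketbra u u) : H →L[ℂ] H) (y j)⟫_ℂ).re := by
  let τ : H → H → ℂ := fun v u => ∑ i ∈ s, ⟪z i, (Φ (ketbra v u) : H →L[ℂ] H) (e i)⟫_ℂ
  let ν : H → ℝ := fun v => (∑ i ∈ s, ⟪z i, (Φ (ketbra v v) : H →L[ℂ] H) (z i)⟫_ℂ).re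
  let μ : H → ℝ := fun u => (∑ j ∈ t, ⟪y j, (Φ (ketbra u u) : H →L[ℂ] H) (y j)⟫_ℂ).re
  have hΦp : ∀ u, (Φ (ketbra u u) : H →L[ℂ] H).IsPositive := fun u =>
    hΦ.isPositive (ketbra_isPositive u)
  have hν0 : ∀ v, 0 ≤ ν v := fun v => by
    simp only [ν, Complex.re_sum]
    exact Finset.sum_nonneg fun i _ => isPositive_re_nonneg (hΦp v) _
  have hμ0 : ∀ v, 0 ≤ μ v := fun v => by
    simp only [μ, Complex.re_sum]
    exact Finset.sum_nonneg fun i _ => isPositive_re_nonneg (hΦp v) _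
  -- With orthonormal vectors in one slot, the corresponding factor is a partial trace of Φ(|u⟩⟨u|),
  -- at most ‖u‖². The second form of τ gives the mirror bound `h2`.
  have h1 : ∀ v u, ‖τ v u‖ ^ 2 ≤ ν v * ‖u‖ ^ 2 := by
    intro v u
    refine (hΦ.norm_sq_sum_le s z e v u).trans ?_
    refine mul_le_mul_of_nonneg_left ?_ (hν0 v)
    refine (sum_re_inner_le_trace e s _ (hΦp u)).trans ?_
    rw [htr, trace_ketbra_self_re]
  have h2 : ∀ v u, ‖τ v u‖ ^ 2 ≤ ‖v‖ ^ 2 * μ u := by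
    intro v u
    simp only [τ, hτ]
    refine (hΦ.norm_sq_sum_le t f y v u).trans ?_
    refine mul_le_mul_of_nonneg_right ?_ (hμ0 u)
    refine (sum_re_inner_le_trace f t _ (hΦp v)).trans ?_
    rw [htr, trace_ketbra_self_re]
  let C : ℝ := ∑ i ∈ s, ‖z i‖ ^ 2
  have hC0 : 0 ≤ C := Finset.sum_nonneg fun i _ => by positivity
  have hνC : ∀ v, ν v ≤ C * ‖v‖ ^ 2 := by
    intro v
    simp only [ν, Complex.re_sum, C, Finset.sum_mul]
    refine Finset.sum_le_sum fun i _ => ?_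
    have hn := norm_le_trace_re _ (hΦp v)
    rw [htr, trace_ketbra_self_re] at hn
    calc _ ≤ ‖⟪z i, (Φ (ketbra v v) : H →L[ℂ] H) (z i)⟫_ℂ‖ := Complex.re_le_norm _
      _ ≤ ‖z i‖ * ‖(Φ (ketbra v v) : H →L[ℂ] H) (z i)‖ := norm_inner_le_norm _ _
      _ ≤ ‖z i‖ * (‖v‖ ^ 2 * ‖z i‖) := by
          gcongr
          exact (ContinuousLinearMap.le_opNorm _ _).trans (by gcongr)
      _ = _ := by ring
  have hbound : ∀ v u, ‖starRingEnd ℂ (τ v u)‖ ≤ √C * ‖v‖ * ‖u‖ := by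
    intro v u
    rw [RCLike.norm_conj]
    refine (sq_le_sq₀ (norm_nonneg _) (by positivity)).1 ?_
    rw [mul_pow, mul_pow, Real.sq_sqrt hC0]
    exact (h1 v u).trans (by gcongr; exact hνC v)
  let B : H →L⋆[ℂ] H →L[ℂ] ℂ := LinearMap.mkContinuous₂
    (LinearMap.mk₂'ₛₗ (starRingEnd ℂ) (RingHom.id ℂ) (fun v u => starRingEnd ℂ (τ v u))
      (by intro v v' u; simp [τ, ketbra_add_left, Finset.sum_add_distrib])
      (by intro c v u; simp [τ, ketbra_smul_left, Finset.mul_sum])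
      (by intro v u u'; simp [τ, ketbra_add_right, Finset.sum_add_distrib])
      (by intro c v u; simp [τ, ketbra_smul_right, Finset.mul_sum])) (√C)
      (by intro v u; exact hbound v u)
  let X : H →L[ℂ] H := InnerProductSpace.continuousLinearMapOfBilin B
  have hX : ∀ u v, ⟪u, X v⟫_ℂ = τ v u := by
    intro u v
    rw [← inner_conj_symm, InnerProductSpace.continuousLinearMapOfBilin_apply]
    change starRingEnd ℂ (starRingEnd ℂ (τ v u)) = _
    rw [Complex.conj_conj]
  refine ⟨X, hX, fun v => ?_, fun u => ?_⟩
  -- Testing with u = X v gives ‖X v‖⁴ ≤ ν(v)‖X v‖²; a factor cancels. The adjoint is treated in the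
  -- same way with `h2`.
  · have h := h1 v (X v)
    rw [← hX, inner_self_eq_norm_sq_to_K, norm_pow, RCLike.norm_ofReal, abs_norm] at h
    by_cases h0 : ‖X v‖ ^ 2 = 0
    · rw [h0]; exact hν0 v
    · exact le_of_mul_le_mul_right (by nlinarith) (lt_of_le_of_ne (by positivity) (Ne.symm h0))
  · have h := h2 (ContinuousLinearMap.adjoint X u) u
    rw [← hX, ← ContinuousLinearMap.adjoint_inner_left, inner_self_eq_norm_sq_to_K,
      norm_pow, RCLike.norm_ofReal, abs_norm] at h
    by_cases h0 : ‖ContinuousLinearMap.adjoint X u‖ ^ 2 = 0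
    · rw [h0]; exact hμ0 u
    · exact le_of_mul_le_mul_left (by nlinarith) (lt_of_le_of_ne (by positivity) (Ne.symm h0))

/-- Normality comes for free: the remainder of the spectral decomposition is positive with trace
tending to 0, Φ preserves both properties, and the norm of a positive operator is at most its trace.
-/
lemma CompletelyPositive.hasSum_inner (hΦ : CompletelyPositive Φ)
    (htr : ∀ A, trace (Φ A) = trace A) {α : Type*} {A : traceClass H}
    (hA : (A : H →L[ℂ] H).IsPositive) {b : HilbertBasis α ℂ H} {p : α → ℝ}
    (hb : IsEigenbasis (A : H →L[ℂ] H) b p) (u v : H) :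
    HasSum (fun i => (p i : ℂ) * ⟪u, (Φ (ketbra (b i) (b i)) : H →L[ℂ] H) v⟫_ℂ)
      ⟪u, (Φ A : H →L[ℂ] H) v⟫_ℂ := by
  let S : Finset α → traceClass H := fun s => ∑ i ∈ s, (p i : ℂ) • ketbra (b i) (b i)
  have hp0 := hb.nonneg hA
  have hSpos : ∀ s, ((A - S s : traceClass H) : H →L[ℂ] H).IsPositive := by
    intro s
    refine isPositive_of_forall_eq_re fun x => ⟨(⟪x, (A : H →L[ℂ] H) x⟫_ℂ).re -
      ∑ i ∈ s, p i * ‖⟪b i, x⟫_ℂ‖ ^ 2, ?_, ?_⟩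
    · exact sub_nonneg.2 (sum_le_hasSum s (fun i _ => mul_nonneg (hp0 i) (by positivity))
        (hb.hasSum_re_inner hA x))
    · rw [Complex.ofReal_sub, ← isPositive_inner_eq_re hA]
      simp only [S, Submodule.coe_sub, sub_apply, inner_sub_right, Submodule.coe_sum,
        Submodule.coe_smul, sum_apply, smul_apply, ketbra_apply, inner_sum, inner_smul_right]
      congr 1
      rw [Complex.ofReal_sum]
      refine Finset.sum_congr rfl fun i _ => ?_
      rw [← inner_conj_symm x (b i), Complex.mul_conj, Complex.normSq_eq_norm_sq,
        Complex.ofReal_mul]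
  have hStr : ∀ s, (trace (A - S s)).re = (trace A).re - ∑ i ∈ s, p i := by
    intro s
    rw [trace_sub, Complex.sub_re, trace_sum, Complex.re_sum]
    congr 1
    refine Finset.sum_congr rfl fun i _ => ?_
    rw [trace_smul, Complex.re_ofReal_mul, trace_ketbra_self_re, b.orthonormal.1 i]; simp
  have hp : HasSum p (trace A).re := by
    have h := Complex.hasSum_re (hasSum_inner_trace A b)
    simpa only [hb.re_inner_self] using h
  rw [HasSum, SummationFilter.unconditional_filter, tendsto_iff_norm_sub_tendsto_zero]
  have hlim : Tendsto (fun s : Finset α => ‖u‖ * (((trace A).re - ∑ i ∈ s, p i) * ‖v‖)) atTop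
      (𝓝 0) := by
    have h0 : Tendsto (fun s : Finset α => (trace A).re - ∑ i ∈ s, p i) atTop (𝓝 0) := by
      have := (tendsto_const_nhds (x := (trace A).re)).sub hp
      simpa using this
    simpa using (h0.mul_const ‖v‖).const_mul ‖u‖
  refine squeeze_zero (fun _ => norm_nonneg _) (fun s => ?_) hlim
  have e1 : ∑ i ∈ s, (p i : ℂ) * ⟪u, (Φ (ketbra (b i) (b i)) : H →L[ℂ] H) v⟫_ℂ -
      ⟪u, (Φ A : H →L[ℂ] H) v⟫_ℂ = -⟪u, (Φ (A - S s) : H →L[ℂ] H) v⟫_ℂ := by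
    simp only [S, map_sub, map_sum, map_smul, Submodule.coe_sub, sub_apply, inner_sub_right,
      Submodule.coe_sum, Submodule.coe_smul, sum_apply, smul_apply, inner_sum, inner_smul_right]
    ring
  rw [e1, norm_neg]
  refine (norm_inner_le_norm _ _).trans ?_
  gcongr
  refine (ContinuousLinearMap.le_opNorm _ _).trans ?_
  gcongr
  rw [← hStr, ← htr]
  exact norm_le_trace_re _ (hΦ.isPositive (hSpos s))

end CompletelyPositive

/-! ### The data-processing inequality -/

section MonotonicityUnderChannels

/-- `∑ᵢⱼ |⟨fⱼ, eᵢ⟩|² (rⱼ - pᵢ)² / (rⱼ + s pᵢ)`, a quadratic relative entropy. -/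
def quadRelEntropy {ι κ : Type*} (e : HilbertBasis ι ℂ H) (p : ι → ℝ) (f : HilbertBasis κ ℂ H)
    (r : κ → ℝ) (s : ℝ) : ℝ≥0∞ :=
  ∑' i, ∑' j, ENNReal.ofReal (‖⟪f j, e i⟫_ℂ‖ ^ 2) *
    ENNReal.ofReal ((r j - p i) ^ 2 / (r j + s * p i))

lemma two_mul_re_le {w x : ℂ} {a b : ℝ} (hb : 0 ≤ b) (hab : b = 0 → a = 0) :
    2 * ((a : ℂ) * (w * x)).re ≤ ‖w‖ ^ 2 * (a ^ 2 / b) + b * ‖x‖ ^ 2 := by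
  rcases hb.eq_or_lt with rfl | hb
  · simp [hab rfl]
  have h1 : ((a : ℂ) * (w * x)).re ≤ |a| * (‖w‖ * ‖x‖) := by
    refine (Complex.re_le_norm _).trans ?_
    simp
  have h2 : ‖w‖ ^ 2 * (a ^ 2 / b) + b * ‖x‖ ^ 2 - 2 * (|a| * (‖w‖ * ‖x‖)) =
      (|a| * ‖w‖ - b * ‖x‖) ^ 2 / b := by
    rw [← sq_abs a]; field_simp; ring
  have h3 : 0 ≤ (|a| * ‖w‖ - b * ‖x‖) ^ 2 / b := by positivity
  linarith

variable {Φ : traceClass H →ₗ[ℂ] traceClass H} {ι κ ι' κ' : Type*}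

lemma sum_inner_eigen {A : H →L[ℂ] H} {b : HilbertBasis ι ℂ H} {p : ι → ℝ}
    (hb : IsEigenbasis A b p) (S : Finset ι) (c : ι → ℂ) :
    (⟪∑ i ∈ S, c i • b i, A (∑ i ∈ S, c i • b i)⟫_ℂ).re = ∑ i ∈ S, p i * ‖c i‖ ^ 2 := by
  classical
  simp only [map_sum, map_smul, hb _, inner_sum, sum_inner, inner_smul_left, inner_smul_right,
    orthonormal_iff_ite.1 b.orthonormal]
  rw [Complex.re_sum]
  refine Finset.sum_congr rfl fun i hi => ?_
  simp only [mul_ite, mul_one, mul_zero, Finset.sum_ite_eq', hi, if_true]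
  have : c i * ((p i : ℂ) * starRingEnd ℂ (c i)) = ((p i * ‖c i‖ ^ 2 : ℝ) : ℂ) := by
    rw [mul_left_comm, Complex.mul_conj, Complex.normSq_eq_norm_sq, Complex.ofReal_mul]
  rw [this, Complex.ofReal_re]

lemma hasSum_prod_of_nonneg {F : ι × κ → ℝ} (hF : ∀ x, 0 ≤ F x) {g : ι → ℝ}
    (h1 : ∀ i, HasSum (fun j => F (i, j)) (g i)) (h2 : Summable g) : HasSum F (∑' i, g i) := by
  have hs : Summable F := by
    rw [summable_prod_of_nonneg hF]
    exact ⟨fun i => (h1 i).summable, by simpa only [(h1 _).tsum_eq] using h2⟩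
  have := (hs.hasSum.prod_fiberwise h1).tsum_eq
  rw [this]
  exact hs.hasSum

/-- This is tr(ω X) = tr(Φ(ω) Y), with the left side expanded in an eigenbasis of ω. -/
lemma CompletelyPositive.hasSum_inner_dual (hΦ : CompletelyPositive Φ)
    (htr : ∀ A, trace (Φ A) = trace A) {S : Finset ι'} {z w : ι' → H} {X : H →L[ℂ] H}
    (hX : ∀ u v, ⟪u, X v⟫_ℂ = ∑ i ∈ S, ⟪z i, (Φ (ketbra v u) : H →L[ℂ] H) (w i)⟫_ℂ)
    {ω : traceClass H} (hω : IsState ω) {b : HilbertBasis ι ℂ H} {q : ι → ℝ}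
    (hb : IsEigenbasis (ω : H →L[ℂ] H) b q) :
    HasSum (fun k => (q k : ℂ) * ⟪b k, X (b k)⟫_ℂ)
      (∑ i ∈ S, ⟪z i, (Φ ω : H →L[ℂ] H) (w i)⟫_ℂ) := by
  have := hasSum_sum (s := S) fun i _ => hΦ.hasSum_inner htr hω.1 hb (z i) (w i)
  simpa only [hX, Finset.mul_sum] using this

set_option maxHeartbeats 800000 in
-- The left side is the variational functional of the output states at a finite-rank test operator
-- Y. With X the dual image of Y, the linear term is tr((φ - ρ)X) before the channel. Completing the
-- square entrywise bounds it by the input quantity plus the quadratic cost of X, and the Schwarz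
-- inequalities bound that cost by the cost of Y.
lemma quadRelEntropy_variational (hΦ : CompletelyPositive Φ) (htr : ∀ A, trace (Φ A) = trace A)
    {ρ φ : traceClass H} (hρ : IsState ρ) (hφ : IsState φ)
    {e : HilbertBasis ι ℂ H} {p : ι → ℝ} (he : IsEigenbasis (ρ : H →L[ℂ] H) e p)
    {f : HilbertBasis κ ℂ H} {r : κ → ℝ} (hf : IsEigenbasis (φ : H →L[ℂ] H) f r)
    {e' : HilbertBasis ι' ℂ H} {p' : ι' → ℝ} (he' : IsEigenbasis (Φ ρ : H →L[ℂ] H) e' p')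
    {f' : HilbertBasis κ' ℂ H} {r' : κ' → ℝ} (hf' : IsEigenbasis (Φ φ : H →L[ℂ] H) f' r')
    {s : ℝ} (hs : 0 < s) (hR : quadRelEntropy e p f r s ≠ ⊤)
    (S : Finset ι') (S' : Finset κ') (y : ι' → κ' → ℂ) :
    2 * (∑ i ∈ S, ∑ j ∈ S', ((r' j - p' i : ℝ) : ℂ) * (⟪f' j, e' i⟫_ℂ * y i j)).re -
      ∑ i ∈ S, ∑ j ∈ S', (r' j + s * p' i) * ‖y i j‖ ^ 2 ≤ (quadRelEntropy e p f r s).toReal := by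
  classical
  -- Y = ∑ yᵢⱼ |e'ᵢ⟩⟨f'ⱼ|. Its two groupings, by rows (`z`) and by columns (`w`), feed the Schwarz
  -- inequalities for X and for its adjoint.
  let z : ι' → H := fun i => ∑ j ∈ S', starRingEnd ℂ (y i j) • f' j
  let w : κ' → H := fun j => ∑ i ∈ S, y i j • e' i
  have hτ : ∀ A : traceClass H, ∑ i ∈ S, ⟪z i, (A : H →L[ℂ] H) (e' i)⟫_ℂ =
      ∑ j ∈ S', ⟪f' j, (A : H →L[ℂ] H) (w j)⟫_ℂ := by
    intro A
    simp only [z, w, sum_inner, inner_smul_left, map_sum, map_smul, inner_sum, inner_smul_right,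
      Complex.conj_conj]
    rw [Finset.sum_comm]
  obtain ⟨X, hX, hX1, hX2⟩ := hΦ.exists_dual htr S S' e' f' z w hτ
  let x : ι × κ → ℂ := fun ij => ⟪e ij.1, X (f ij.2)⟫_ℂ
  let g : ι × κ → ℂ := fun ij => ⟪f ij.2, e ij.1⟫_ℂ
  have hp0 := he.nonneg hρ.1
  have hr0 := hf.nonneg hφ.1
  have hp1 := he.hasSum_one hρ
  have hr1 := hf.hasSum_one hφ
  -- sums of squares
  have hx_j : ∀ j, HasSum (fun i => ‖x (i, j)‖ ^ 2) (‖X (f j)‖ ^ 2) := fun j =>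
    hasSum_norm_inner_sq e (X (f j))
  have hx_i : ∀ i, HasSum (fun j => ‖x (i, j)‖ ^ 2) (‖ContinuousLinearMap.adjoint X (e i)‖ ^ 2) := by
    intro i
    convert hasSum_norm_inner_sq f (ContinuousLinearMap.adjoint X (e i)) using 2 with j
    simp only [x]
    rw [ContinuousLinearMap.adjoint_inner_right, norm_inner_symm]
  have hg_j : ∀ j, HasSum (fun i => ‖g (i, j)‖ ^ 2) 1 := by
    intro j
    have := hasSum_norm_inner_sq e (f j)
    rw [f.orthonormal.1 j, one_pow] at this
    simpa only [g, norm_inner_symm (f j)] using this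
  have hg_i : ∀ i, HasSum (fun j => ‖g (i, j)‖ ^ 2) 1 := by
    intro i
    have := hasSum_norm_inner_sq f (e i)
    rwa [e.orthonormal.1 i, one_pow] at this
  have hbdX : ∀ j, ‖X (f j)‖ ^ 2 ≤ ‖X‖ ^ 2 := fun j => by
    have := X.le_opNorm (f j)
    rw [f.orthonormal.1 j, mul_one] at this
    gcongr
  have hbdX' : ∀ i, ‖ContinuousLinearMap.adjoint X (e i)‖ ^ 2 ≤
      ‖ContinuousLinearMap.adjoint X‖ ^ 2 := fun i => by
    have := (ContinuousLinearMap.adjoint X).le_opNorm (e i)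
    rw [e.orthonormal.1 i, mul_one] at this
    gcongr
  have hsumr : Summable fun j => r j * ‖X (f j)‖ ^ 2 :=
    Summable.of_nonneg_of_le (fun j => mul_nonneg (hr0 j) (by positivity))
      (fun j => mul_le_mul_of_nonneg_left (hbdX j) (hr0 j)) (hr1.summable.mul_right _)
  have hsump : Summable fun i => p i * ‖ContinuousLinearMap.adjoint X (e i)‖ ^ 2 :=
    Summable.of_nonneg_of_le (fun i => mul_nonneg (hp0 i) (by positivity))
      (fun i => mul_le_mul_of_nonneg_left (hbdX' i) (hp0 i)) (hp1.summable.mul_right _)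
  have hrx : HasSum (fun ij : ι × κ => r ij.2 * ‖x ij‖ ^ 2) (∑' j, r j * ‖X (f j)‖ ^ 2) := by
    have h := hasSum_prod_of_nonneg (F := fun ji : κ × ι => r ji.1 * ‖x (ji.2, ji.1)‖ ^ 2)
      (fun ji => mul_nonneg (hr0 _) (by positivity)) (fun j => (hx_j j).mul_left (r j)) hsumr
    exact (Equiv.prodComm ι κ).hasSum_iff.2 h
  have hpx : HasSum (fun ij : ι × κ => p ij.1 * ‖x ij‖ ^ 2)
      (∑' i, p i * ‖ContinuousLinearMap.adjoint X (e i)‖ ^ 2) :=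
    hasSum_prod_of_nonneg (F := fun ij : ι × κ => p ij.1 * ‖x ij‖ ^ 2)
      (fun ij => mul_nonneg (hp0 _) (by positivity)) (fun i => (hx_i i).mul_left (p i)) hsump
  have hrg : HasSum (fun ij : ι × κ => r ij.2 * ‖g ij‖ ^ 2) (∑' j, r j * 1) := by
    have h := hasSum_prod_of_nonneg (F := fun ji : κ × ι => r ji.1 * ‖g (ji.2, ji.1)‖ ^ 2)
      (fun ji => mul_nonneg (hr0 _) (by positivity)) (fun j => (hg_j j).mul_left (r j))
      (by simpa using hr1.summable)
    exact (Equiv.prodComm ι κ).hasSum_iff.2 h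
  have hpg : HasSum (fun ij : ι × κ => p ij.1 * ‖g ij‖ ^ 2) (∑' i, p i * 1) :=
    hasSum_prod_of_nonneg (F := fun ij : ι × κ => p ij.1 * ‖g ij‖ ^ 2)
      (fun ij => mul_nonneg (hp0 _) (by positivity)) (fun i => (hg_i i).mul_left (p i))
      (by simpa using hp1.summable)
  have hgx : ∀ ij, ‖g ij * x ij‖ ≤ ‖g ij‖ ^ 2 + ‖x ij‖ ^ 2 := fun ij => by
    rw [norm_mul]; nlinarith [sq_nonneg (‖g ij‖ - ‖x ij‖), sq_nonneg ‖g ij‖, sq_nonneg ‖x ij‖]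
  -- the functional `tr (Φ A Y)` at `φ` and at `ρ`
  have hφX : HasSum (fun ij : ι × κ => (r ij.2 : ℂ) * (g ij * x ij))
      (∑ i ∈ S, ⟪z i, (Φ φ : H →L[ℂ] H) (e' i)⟫_ℂ) := by
    have hsm : Summable fun ij : ι × κ => (r ij.2 : ℂ) * (g ij * x ij) := by
      refine Summable.of_norm_bounded (hrg.summable.add hrx.summable) fun ij => ?_
      rw [norm_mul, Complex.norm_real, Real.norm_of_nonneg (hr0 _), ← mul_add]
      exact mul_le_mul_of_nonneg_left (hgx ij) (hr0 _)
    have h1 := (Equiv.prodComm κ ι).hasSum_iff.2 hsm.hasSum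
    have h2 := h1.prod_fiberwise (g := fun j => (r j : ℂ) * ⟪f j, X (f j)⟫_ℂ) fun j =>
      (e.hasSum_inner_mul_inner (f j) (X (f j))).mul_left _
    rw [← h2.unique (hΦ.hasSum_inner_dual htr hX hφ hf)]
    exact hsm.hasSum
  have hρX : HasSum (fun ij : ι × κ => (p ij.1 : ℂ) * (g ij * x ij))
      (∑ i ∈ S, ⟪z i, (Φ ρ : H →L[ℂ] H) (e' i)⟫_ℂ) := by
    have hsm : Summable fun ij : ι × κ => (p ij.1 : ℂ) * (g ij * x ij) := by
      refine Summable.of_norm_bounded (hpg.summable.add hpx.summable) fun ij => ?_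
      rw [norm_mul, Complex.norm_real, Real.norm_of_nonneg (hp0 _), ← mul_add]
      exact mul_le_mul_of_nonneg_left (hgx ij) (hp0 _)
    have h2 := hsm.hasSum.prod_fiberwise (g := fun i => (p i : ℂ) * ⟪e i, X (e i)⟫_ℂ) fun i => by
      have := f.hasSum_inner_mul_inner (ContinuousLinearMap.adjoint X (e i)) (e i)
      simp only [ContinuousLinearMap.adjoint_inner_left] at this
      simpa only [g, x, mul_comm ⟪f _, e i⟫_ℂ] using this.mul_left (p i : ℂ)
    rw [← h2.unique (hΦ.hasSum_inner_dual htr hX hρ he)]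
    exact hsm.hasSum
  -- the quadratic relative entropy as a real sum
  have hRsum : HasSum (fun ij : ι × κ => ‖g ij‖ ^ 2 * ((r ij.2 - p ij.1) ^ 2 / (r ij.2 + s * p ij.1)))
      (quadRelEntropy e p f r s).toReal := by
    have hnn : ∀ ij : ι × κ, 0 ≤ (r ij.2 - p ij.1) ^ 2 / (r ij.2 + s * p ij.1) := fun ij =>
      div_nonneg (sq_nonneg _) (add_nonneg (hr0 _) (mul_nonneg hs.le (hp0 _)))
    have heq : quadRelEntropy e p f r s = ∑' ij : ι × κ,
        ENNReal.ofReal (‖g ij‖ ^ 2 * ((r ij.2 - p ij.1) ^ 2 / (r ij.2 + s * p ij.1))) := by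
      rw [quadRelEntropy, ENNReal.tsum_prod']
      exact tsum_congr fun i => tsum_congr fun j =>
        (ENNReal.ofReal_mul (by positivity)).symm
    rw [heq] at hR ⊢
    have := ENNReal.hasSum_toReal hR
    rw [ENNReal.tsum_toReal_eq (fun _ => ENNReal.ofReal_ne_top)]
    simpa only [ENNReal.toReal_ofReal (mul_nonneg (sq_nonneg _) (hnn _))] using this
  have hmain : 2 * (∑ i ∈ S, ⟪z i, (Φ φ : H →L[ℂ] H) (e' i)⟫_ℂ -
      ∑ i ∈ S, ⟪z i, (Φ ρ : H →L[ℂ] H) (e' i)⟫_ℂ).re ≤ (quadRelEntropy e p f r s).toReal +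
      ((∑' j, r j * ‖X (f j)‖ ^ 2) +
        s * ∑' i, p i * ‖ContinuousLinearMap.adjoint X (e i)‖ ^ 2) := by
    refine hasSum_le (fun ij => ?_) ((Complex.hasSum_re (hφX.sub hρX)).mul_left 2)
      (hRsum.add (hrx.add (hpx.mul_left s)))
    have h := two_mul_re_le (w := g ij) (x := x ij) (a := r ij.2 - p ij.1)
      (b := r ij.2 + s * p ij.1) (add_nonneg (hr0 _) (mul_nonneg hs.le (hp0 _))) (by
        intro h0
        have h1 := hr0 ij.2
        have h2 := mul_nonneg hs.le (hp0 ij.1)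
        have h3 : r ij.2 = 0 := by linarith
        have h4 : s * p ij.1 = 0 := by linarith
        rw [h3, (mul_eq_zero.1 h4).resolve_left hs.ne', sub_zero])
    have e1 : ((r ij.2 - p ij.1 : ℝ) : ℂ) * (g ij * x ij) =
        (r ij.2 : ℂ) * (g ij * x ij) - (p ij.1 : ℂ) * (g ij * x ij) := by push_cast; ring
    rw [e1] at h
    linarith
  -- Schwarz inequalities
  have hS1 : ∑' j, r j * ‖X (f j)‖ ^ 2 ≤ ∑ i ∈ S, ∑ j ∈ S', r' j * ‖y i j‖ ^ 2 := by
    have h1 := Complex.hasSum_re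
      (hasSum_sum (s := S) fun i _ => hΦ.hasSum_inner htr hφ.1 hf (z i) (z i))
    have h2 : (∑ i ∈ S, ⟪z i, (Φ φ : H →L[ℂ] H) (z i)⟫_ℂ).re =
        ∑ i ∈ S, ∑ j ∈ S', r' j * ‖y i j‖ ^ 2 := by
      rw [Complex.re_sum]
      refine Finset.sum_congr rfl fun i _ => ?_
      rw [sum_inner_eigen hf' S' (fun j => starRingEnd ℂ (y i j))]
      simp only [RCLike.norm_conj]
    rw [← h2]
    refine hasSum_le (fun j => ?_) hsumr.hasSum h1
    rw [← Finset.mul_sum, Complex.re_ofReal_mul]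
    exact mul_le_mul_of_nonneg_left (hX1 (f j)) (hr0 j)
  have hS2 : ∑' i, p i * ‖ContinuousLinearMap.adjoint X (e i)‖ ^ 2 ≤
      ∑ i ∈ S, ∑ j ∈ S', p' i * ‖y i j‖ ^ 2 := by
    have h1 := Complex.hasSum_re
      (hasSum_sum (s := S') fun j _ => hΦ.hasSum_inner htr hρ.1 he (w j) (w j))
    have h2 : (∑ j ∈ S', ⟪w j, (Φ ρ : H →L[ℂ] H) (w j)⟫_ℂ).re =
        ∑ i ∈ S, ∑ j ∈ S', p' i * ‖y i j‖ ^ 2 := by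
      rw [Complex.re_sum, Finset.sum_comm]
      exact Finset.sum_congr rfl fun j _ => sum_inner_eigen he' S (fun i => y i j)
    rw [← h2]
    refine hasSum_le (fun i => ?_) hsump.hasSum h1
    rw [← Finset.mul_sum, Complex.re_ofReal_mul]
    exact mul_le_mul_of_nonneg_left (hX2 (e i)) (hp0 i)
  have hlhs : ∑ i ∈ S, ⟪z i, (Φ φ : H →L[ℂ] H) (e' i)⟫_ℂ -
      ∑ i ∈ S, ⟪z i, (Φ ρ : H →L[ℂ] H) (e' i)⟫_ℂ =
      ∑ i ∈ S, ∑ j ∈ S', ((r' j - p' i : ℝ) : ℂ) * (⟪f' j, e' i⟫_ℂ * y i j) := by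
    rw [← Finset.sum_sub_distrib]
    refine Finset.sum_congr rfl fun i _ => ?_
    simp only [z, sum_inner, inner_smul_left, Complex.conj_conj]
    rw [← Finset.sum_sub_distrib]
    refine Finset.sum_congr rfl fun j _ => ?_
    rw [hf'.inner_apply (hΦ.isPositive hφ.1), he' i, inner_smul_right]
    push_cast; ring
  have hrhs : ∑ i ∈ S, ∑ j ∈ S', (r' j + s * p' i) * ‖y i j‖ ^ 2 =
      (∑ i ∈ S, ∑ j ∈ S', r' j * ‖y i j‖ ^ 2) + s * ∑ i ∈ S, ∑ j ∈ S', p' i * ‖y i j‖ ^ 2 := by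
    simp only [Finset.mul_sum, ← Finset.sum_add_distrib]
    exact Finset.sum_congr rfl fun i _ => Finset.sum_congr rfl fun j _ => by ring
  rw [← hlhs, hrhs]
  have hS2' := mul_le_mul_of_nonneg_left hS2 hs.le
  linarith

/-- Every finite partial sum of the output quantity lies in a rectangular one, and that is the value
of the variational functional at its maximizer. -/
theorem quadRelEntropy_le (hΦ : CompletelyPositive Φ) (htr : ∀ A, trace (Φ A) = trace A)
    {ρ φ : traceClass H} (hρ : IsState ρ) (hφ : IsState φ)
    {e : HilbertBasis ι ℂ H} {p : ι → ℝ} (he : IsEigenbasis (ρ : H →L[ℂ] H) e p)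
    {f : HilbertBasis κ ℂ H} {r : κ → ℝ} (hf : IsEigenbasis (φ : H →L[ℂ] H) f r)
    {e' : HilbertBasis ι' ℂ H} {p' : ι' → ℝ} (he' : IsEigenbasis (Φ ρ : H →L[ℂ] H) e' p')
    {f' : HilbertBasis κ' ℂ H} {r' : κ' → ℝ} (hf' : IsEigenbasis (Φ φ : H →L[ℂ] H) f' r')
    {s : ℝ} (hs : 0 < s) : quadRelEntropy e' p' f' r' s ≤ quadRelEntropy e p f r s := by
  classical
  by_cases hR : quadRelEntropy e p f r s = ⊤
  · rw [hR]; exact le_top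
  have hp0 := he'.nonneg (hΦ.isPositive hρ.1)
  have hr0 := hf'.nonneg (hΦ.isPositive hφ.1)
  rw [quadRelEntropy, ← ENNReal.tsum_prod, ENNReal.tsum_eq_iSup_sum]
  refine iSup_le fun F => ?_
  let S := F.image Prod.fst
  let S' := F.image Prod.snd
  have hF : F ⊆ S ×ˢ S' := fun x hx =>
    Finset.mem_product.2 ⟨Finset.mem_image_of_mem _ hx, Finset.mem_image_of_mem _ hx⟩
  refine (Finset.sum_le_sum_of_subset hF).trans ?_
  -- The optimal coefficients solve the first-order condition entry by entry. Where the denominator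
  -- is 0, division by zero gives 0 on both sides.
  have hvar := quadRelEntropy_variational hΦ htr hρ hφ he hf he' hf' hs hR S S'
    (fun i j => ((r' j - p' i) / (r' j + s * p' i) : ℝ) * ⟪e' i, f' j⟫_ℂ)
  have e1 : 2 * (∑ i ∈ S, ∑ j ∈ S', ((r' j - p' i : ℝ) : ℂ) * (⟪f' j, e' i⟫_ℂ *
      (((r' j - p' i) / (r' j + s * p' i) : ℝ) * ⟪e' i, f' j⟫_ℂ))).re -
      ∑ i ∈ S, ∑ j ∈ S', (r' j + s * p' i) *
        ‖(((r' j - p' i) / (r' j + s * p' i) : ℝ) : ℂ) * ⟪e' i, f' j⟫_ℂ‖ ^ 2 =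
      ∑ i ∈ S, ∑ j ∈ S', ‖⟪f' j, e' i⟫_ℂ‖ ^ 2 * ((r' j - p' i) ^ 2 / (r' j + s * p' i)) := by
    rw [Complex.re_sum, Finset.mul_sum, ← Finset.sum_sub_distrib]
    refine Finset.sum_congr rfl fun i _ => ?_
    rw [Complex.re_sum, Finset.mul_sum, ← Finset.sum_sub_distrib]
    refine Finset.sum_congr rfl fun j _ => ?_
    have h1 : ((r' j - p' i : ℝ) : ℂ) * (⟪f' j, e' i⟫_ℂ *
        (((r' j - p' i) / (r' j + s * p' i) : ℝ) * ⟪e' i, f' j⟫_ℂ)) =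
        (((r' j - p' i) * ((r' j - p' i) / (r' j + s * p' i)) * ‖⟪f' j, e' i⟫_ℂ‖ ^ 2 : ℝ) : ℂ) := by
      rw [← inner_conj_symm (e' i) (f' j), Complex.ofReal_mul, ← Complex.normSq_eq_norm_sq,
        ← Complex.mul_conj]
      push_cast; ring
    rw [h1, Complex.ofReal_re, norm_mul, mul_pow, Complex.norm_real, norm_inner_symm (e' i),
      Real.norm_eq_abs, sq_abs]
    by_cases h0 : r' j + s * p' i = 0
    · simp [h0]
    · field_simp; ring
  rw [e1] at hvar
  have hnn : ∀ i j, 0 ≤ (r' j - p' i) ^ 2 / (r' j + s * p' i) := fun i j =>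
    div_nonneg (sq_nonneg _) (add_nonneg (hr0 _) (mul_nonneg hs.le (hp0 _)))
  rw [Finset.sum_product]
  calc _ = ENNReal.ofReal (∑ i ∈ S, ∑ j ∈ S', ‖⟪f' j, e' i⟫_ℂ‖ ^ 2 *
        ((r' j - p' i) ^ 2 / (r' j + s * p' i))) := by
        rw [ENNReal.ofReal_sum_of_nonneg fun i _ => Finset.sum_nonneg fun j _ =>
          mul_nonneg (sq_nonneg _) (hnn i j)]
        refine Finset.sum_congr rfl fun i _ => ?_
        rw [ENNReal.ofReal_sum_of_nonneg fun j _ => mul_nonneg (sq_nonneg _) (hnn i j)]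
        exact Finset.sum_congr rfl fun j _ => (ENNReal.ofReal_mul (sq_nonneg _)).symm
    _ ≤ _ := ENNReal.ofReal_le_of_le_toReal hvar

end MonotonicityUnderChannels

/-! ### Integral representation of the relative entropy and data processing -/

section RelEntropyMonotone

lemma hasDerivAt_klPrimitive {p r s : ℝ} (hp : 0 ≤ p) (hr : 0 < r) (hs : 0 ≤ s) :
    HasDerivAt (fun s => p * Real.log (r + s * p) - p * Real.log (1 + s) - (r - p) / (1 + s))
      ((r - p) ^ 2 / (r + s * p) * (1 / (1 + s) ^ 2)) s := by
  have h1 : r + s * p ≠ 0 := by positivity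
  have h2 : 1 + s ≠ 0 := by positivity
  have d1 : HasDerivAt (fun s => r + s * p) p s := by
    simpa using ((hasDerivAt_id s).mul_const p).const_add r
  have d2 : HasDerivAt (fun s => 1 + s) 1 s := (hasDerivAt_id s).const_add 1
  have h := (((d1.log h1).const_mul p).sub ((d2.log h2).const_mul p)).sub
    ((hasDerivAt_const s (r - p)).div d2 h2)
  refine h.congr_deriv ?_
  field_simp
  ring

lemma tendsto_klPrimitive {p r : ℝ} (hp : 0 ≤ p) :
    Tendsto (fun s => p * Real.log (r + s * p) - p * Real.log (1 + s) - (r - p) / (1 + s)) atTop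
      (𝓝 (p * Real.log p)) := by
  have hs : Tendsto (fun s : ℝ => 1 + s) atTop atTop := tendsto_atTop_add_const_left _ _ tendsto_id
  have h3 : Tendsto (fun s : ℝ => (r - p) / (1 + s)) atTop (𝓝 0) := hs.const_div_atTop _
  rcases hp.eq_or_lt with rfl | hp
  · simpa using h3.neg
  have h4 : Tendsto (fun s : ℝ => Real.log (p + (r - p) / (1 + s))) atTop (𝓝 (Real.log p)) := by
    have : Tendsto (fun s : ℝ => p + (r - p) / (1 + s)) atTop (𝓝 p) := by
      simpa using h3.const_add p
    exact (Real.continuousAt_log hp.ne').tendsto.comp this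
  have h5 := (h4.const_mul p).sub h3
  rw [sub_zero] at h5
  refine h5.congr' ?_
  have hr : Tendsto (fun s : ℝ => r + s * p) atTop atTop :=
    tendsto_atTop_add_const_left _ _ (tendsto_id.atTop_mul_const hp)
  filter_upwards [eventually_gt_atTop 0, hr.eventually_gt_atTop 0] with s hs0 hrs
  have e1 : p + (r - p) / (1 + s) = (r + s * p) / (1 + s) := by field_simp; ring
  rw [e1, Real.log_div hrs.ne' (by positivity)]
  ring

/-- The primitive equals p ln r - (r - p) at s = 0 and tends to p ln p at infinity; the difference
is `klTerm p r`. -/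
lemma ofReal_klTerm_eq_lintegral {p r : ℝ} (hp : 0 ≤ p) (hr : 0 ≤ r) (h : r = 0 → p = 0) :
    ENNReal.ofReal (klTerm p r) = ∫⁻ s in Ioi (0 : ℝ), ENNReal.ofReal ((r - p) ^ 2 / (r + s * p)) *
      ENNReal.ofReal (1 / (1 + s) ^ 2) := by
  rcases hr.eq_or_lt with rfl | hr
  · simp [h rfl, klTerm]
  have hnn : ∀ s ∈ Ioi (0 : ℝ), 0 ≤ (r - p) ^ 2 / (r + s * p) * (1 / (1 + s) ^ 2) := fun s hs => by
    have : 0 < s := hs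
    positivity
  have hd : ∀ s ∈ Ici (0 : ℝ), HasDerivAt _ _ s := fun s hs => hasDerivAt_klPrimitive hp hr hs
  have hint := MeasureTheory.integrableOn_Ioi_deriv_of_nonneg' hd hnn (tendsto_klPrimitive hp)
  have hval := MeasureTheory.integral_Ioi_of_hasDerivAt_of_nonneg' hd hnn (tendsto_klPrimitive hp)
  have e1 : klTerm p r = ∫ s in Ioi (0 : ℝ), (r - p) ^ 2 / (r + s * p) * (1 / (1 + s) ^ 2) := by
    rw [hval, klTerm]; simp; ring
  rw [e1, MeasureTheory.ofReal_integral_eq_lintegral_ofReal hint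
    ((MeasureTheory.ae_restrict_iff' measurableSet_Ioi).2 (Eventually.of_forall hnn))]
  refine MeasureTheory.setLIntegral_congr_fun measurableSet_Ioi fun s hs => ?_
  have : (0 : ℝ) < s := hs
  exact ENNReal.ofReal_mul (by positivity)

/-- Countability is what lets the integral over s be exchanged with the sums over eigenvectors. -/
lemma countable_of_hilbertBasis [TopologicalSpace.SeparableSpace H] {ι : Type*}
    (b : HilbertBasis ι ℂ H) : Countable ι := by
  have hdist : ∀ i j, i ≠ j → 1 ≤ dist (b i) (b j) := by
    intro i j hij
    have h1 : ‖b i - b j‖ ^ 2 = 2 := by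
      rw [@norm_sub_sq ℂ, b.orthonormal.2 hij, b.orthonormal.1 i, b.orthonormal.1 j]; norm_num
    rw [dist_eq_norm]
    nlinarith [norm_nonneg (b i - b j)]
  have hdisj : (Set.univ : Set ι).PairwiseDisjoint fun i => Metric.ball (b i) (1 / 2) := by
    intro i _ j _ hij
    exact Metric.ball_disjoint_ball (by norm_num; exact hdist i j hij)
  exact Set.countable_univ_iff.1 (hdisj.countable_of_isOpen (fun _ _ => Metric.isOpen_ball)
    fun i _ => Metric.nonempty_ball.2 (by norm_num))

variable {ι κ : Type*}

theorem relEntropy_eq_lintegral [TopologicalSpace.SeparableSpace H] {ρ φ : traceClass H}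
    (hρ : IsState ρ) (hφ : IsState φ)
    (hker : ∀ v, (φ : H →L[ℂ] H) v = 0 → (ρ : H →L[ℂ] H) v = 0)
    {e : HilbertBasis ι ℂ H} {p : ι → ℝ} (he : IsEigenbasis (ρ : H →L[ℂ] H) e p)
    {f : HilbertBasis κ ℂ H} {r : κ → ℝ} (hf : IsEigenbasis (φ : H →L[ℂ] H) f r) :
    relEntropy ρ φ = ∫⁻ s in Ioi (0 : ℝ), quadRelEntropy e p f r s *
      ENNReal.ofReal (1 / (1 + s) ^ 2) := by
  have := countable_of_hilbertBasis e
  have := countable_of_hilbertBasis f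
  rw [relEntropy_eq_tsum hρ.1 hφ.1 hker he hf]
  have hmeas : ∀ i j, Measurable fun s : ℝ => ENNReal.ofReal (‖⟪f j, e i⟫_ℂ‖ ^ 2) *
      (ENNReal.ofReal ((r j - p i) ^ 2 / (r j + s * p i)) * ENNReal.ofReal (1 / (1 + s) ^ 2)) := by
    intro i j
    fun_prop
  simp only [quadRelEntropy, ← ENNReal.tsum_mul_right, mul_assoc]
  rw [MeasureTheory.lintegral_tsum fun i => (Measurable.tsum (hmeas i)).aemeasurable]
  refine tsum_congr fun i => ?_
  rw [MeasureTheory.lintegral_tsum fun j => (hmeas i j).aemeasurable]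
  refine tsum_congr fun j => ?_
  rw [MeasureTheory.lintegral_const_mul _ (by fun_prop)]
  by_cases hz : ‖⟪f j, e i⟫_ℂ‖ = 0
  · simp [hz]
  rw [ofReal_klTerm_eq_lintegral (he.nonneg hρ.1 i) (hf.nonneg hφ.1 j) fun h =>
    (mul_norm_inner_eq_zero hρ.1 hker he hf i j h).resolve_right hz]

lemma Dominates.map {Φ : traceClass H →ₗ[ℂ] traceClass H} (hΦ : CompletelyPositive Φ)
    {φ ρ : traceClass H} (h : Dominates φ ρ) : Dominates (Φ φ) (Φ ρ) := by
  obtain ⟨α, hα, hle⟩ := h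
  refine ⟨α, hα, ?_⟩
  rw [ContinuousLinearMap.le_def] at hle ⊢
  have := hΦ.isPositive (A := φ - (α : ℂ) • ρ) hle
  simpa using this

/-- Data-processing inequality. -/
theorem relEntropy_map_le [TopologicalSpace.SeparableSpace H]
    {Φ : traceClass H →ₗ[ℂ] traceClass H} (hΦ : CompletelyPositive Φ)
    (htr : ∀ A, trace (Φ A) = trace A) {ρ φ : traceClass H} (hρ : IsState ρ) (hφ : IsState φ)
    (hdom : Dominates φ ρ) : relEntropy (Φ ρ) (Φ φ) ≤ relEntropy ρ φ := by
  have hρ' := hΦ.isState htr hρ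
  have hφ' := hΦ.isState htr hφ
  obtain ⟨_, e, p, he⟩ := hρ.exists_isEigenbasis
  obtain ⟨_, f, r, hf⟩ := hφ.exists_isEigenbasis
  obtain ⟨_, e', p', he'⟩ := hρ'.exists_isEigenbasis
  obtain ⟨_, f', r', hf'⟩ := hφ'.exists_isEigenbasis
  rw [relEntropy_eq_lintegral hρ hφ (hdom.ker_le hρ.1) he hf,
    relEntropy_eq_lintegral hρ' hφ' ((hdom.map hΦ).ker_le hρ'.1) he' hf']
  refine MeasureTheory.setLIntegral_mono' measurableSet_Ioi fun s hs => ?_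
  gcongr
  exact quadRelEntropy_le hΦ htr hρ hφ he hf he' hf' hs

end RelEntropyMonotone

/-! ### Mixtures -/

section Mix

variable {φ ρ : traceClass H}

lemma coe_mix (φ ρ : traceClass H) (l : ℝ) : (mix φ ρ l : H →L[ℂ] H) =
    ((1 - l : ℝ) : ℂ) • (φ : H →L[ℂ] H) + (l : ℂ) • (ρ : H →L[ℂ] H) := rfl

lemma mix_zero (φ ρ : traceClass H) : mix φ ρ 0 = φ := by simp [mix]

lemma map_mix (Φ : traceClass H →ₗ[ℂ] traceClass H) (φ ρ : traceClass H) (l : ℝ) :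
    Φ (mix φ ρ l) = mix (Φ φ) (Φ ρ) l := by simp [mix]

lemma isPositive_real_smul {A : H →L[ℂ] H} (hA : A.IsPositive) {c : ℝ} (hc : 0 ≤ c) :
    ((c : ℂ) • A).IsPositive := hA.smul_of_nonneg (by exact_mod_cast hc)

/-- Splitting φ = (φ - αρ) + αρ shows positivity down to l = -α. These negative l put φ in the
interior of a segment of states. -/
lemma mix_isState {α : ℝ} (hα : 0 < α) (hle : (α : ℂ) • (ρ : H →L[ℂ] H) ≤ (φ : H →L[ℂ] H))
    (hφ : IsState φ) (hρ : IsState ρ) {l : ℝ} (hl : -α ≤ l) (hl1 : l ≤ 1) :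
    IsState (mix φ ρ l) := by
  refine ⟨?_, ?_⟩
  · have hc : 0 ≤ (1 - l) * α + l := by
      rcases le_total 0 l with h | h
      · nlinarith
      · nlinarith
    have e1 : (mix φ ρ l : H →L[ℂ] H) = ((1 - l : ℝ) : ℂ) • ((φ : H →L[ℂ] H) -
        (α : ℂ) • (ρ : H →L[ℂ] H)) + (((1 - l) * α + l : ℝ) : ℂ) • (ρ : H →L[ℂ] H) := by
      rw [coe_mix]; push_cast; module
    rw [e1]
    exact (isPositive_real_smul ((ContinuousLinearMap.le_def _ _).1 hle) (by linarith)).add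
      (isPositive_real_smul hρ.1 hc)
  · rw [mix, trace_add, trace_smul, trace_smul, hφ.2, hρ.2]; push_cast; ring

lemma dominates_mix {α : ℝ} (hα : 0 < α) (hle : (α : ℂ) • (ρ : H →L[ℂ] H) ≤ (φ : H →L[ℂ] H))
    (hφ : (φ : H →L[ℂ] H).IsPositive) (hρ : (ρ : H →L[ℂ] H).IsPositive) {l : ℝ} (hl1 : l ≤ 1) :
    Dominates φ (mix φ ρ l) := by
  have hle' := (ContinuousLinearMap.le_def _ _).1 hle
  rcases le_total 0 l with h | h
  -- C is chosen so that φ - φ(l)/C = φ/C + (l/(αC))(φ - αρ), a sum of positive operators.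
  · let C := 1 - l + l / α + 1
    have hC : 0 < C := by have : 0 ≤ l / α := by positivity
                          linarith
    refine ⟨1 / C, by positivity, ?_⟩
    rw [ContinuousLinearMap.le_def]
    have hCc : (C : ℂ) ≠ 0 := by exact_mod_cast hC.ne'
    have hαc : (α : ℂ) ≠ 0 := by exact_mod_cast hα.ne'
    have e1 : (φ : H →L[ℂ] H) - ((1 / C : ℝ) : ℂ) • (mix φ ρ l : H →L[ℂ] H) =
        ((1 / C : ℝ) : ℂ) • (φ : H →L[ℂ] H) + ((l / α / C : ℝ) : ℂ) • ((φ : H →L[ℂ] H) -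
          (α : ℂ) • (ρ : H →L[ℂ] H)) := by
      rw [coe_mix]
      have hCe : (C : ℂ) = 1 - l + l / α + 1 := by simp [C]
      match_scalars
      · field_simp
        rw [hCe]; field_simp; ring
      · field_simp
    rw [e1]
    exact (isPositive_real_smul hφ (by positivity)).add (isPositive_real_smul hle' (by positivity))
  · have hC : 0 < 1 - l := by linarith
    refine ⟨1 / (1 - l), by positivity, ?_⟩
    rw [ContinuousLinearMap.le_def]
    have hCc : (1 - l : ℂ) ≠ 0 := by exact_mod_cast hC.ne'
    have e1 : (φ : H →L[ℂ] H) - ((1 / (1 - l) : ℝ) : ℂ) • (mix φ ρ l : H →L[ℂ] H) =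
        ((-l / (1 - l) : ℝ) : ℂ) • (ρ : H →L[ℂ] H) := by
      rw [coe_mix]
      match_scalars
      · field_simp; ring
      · field_simp
    rw [e1]
    exact isPositive_real_smul hρ (div_nonneg (by linarith) hC.le)

lemma mix_mem_statesOf {P : Set (H →L[ℂ] H)} (hφ : φ ∈ statesOf P) (hρ : ρ ∈ statesOf P) {l : ℝ}
    (h : IsState (mix φ ρ l)) : mix φ ρ l ∈ statesOf P := by
  refine ⟨h, fun v => ?_⟩
  have := ((hφ.2 v).const_smul ((1 - l : ℝ) : ℂ)).add ((hρ.2 v).const_smul (l : ℂ))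
  simpa [coe_mix] using this

lemma crossEntropy_ne_top {κ : Type*} {A B : H →L[ℂ] H} {α : ℝ} (hα : 0 < α)
    (hle : (α : ℂ) • A ≤ B) {f : HilbertBasis κ ℂ H} {r : κ → ℝ} (hB : crossEntropy B f r ≠ ⊤) :
    crossEntropy A f r ≠ ⊤ := by
  have h := crossEntropy_mono hle f r
  rw [crossEntropy_smul hα.le] at h
  intro htop
  rw [htop, ENNReal.mul_top (by simpa using hα)] at h
  exact hB (top_le_iff.1 h)

/-- `D(ρ‖φ) + S(ρ)` is finite, and affine in `ρ`. -/
lemma relEntropy_add_entropy_mix {α : ℝ} (hα : 0 < α)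
    (hle : (α : ℂ) • (ρ : H →L[ℂ] H) ≤ (φ : H →L[ℂ] H))
    (hφ : IsState φ) (hρ : IsState ρ) (hS : entropy φ ≠ ⊤) {l : ℝ} (hl : -α ≤ l) (hl1 : l ≤ 1) :
    relEntropy ρ φ + entropy ρ ≠ ⊤ ∧
    relEntropy (mix φ ρ l) φ + entropy (mix φ ρ l) ≠ ⊤ ∧
    (relEntropy (mix φ ρ l) φ + entropy (mix φ ρ l)).toReal =
      (1 - l) * (entropy φ).toReal + l * (relEntropy ρ φ + entropy ρ).toReal := by
  obtain ⟨κ, f, r, hf⟩ := hφ.exists_isEigenbasis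
  have hψ := mix_isState hα hle hφ hρ hl hl1
  have hdψ := dominates_mix hα hle hφ.1 hρ.1 hl1
  have hdρ : Dominates φ ρ := ⟨α, hα, hle⟩
  rw [relEntropy_add_entropy hψ hφ (hdψ.ker_le hψ.1) hf,
    relEntropy_add_entropy hρ hφ (hdρ.ker_le hρ.1) hf, ← crossEntropy_self hφ hf]
  rw [← crossEntropy_self hφ hf] at hS
  have h1 := crossEntropy_ne_top hα hle hS
  have h2 : crossEntropy (mix φ ρ l : H →L[ℂ] H) f r ≠ ⊤ := by
    obtain ⟨β, hβ, hle'⟩ := hdψ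
    exact crossEntropy_ne_top hβ hle' hS
  refine ⟨h1, h2, ?_⟩
  rcases le_total 0 l with h | h
  · rw [coe_mix, crossEntropy_add (isPositive_real_smul hφ.1 (by linarith))
      (isPositive_real_smul hρ.1 h), crossEntropy_smul (by linarith), crossEntropy_smul h,
      ENNReal.toReal_add (ENNReal.mul_ne_top ENNReal.ofReal_ne_top hS)
        (ENNReal.mul_ne_top ENNReal.ofReal_ne_top h1), ENNReal.toReal_mul, ENNReal.toReal_mul,
      ENNReal.toReal_ofReal (by linarith), ENNReal.toReal_ofReal h]
  -- For l ≤ 0 the ρ term is moved across, since additivity of the cross entropy in [0, ∞] requires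
  -- nonnegative coefficients.
  · have e1 : ((1 - l : ℝ) : ℂ) • (φ : H →L[ℂ] H) = (mix φ ρ l : H →L[ℂ] H) +
        ((-l : ℝ) : ℂ) • (ρ : H →L[ℂ] H) := by
      rw [coe_mix]; push_cast; module
    have e2 := congrArg (fun A => (crossEntropy A f r).toReal) e1
    beta_reduce at e2
    rw [crossEntropy_add hψ.1 (isPositive_real_smul hρ.1 (by linarith)),
      crossEntropy_smul (by linarith), crossEntropy_smul (by linarith),
      ENNReal.toReal_add h2 (ENNReal.mul_ne_top ENNReal.ofReal_ne_top h1), ENNReal.toReal_mul,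
      ENNReal.toReal_mul, ENNReal.toReal_ofReal (by linarith),
      ENNReal.toReal_ofReal (by linarith)] at e2
    linarith

/-- Convexity of the entropy gain of a channel along a mixture, in a one-sided form. -/
lemma entropyGain_mix [TopologicalSpace.SeparableSpace H]
    {Φ : traceClass H →ₗ[ℂ] traceClass H} (hΦ : CompletelyPositive Φ)
    (htr : ∀ A, trace (Φ A) = trace A) {α : ℝ} (hα : 0 < α)
    (hle : (α : ℂ) • (ρ : H →L[ℂ] H) ≤ (φ : H →L[ℂ] H))
    (hφ : IsState φ) (hρ : IsState ρ) (hS : entropy φ ≠ ⊤) (hS' : entropy (Φ φ) ≠ ⊤)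
    {l : ℝ} (hl : -α ≤ l) (hl1 : l ≤ 1) :
    l * ((relEntropy (Φ ρ) (Φ φ) + entropy (Φ ρ)).toReal -
      (relEntropy ρ φ + entropy ρ).toReal) ≤
    ((entropy (Φ (mix φ ρ l))).toReal - (entropy (mix φ ρ l)).toReal) -
      (1 - l) * ((entropy (Φ φ)).toReal - (entropy φ).toReal) := by
  have hle' : (α : ℂ) • (Φ ρ : H →L[ℂ] H) ≤ (Φ φ : H →L[ℂ] H) := by
    rw [ContinuousLinearMap.le_def] at hle ⊢
    simpa using hΦ.isPositive (A := φ - (α : ℂ) • ρ) hle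
  obtain ⟨-, h1, h2⟩ := relEntropy_add_entropy_mix hα hle hφ hρ hS hl hl1
  obtain ⟨-, h3, h4⟩ := relEntropy_add_entropy_mix hα hle' (hΦ.isState htr hφ)
    (hΦ.isState htr hρ) hS' hl hl1
  have hdpi := relEntropy_map_le hΦ htr (mix_isState hα hle hφ hρ hl hl1) hφ
    (dominates_mix hα hle hφ.1 hρ.1 hl1)
  rw [← map_mix] at h3 h4
  rw [ENNReal.toReal_add (ENNReal.add_ne_top.1 h1).1 (ENNReal.add_ne_top.1 h1).2] at h2
  rw [ENNReal.toReal_add (ENNReal.add_ne_top.1 h3).1 (ENNReal.add_ne_top.1 h3).2] at h4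
  have h5 := ENNReal.toReal_mono (ENNReal.add_ne_top.1 h1).1 hdpi
  nlinarith

end Mix

/-! ### One-sided derivatives -/

section Derivatives

/-- Dividing by l t bounds c(t)/t above for l > 0 and below for l < 0. For fixed l both bounds
converge as t → 0, to (e(l) - e(0))/l + e(0), and these limits meet as l → 0 because e has a
two-sided derivative. -/
lemma tendsto_div_of_forall_slope_le {c : ℝ → ℝ} {h : ℝ → ℝ → ℝ} {e : ℝ → ℝ} {e' ε : ℝ}
    (hε : 0 < ε)
    (hle : ∀ l, |l| < ε → ∀ᶠ t in 𝓝[>] (0 : ℝ), l * c t ≤ h t l - (1 - l) * h t 0)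
    (hlim : ∀ l, |l| < ε → Tendsto (fun t => h t l / t) (𝓝[>] 0) (𝓝 (e l)))
    (he : HasDerivAt e e' 0) :
    Tendsto (fun t => c t / t) (𝓝[>] 0) (𝓝 (e 0 + e')) := by
  have hslope := hasDerivAt_iff_tendsto_slope.1 he
  have hslope' : Tendsto (fun l => (e l - e 0) / l + e 0) (𝓝[≠] 0) (𝓝 (e 0 + e')) := by
    rw [add_comm (e 0)]
    refine (hslope.add_const (e 0)).congr fun l => ?_
    rw [slope_def_field, sub_zero]
  have hlim' : ∀ l, |l| < ε → l ≠ 0 →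
      Tendsto (fun t => (h t l / t - h t 0 / t) / l + h t 0 / t) (𝓝[>] 0)
        (𝓝 ((e l - e 0) / l + e 0)) := fun l hl _ =>
    ((((hlim l hl).sub (hlim 0 (by simpa using hε))).div_const l).add
      (hlim 0 (by simpa using hε)))
  have hbd : ∀ᶠ l in 𝓝 (0 : ℝ), |l| < ε := by
    have : Tendsto (fun l : ℝ => |l|) (𝓝 0) (𝓝 0) := by simpa using (continuous_abs.tendsto (0 : ℝ))
    exact this.eventually (gt_mem_nhds hε)
  rw [tendsto_order]
  constructor
  · intro a ha
    have h1 : ∀ᶠ l in 𝓝[<] (0 : ℝ), a < (e l - e 0) / l + e 0 :=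
      (hslope'.mono_left (nhdsWithin_mono _ fun x hx => ne_of_lt hx)).eventually (lt_mem_nhds ha)
    obtain ⟨l, ⟨h2, h3⟩, h4⟩ := ((h1.and (hbd.filter_mono nhdsWithin_le_nhds)).and
      self_mem_nhdsWithin).exists
    have hl0 : l < 0 := h4
    filter_upwards [(hlim' l h3 hl0.ne).eventually (lt_mem_nhds h2), hle l h3,
      self_mem_nhdsWithin] with t ht1 ht2 ht3
    have ht : 0 < t := ht3
    have hl0' := hl0.ne
    refine ht1.trans_le ?_
    have e1 : (h t l / t - h t 0 / t) / l + h t 0 / t = (h t l - (1 - l) * h t 0) / l / t := by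
      field_simp; ring
    rw [e1]
    gcongr
    rw [div_le_iff_of_neg hl0]
    linarith
  · intro a ha
    have h1 : ∀ᶠ l in 𝓝[>] (0 : ℝ), (e l - e 0) / l + e 0 < a :=
      (hslope'.mono_left (nhdsWithin_mono _ fun x hx => ne_of_gt hx)).eventually (gt_mem_nhds ha)
    obtain ⟨l, ⟨h2, h3⟩, h4⟩ := ((h1.and (hbd.filter_mono nhdsWithin_le_nhds)).and
      self_mem_nhdsWithin).exists
    have hl0 : 0 < l := h4
    filter_upwards [(hlim' l h3 hl0.ne').eventually (gt_mem_nhds h2), hle l h3,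
      self_mem_nhdsWithin] with t ht1 ht2 ht3
    have ht : 0 < t := ht3
    refine lt_of_le_of_lt ?_ ht1
    have e1 : (h t l / t - h t 0 / t) / l + h t 0 / t = (h t l - (1 - l) * h t 0) / l / t := by
      field_simp; ring
    rw [e1]
    gcongr
    rw [le_div_iff₀ hl0]
    linarith

lemma HasRightDerivAtZero.unique {f : ℝ → EReal} {a b : EReal} (ha : HasRightDerivAtZero f a)
    (hb : HasRightDerivAtZero f b) : a = b := tendsto_nhds_unique ha.2.2 hb.2.2

lemma coe_ennreal_eq_coe_toReal {x : ℝ≥0∞} (hx : x ≠ ⊤) : (x : EReal) = (x.toReal : EReal) := by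
  rw [← EReal.toReal_coe_ennreal, EReal.coe_toReal (by simpa using hx) (EReal.coe_ennreal_ne_bot x)]

lemma quotient_eq_coe {F : ℝ → ℝ≥0∞} (h0 : F 0 ≠ ⊤) {t : ℝ} (ht : F t ≠ ⊤) :
    ((F t : EReal) - (F 0 : EReal)) / (t : EReal) =
      ((((F t).toReal - (F 0).toReal) / t : ℝ) : EReal) := by
  rw [coe_ennreal_eq_coe_toReal h0, coe_ennreal_eq_coe_toReal ht]
  norm_cast

lemma hasRightDerivAtZero_iff {F : ℝ → ℝ≥0∞} (h0 : F 0 ≠ ⊤) (ht : ∀ᶠ t in 𝓝[>] (0 : ℝ), F t ≠ ⊤)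
    {x : EReal} : HasRightDerivAtZero (fun t => (F t : EReal)) x ↔
      Tendsto (fun t => ((((F t).toReal - (F 0).toReal) / t : ℝ) : EReal)) (𝓝[>] 0) (𝓝 x) := by
  have hcongr : (fun t : ℝ => ((F t : EReal) - (F 0 : EReal)) / (t : EReal)) =ᶠ[𝓝[>] 0]
      fun t => ((((F t).toReal - (F 0).toReal) / t : ℝ) : EReal) := by
    filter_upwards [ht] with t ht using quotient_eq_coe h0 ht
  refine ⟨fun h => h.2.2.congr' hcongr, fun h => ⟨?_, ?_, h.congr' hcongr.symm⟩⟩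
  · exact EReal.coe_ennreal_ne_bot _
  · simpa using h0

lemma HasRightDerivAtZero.ne_top {F : ℝ → ℝ≥0∞} {x : EReal}
    (h : HasRightDerivAtZero (fun t => (F t : EReal)) x) : F 0 ≠ ⊤ := by
  simpa using h.2.1

lemma HasRightDerivAtZero.eventually_ne_top {F : ℝ → ℝ≥0∞} {x : EReal}
    (h : HasRightDerivAtZero (fun t => (F t : EReal)) x) (hx : x ≠ ⊤) :
    ∀ᶠ t in 𝓝[>] (0 : ℝ), F t ≠ ⊤ := by
  have h1 := h.2.2.eventually (gt_mem_nhds (lt_top_iff_ne_top.2 hx))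
  filter_upwards [h1, self_mem_nhdsWithin] with t ht1 ht2 htop
  have ht : (0 : ℝ) < t := ht2
  simp only [htop, coe_ennreal_eq_coe_toReal h.ne_top, EReal.coe_ennreal_top, EReal.top_sub_coe] at ht1
  rw [EReal.top_div_of_pos_ne_top (by exact_mod_cast ht) (EReal.coe_ne_top t)] at ht1
  exact lt_irrefl _ ht1

lemma HasRightDerivAtZero.tendsto_real {F : ℝ → ℝ≥0∞} {x : ℝ}
    (h : HasRightDerivAtZero (fun t => (F t : EReal)) x) :
    Tendsto (fun t => ((F t).toReal - (F 0).toReal) / t) (𝓝[>] 0) (𝓝 x) := by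
  have h1 := (hasRightDerivAtZero_iff h.ne_top (h.eventually_ne_top (EReal.coe_ne_top x))).1 h
  exact EReal.tendsto_coe.1 h1

end Derivatives

/-! ### The mismatch cost -/

section Mismatch

variable [TopologicalSpace.SeparableSpace H] {T : ℝ → traceClass H →ₗ[ℂ] traceClass H}
  {φ ρ : traceClass H}

lemma IsLindbladSemigroup.isState (hT : IsLindbladSemigroup T) {t : ℝ} (ht : 0 ≤ t)
    {ω : traceClass H} (hω : IsState ω) : IsState (T t ω) :=
  (hT.completelyPositive t ht).isState (hT.tracePreserving t ht) hω

/-- The squeeze gives the derivative of D + S(ρ(t)); subtracting the entropy rate x of ρ isolates D.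
The case x = ∞ is allowed, and then D has slope -∞. -/
theorem hasRightDerivAtZero_relEntropy (hT : IsLindbladSemigroup T) (hφ : IsState φ)
    (hρ : IsState ρ) (hdom : Dominates φ ρ) {ε : ℝ} (hε : 0 < ε) {e : ℝ → ℝ} {e' : ℝ}
    (he : ∀ l, |l| < ε →
      HasRightDerivAtZero (fun t => (entropy (T t (mix φ ρ l)) : EReal)) (e l))
    (hde : HasDerivAt e e' 0) {x : EReal} (hx : x ≠ ⊥)
    (hρx : HasRightDerivAtZero (fun t => (entropy (T t ρ) : EReal)) x) :
    HasRightDerivAtZero (fun t => (relEntropy (T t ρ) (T t φ) : EReal)) ((e 0 + e' : ℝ) - x) := by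
  obtain ⟨α, hα, hle⟩ := hdom
  have hT0 : ∀ ω, T 0 ω = ω := fun ω => by rw [hT.zero]; rfl
  have hφe := he 0 (by simpa using hε)
  rw [mix_zero] at hφe
  have hSφ : entropy φ ≠ ⊤ := by simpa [hT0] using hφe.ne_top
  have hSφt := hφe.eventually_ne_top (EReal.coe_ne_top _)
  let F : ℝ → ℝ≥0∞ := fun t => relEntropy (T t ρ) (T t φ) + entropy (T t ρ)
  have hle_t : ∀ t, 0 ≤ t → (α : ℂ) • (T t ρ : H →L[ℂ] H) ≤ (T t φ : H →L[ℂ] H) := by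
    intro t ht
    rw [ContinuousLinearMap.le_def] at hle ⊢
    simpa using (hT.completelyPositive t ht).isPositive (A := φ - (α : ℂ) • ρ) hle
  have hFt : ∀ t, 0 ≤ t → entropy (T t φ) ≠ ⊤ → F t ≠ ⊤ := fun t ht h =>
    (relEntropy_add_entropy_mix hα (hle_t t ht) (hT.isState ht hφ) (hT.isState ht hρ) h
      (l := 0) (by linarith) zero_le_one).1
  have hF0 : F 0 ≠ ⊤ := hFt 0 le_rfl (by rwa [hT0])
  have hFev : ∀ᶠ t in 𝓝[>] (0 : ℝ), F t ≠ ⊤ := by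
    filter_upwards [hSφt, self_mem_nhdsWithin] with t h1 h2 using hFt t (le_of_lt h2) h1
  have hc : Tendsto (fun t => ((F t).toReal - (F 0).toReal) / t) (𝓝[>] 0) (𝓝 (e 0 + e')) := by
    refine tendsto_div_of_forall_slope_le (c := fun t => (F t).toReal - (F 0).toReal)
      (h := fun t l => (entropy (T t (mix φ ρ l))).toReal - (entropy (T 0 (mix φ ρ l))).toReal)
      (lt_min hε (lt_min hα one_pos)) (fun l hl => ?_)
      (fun l hl => (he l (hl.trans_le (min_le_left _ _))).tendsto_real) hde
    have hl' := abs_lt.1 (hl.trans_le (min_le_right _ _))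
    have h1 := hl'.1
    have h2 := hl'.2
    have h3 : min α 1 ≤ α := min_le_left _ _
    have h4 : min α 1 ≤ 1 := min_le_right _ _
    filter_upwards [hSφt, self_mem_nhdsWithin] with t ht1 ht2
    have ht : (0 : ℝ) ≤ t := le_of_lt ht2
    have := entropyGain_mix (hT.completelyPositive t ht) (hT.tracePreserving t ht) hα hle hφ hρ hSφ
      ht1 (l := l) (by linarith) (by linarith)
    simpa only [F, hT0, mix_zero] using this
  have hG0 : relEntropy (T 0 ρ) (T 0 φ) ≠ ⊤ := (ENNReal.add_ne_top.1 hF0).1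
  have hGev : ∀ᶠ t in 𝓝[>] (0 : ℝ), relEntropy (T t ρ) (T t φ) ≠ ⊤ := by
    filter_upwards [hFev] with t h using (ENNReal.add_ne_top.1 h).1
  have hSev : ∀ᶠ t in 𝓝[>] (0 : ℝ), entropy (T t ρ) ≠ ⊤ := by
    filter_upwards [hFev] with t h using (ENNReal.add_ne_top.1 h).2
  have hS0 : entropy (T 0 ρ) ≠ ⊤ := (ENNReal.add_ne_top.1 hF0).2
  rw [hasRightDerivAtZero_iff (F := fun t => relEntropy (T t ρ) (T t φ)) hG0 hGev]
  rw [hasRightDerivAtZero_iff (F := fun t => entropy (T t ρ)) hS0 hSev] at hρx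
  have heq : (fun t => ((((F t).toReal - (F 0).toReal) / t -
      ((entropy (T t ρ)).toReal - (entropy (T 0 ρ)).toReal) / t : ℝ) : EReal)) =ᶠ[𝓝[>] 0]
      fun t => ((((relEntropy (T t ρ) (T t φ)).toReal -
        (relEntropy (T 0 ρ) (T 0 φ)).toReal) / t : ℝ) : EReal) := by
    filter_upwards [hGev, hSev] with t h1 h2
    simp only [F]
    rw [ENNReal.toReal_add h1 h2, ENNReal.toReal_add hG0 hS0]
    congr 1
    ring
  refine Tendsto.congr' heq ?_
  induction x with
  | bot => exact absurd rfl hx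
  | coe x =>
    have h1 : Tendsto _ _ (𝓝 x) := EReal.tendsto_coe.1 hρx
    rw [← EReal.coe_sub]
    exact EReal.tendsto_coe.2 (hc.sub h1)
  | top =>
    rw [EReal.sub_top]
    rw [EReal.tendsto_coe_nhds_top_iff] at hρx
    rw [EReal.tendsto_coe_nhds_bot_iff]
    simpa only [sub_eq_add_neg, Function.comp_def] using hc.add_atBot (tendsto_neg_atTop_atBot.comp hρx)

end Mismatch

/-! ### Extending the linear functional to negative mixing parameters -/

section LinearFunctional

variable {Q : traceClass H → EReal} {φ ρ : traceClass H}

/-- Linearity of Q is given only for proper mixtures. For l < 0, φ itself is a proper mixture of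
φ(l) and ρ, and the relation can be solved for Q(φ(l)). -/
lemma eq_mix_mix (φ ρ : traceClass H) {l : ℝ} (hl : l < 0) :
    φ = mix (mix φ ρ l) ρ (-l / (1 - l)) := by
  have h1 : (1 - l : ℂ) ≠ 0 := by
    have : (1 - l : ℝ) ≠ 0 := by linarith
    exact_mod_cast this
  simp only [mix]
  match_scalars
  · field_simp; ring
  · field_simp; ring

/-- ρ occurs in φ with positive weight and the other component has Q ≠ -∞, so Q(ρ) = ∞ would force
Q(φ) = ∞. -/
lemma IsLinearOnStates.ne_top_of_dominates (hQ : IsLinearOnStates Q) (hφ : IsState φ)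
    (hρ : IsState ρ) (hdom : Dominates φ ρ) (h : Q φ ≠ ⊤) : Q ρ ≠ ⊤ := by
  obtain ⟨α, hα, hle⟩ := hdom
  have hψ := mix_isState hα hle hφ hρ (l := -α) le_rfl (by linarith)
  have hs0 : 0 < -(-α) / (1 - -α) := by rw [neg_neg]; apply div_pos <;> linarith
  have hs1 : -(-α) / (1 - -α) < 1 := by rw [div_lt_one] <;> linarith
  have h1 := hQ.2 _ _ hψ hρ _ hs0 hs1
  rw [← eq_mix_mix φ ρ (by linarith)] at h1
  intro htop
  rw [htop, EReal.coe_mul_top_of_pos hs0] at h1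
  refine h (h1.trans (EReal.add_top_of_ne_bot ?_))
  have hb := hQ.1 _ hψ
  generalize Q (mix φ ρ (-α)) = q at hb
  have hs : 0 < 1 - -(-α) / (1 - -α) := by linarith
  induction q with
  | bot => exact absurd rfl hb
  | coe q => rw [← EReal.coe_mul]; exact EReal.coe_ne_bot _
  | top => rw [EReal.coe_mul_top_of_pos hs]; simp

lemma IsLinearOnStates.mix_eq (hQ : IsLinearOnStates Q) (hφ : IsState φ) (hρ : IsState ρ)
    {α : ℝ} (hα : 0 < α) (hle : (α : ℂ) • (ρ : H →L[ℂ] H) ≤ (φ : H →L[ℂ] H)) {a b : ℝ}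
    (ha : Q φ = a) (hb : Q ρ = b) {l : ℝ} (hl : -α ≤ l) (hl1 : l < 1) :
    Q (mix φ ρ l) = ((1 - l) * a + l * b : ℝ) := by
  rcases lt_trichotomy l 0 with h | h | h
  · have hψ := mix_isState hα hle hφ hρ hl hl1.le
    have hs0 : 0 < -l / (1 - l) := by apply div_pos <;> linarith
    have hs1 : -l / (1 - l) < 1 := by rw [div_lt_one] <;> linarith
    have h1 := hQ.2 _ _ hψ hρ _ hs0 hs1
    rw [← eq_mix_mix φ ρ h, ha, hb] at h1
    have hbot := hQ.1 _ hψ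
    generalize Q (mix φ ρ l) = q at hbot h1
    have hs : 0 < 1 - -l / (1 - l) := by linarith
    induction q with
    | bot => exact absurd rfl hbot
    | coe q =>
      norm_cast at h1 ⊢
      have h2 : (1 - l) ≠ 0 := by linarith
      field_simp at h1
      linarith
    | top =>
      rw [EReal.coe_mul_top_of_pos hs, ← EReal.coe_mul, EReal.top_add_coe] at h1
      exact absurd h1 (EReal.coe_ne_top a)
  · subst h; rw [mix_zero, ha]; simp
  · rw [hQ.2 _ _ hφ hρ l h hl1, ha, hb]; norm_cast

end LinearFunctional

/-! ### The identity from stationarity at the minimizer -/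

section Identity

variable [TopologicalSpace.SeparableSpace H] {T : ℝ → traceClass H →ₗ[ℂ] traceClass H}
  {Q : traceClass H → EReal} {φ ρ : traceClass H}

lemma entropyRate_eq {ω : traceClass H} {x : EReal}
    (h : HasRightDerivAtZero (fun t => (entropy (T t ω) : EReal)) x) : entropyRate T ω = x := by
  have hex : ∃ e, HasRightDerivAtZero (fun t => (entropy (T t ω) : EReal)) e := ⟨x, h⟩
  rw [entropyRate, dif_pos hex]
  exact hex.choose_spec.unique h

lemma hasRightDerivAtZero_entropyRate {ω : traceClass H} (h : entropyRate T ω ≠ ⊤) :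
    HasRightDerivAtZero (fun t => (entropy (T t ω) : EReal)) (entropyRate T ω) := by
  rw [entropyRate] at h ⊢
  split_ifs with hex
  · exact hex.choose_spec
  · rw [dif_neg hex] at h; exact absurd rfl h

/-- The mismatch cost identity, given the entropy rates along the mixtures of `φ` and `ρ`. -/
theorem mismatchCostIdentity_of_entropyRates (hT : IsLindbladSemigroup T)
    (hQ : IsLinearOnStates Q) {P : Set (H →L[ℂ] H)} (hmin : IsEPRateMinimizer T Q (statesOf P) φ)
    (hρP : ρ ∈ statesOf P) (hdom : Dominates φ ρ) (hQφ : Q φ ≠ ⊤)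
    {ε : ℝ} (hε : 0 < ε) {e : ℝ → ℝ}
    (he : ∀ l, |l| < ε →
      HasRightDerivAtZero (fun t => (entropy (T t (mix φ ρ l)) : EReal)) (e l))
    (hde : DifferentiableAt ℝ e 0) {x : EReal} (hx : x ≠ ⊥)
    (hρx : HasRightDerivAtZero (fun t => (entropy (T t ρ) : EReal)) x) :
    MismatchCostIdentity T Q φ ρ := by
  have hφ : IsState φ := hmin.1.1
  have hρ : IsState ρ := hρP.1
  have hQρ := hQ.ne_top_of_dominates hφ hρ hdom hQφ
  obtain ⟨a, ha⟩ : ∃ a : ℝ, Q φ = a := ⟨_, (EReal.coe_toReal hQφ (hQ.1 _ hφ)).symm⟩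
  obtain ⟨b, hb⟩ : ∃ b : ℝ, Q ρ = b := ⟨_, (EReal.coe_toReal hQρ (hQ.1 _ hρ)).symm⟩
  have hd := hde.hasDerivAt
  obtain ⟨α, hα, hle⟩ := id hdom
  have hφe := he 0 (by simpa using hε)
  rw [mix_zero] at hφe
  -- A two-sided minimum: mixtures with small negative l are states and still belong to `statesOf
  -- P`.
  have hmin0 : IsLocalMin (fun l => e l + ((1 - l) * a + l * b)) 0 := by
    have hbd : ∀ᶠ l in 𝓝 (0 : ℝ), |l| < min ε (min α 1) := by
      have : Tendsto (fun l : ℝ => |l|) (𝓝 0) (𝓝 0) := by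
        simpa using (continuous_abs.tendsto (0 : ℝ))
      exact this.eventually (gt_mem_nhds (lt_min hε (lt_min hα one_pos)))
    filter_upwards [hbd] with l hl
    have hl' := abs_lt.1 (hl.trans_le (min_le_right _ _))
    have h1 := hl'.1
    have h2 := hl'.2
    have h3 : min α 1 ≤ α := min_le_left _ _
    have h4 : min α 1 ≤ 1 := min_le_right _ _
    have hψ := mix_isState hα hle hφ hρ (l := l) (by linarith) (by linarith)
    have h5 := hmin.2 _ (mix_mem_statesOf hmin.1 hρP hψ)
    rw [epRate, epRate, entropyRate_eq hφe, ha,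
      entropyRate_eq (he l (hl.trans_le (min_le_left _ _))),
      hQ.mix_eq hφ hρ hα hle ha hb (by linarith) (by linarith)] at h5
    norm_cast at h5
    simpa using h5
  have hzero : deriv e 0 + (b - a) = 0 := by
    have hd2 : HasDerivAt (fun l => e l + ((1 - l) * a + l * b)) (deriv e 0 + (b - a)) 0 := by
      have h1 := (((hasDerivAt_id (0 : ℝ)).const_sub 1).mul_const a).add
        ((hasDerivAt_id (0 : ℝ)).mul_const b)
      refine (hd.add h1).congr_deriv ?_
      ring
    exact hmin0.hasDerivAt_eq_zero hd2
  refine ⟨_, hasRightDerivAtZero_relEntropy hT hφ hρ hdom hε he hd hx hρx, ?_⟩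
  rw [epRate, epRate, entropyRate_eq hρx, entropyRate_eq hφe, ha, hb]
  have hd' : deriv e 0 = a - b := by linarith
  rw [hd']
  induction x with
  | bot => exact absurd rfl hx
  | coe x => norm_cast; ring
  | top =>
    rw [EReal.sub_top, EReal.top_add_coe, ← EReal.coe_add, EReal.top_sub_coe, EReal.neg_bot]

lemma isFinite_of_isFinite_add {x y : EReal} (h : IsFinite (x + y)) : IsFinite x ∧ IsFinite y := by
  obtain ⟨h1, h2⟩ := h
  have hx : x ≠ ⊥ := fun h => h1 (by rw [h, EReal.bot_add])
  have hy : y ≠ ⊥ := fun h => h1 (by rw [h, EReal.add_bot])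
  exact ⟨⟨hx, fun h => h2 (by rw [h, EReal.top_add_of_ne_bot hy])⟩,
    ⟨hy, fun h => h2 (by rw [h, EReal.add_top_of_ne_bot hx])⟩⟩

/-- Along the segment Q is finite and affine, so subtracting it transfers finiteness and
differentiability from the EP rate to the entropy rate. Minimality rules out the value -∞ at ρ. -/
theorem mismatchCostIdentity_of_smooth (hT : IsLindbladSemigroup T)
    (hQ : IsLinearOnStates Q) {P : Set (H →L[ℂ] H)} (hmin : IsEPRateMinimizer T Q (statesOf P) φ)
    (hρP : ρ ∈ statesOf P) (hρtop : epRate T Q ρ < ⊤) (hdom : Dominates φ ρ)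
    (hsmooth : SmoothNearMinimizer T Q φ ρ) :
    IsFinite (epRate T Q ρ) ∧ IsFinite (epRate T Q φ) ∧ MismatchCostIdentity T Q φ ρ := by
  obtain ⟨ε, hε, hfin, hC1⟩ := hsmooth hdom
  have hφfin : IsFinite (epRate T Q φ) := by
    simpa only [mix_zero] using hfin 0 ⟨by linarith, hε⟩
  have hρfin : IsFinite (epRate T Q ρ) := by
    refine ⟨fun h => ?_, hρtop.ne⟩
    have := hmin.2 ρ hρP
    rw [h, le_bot_iff] at this
    exact hφfin.1 this
  refine ⟨hρfin, hφfin, ?_⟩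
  have hφ : IsState φ := hmin.1.1
  have hρ : IsState ρ := hρP.1
  obtain ⟨-, hQφ⟩ := isFinite_of_isFinite_add hφfin
  obtain ⟨hρr, hQρ⟩ := isFinite_of_isFinite_add hρfin
  let e : ℝ → ℝ := fun l => (entropyRate T (mix φ ρ l)).toReal
  have hrate : ∀ l, |l| < ε → IsFinite (entropyRate T (mix φ ρ l)) := fun l hl =>
    (isFinite_of_isFinite_add (hfin l (abs_lt.1 hl))).1
  have he : ∀ l, |l| < ε →
      HasRightDerivAtZero (fun t => (entropy (T t (mix φ ρ l)) : EReal)) (e l) := by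
    intro l hl
    simp only [e]
    rw [EReal.coe_toReal (hrate l hl).2 (hrate l hl).1]
    exact hasRightDerivAtZero_entropyRate (hrate l hl).2
  obtain ⟨α, hα, hle⟩ := id hdom
  have hde : DifferentiableAt ℝ e 0 := by
    have h1 : DifferentiableAt ℝ (fun l => (epRate T Q (mix φ ρ l)).toReal) 0 :=
      (hC1.differentiableOn one_ne_zero).differentiableAt (Ioo_mem_nhds (by linarith) hε)
    have h2 : DifferentiableAt ℝ (fun l : ℝ => (1 - l) * (Q φ).toReal + l * (Q ρ).toReal) 0 := by
      fun_prop
    refine (h1.sub h2).congr_of_eventuallyEq ?_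
    have hbd : ∀ᶠ l in 𝓝 (0 : ℝ), |l| < min ε (min α 1) := by
      have : Tendsto (fun l : ℝ => |l|) (𝓝 0) (𝓝 0) := by
        simpa using (continuous_abs.tendsto (0 : ℝ))
      exact this.eventually (gt_mem_nhds (lt_min hε (lt_min hα one_pos)))
    filter_upwards [hbd] with l hl
    have hl' := abs_lt.1 (hl.trans_le (min_le_right _ _))
    have h1 := hl'.1
    have h2 := hl'.2
    have h3 : min α 1 ≤ α := min_le_left _ _
    have h4 : min α 1 ≤ 1 := min_le_right _ _
    have hlε := hl.trans_le (min_le_left _ _)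
    have h5 := hQ.mix_eq hφ hρ hα hle (EReal.coe_toReal hQφ.2 hQφ.1).symm
      (EReal.coe_toReal hQρ.2 hQρ.1).symm (l := l) (by linarith) (by linarith)
    simp only [Pi.sub_apply]
    rw [epRate, h5, EReal.toReal_add (hrate l hlε).2 (hrate l hlε).1 (EReal.coe_ne_top _)
      (EReal.coe_ne_bot _), EReal.toReal_coe]
    simp [e]
  exact mismatchCostIdentity_of_entropyRates hT hQ hmin hρP hdom hQφ.2 hε he hde hρr.1
    (hasRightDerivAtZero_entropyRate hρr.2)

end Identity

/-! ### Norm-continuous semigroups in a Banach algebra -/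

section Semigroup

variable {A : Type*} [NormedRing A] [NormedAlgebra ℝ A] [CompleteSpace A] {f : ℝ → A}

lemma continuousOn_of_semigroup (hf : ∀ s t, 0 ≤ s → 0 ≤ t → f (s + t) = f s * f t)
    (h0 : f 0 = 1) (hlim : Tendsto f (𝓝[>] 0) (𝓝 1)) {a C : ℝ}
    (hC : ∀ t ∈ Icc 0 a, ‖f t‖ ≤ C) : ContinuousOn f (Icc 0 a) := by
  have hlim' : ∀ ε > 0, ∃ δ > 0, ∀ t, 0 ≤ t → t < δ → ‖f t - 1‖ < ε := by
    intro ε hε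
    have h1 := (Metric.tendsto_nhdsWithin_nhds.1 hlim) ε hε
    obtain ⟨δ, hδ, h⟩ := h1
    refine ⟨δ, hδ, fun t ht htδ => ?_⟩
    rcases ht.eq_or_lt with rfl | ht
    · simpa [h0] using hε
    · rw [← dist_eq_norm]
      exact h ht (by simpa [abs_of_pos ht] using htδ)
  have key : ∀ s ∈ Icc 0 a, ∀ t, s ≤ t → ‖f t - f s‖ ≤ C * ‖f (t - s) - 1‖ := by
    intro s hs t hst
    have h1 : f t = f s * f (t - s) := by rw [← hf s _ hs.1 (by linarith)]; congr 1; ring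
    rw [h1, show f s * f (t - s) - f s = f s * (f (t - s) - 1) by noncomm_ring]
    exact (norm_mul_le _ _).trans (by gcongr; exact hC s hs)
  rw [Metric.continuousOn_iff]
  intro b hb ε hε
  have hC0 : 0 ≤ C := (norm_nonneg _).trans (hC b hb)
  obtain ⟨δ, hδ, h⟩ := hlim' (ε / (C + 1)) (by positivity)
  refine ⟨δ, hδ, fun t ht htb => ?_⟩
  have hfin : ∀ x : ℝ, 0 ≤ x → x < δ → C * ‖f x - 1‖ < ε := by
    intro x hx hxδ
    have h1 := h x hx hxδ
    rw [lt_div_iff₀ (by positivity)] at h1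
    nlinarith [norm_nonneg (f x - 1)]
  rw [Real.dist_eq] at htb
  rw [dist_eq_norm]
  rcases le_total b t with hbt | hbt
  · exact (key b hb t hbt).trans_lt
      (hfin _ (by linarith) (by rwa [abs_of_nonneg (by linarith)] at htb))
  · rw [norm_sub_rev]
    refine (key t ht b hbt).trans_lt (hfin _ (by linarith) ?_)
    rw [abs_of_nonpos (by linarith)] at htb; linarith

/-- A one-parameter semigroup that is norm continuous at zero has a bounded generator. -/
theorem exists_generator_of_semigroup (hf : ∀ s t, 0 ≤ s → 0 ≤ t → f (s + t) = f s * f t)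
    (h0 : f 0 = 1) (hlim : Tendsto f (𝓝[>] 0) (𝓝 1)) :
    ∃ (L : A) (K δ : ℝ), 0 ≤ K ∧ 0 < δ ∧ ∀ t ∈ Icc 0 δ, ‖f t - 1 - t • L‖ ≤ K * t ^ 2 := by
  obtain ⟨a, ha, hbd⟩ : ∃ a > 0, ∀ t ∈ Icc 0 a, ‖f t - 1‖ ≤ 1 / 2 := by
    obtain ⟨δ, hδ, h⟩ := (Metric.tendsto_nhdsWithin_nhds.1 hlim) (1 / 2) (by norm_num)
    refine ⟨δ / 2, by positivity, fun t ht => ?_⟩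
    rcases ht.1.eq_or_lt with rfl | ht0
    · simp [h0]
    · rw [← dist_eq_norm]
      exact (h ht0 (by simp only [dist_zero_right, Real.norm_eq_abs, abs_of_pos ht0]
                       linarith [ht.2])).le
  let C : ℝ := ‖(1 : A)‖ + 1
  have hC : ∀ t ∈ Icc 0 a, ‖f t‖ ≤ C := by
    intro t ht
    have h1 := norm_add_le (f t - 1) 1
    rw [sub_add_cancel] at h1
    have := hbd t ht
    simp only [C]; linarith
  have hC0 : 0 ≤ C := by positivity
  have hcont := continuousOn_of_semigroup hf h0 hlim hC
  have hint : ∀ x y, x ∈ Icc 0 a → y ∈ Icc 0 a →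
      IntervalIntegrable f MeasureTheory.volume x y := fun x y hx hy =>
    (hcont.mono (uIcc_subset_Icc hx hy)).intervalIntegrable
  let M : ℝ → A := fun t => ∫ s in (0 : ℝ)..t, f s
  -- Half of a, so that the shifted intervals [t, t + δ] with t ≤ δ stay where f is controlled.
  let δ := a / 2
  have hδ : 0 < δ := by positivity
  have hδa : δ + δ = a := by simp only [δ]; ring
  have hMnear : ∀ t ∈ Icc 0 a, ∀ c, (∀ s ∈ Icc 0 t, ‖f s - 1‖ ≤ c) →
      ‖M t - t • (1 : A)‖ ≤ c * t := by
    intro t ht c hc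
    have h1 : M t - t • (1 : A) = ∫ s in (0 : ℝ)..t, (f s - 1) := by
      rw [intervalIntegral.integral_sub (hint 0 t ⟨le_rfl, ha.le⟩ ht) (by simp)]
      simp [M]
    rw [h1]
    have h2 := intervalIntegral.norm_integral_le_of_norm_le_const (a := (0 : ℝ)) (b := t)
      (f := fun s => f s - 1) (C := c) (fun s hs => by
        rw [uIoc_of_le ht.1] at hs
        exact hc s ⟨hs.1.le, hs.2⟩)
    rwa [sub_zero, abs_of_nonneg ht.1] at h2
  -- The average of f over [0, δ] lies within 1/2 of 1, hence is invertible by the Neumann series.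
  have hunit : IsUnit (M δ) := by
    have h1 := hMnear δ ⟨hδ.le, by linarith⟩ (1 / 2) (fun s hs => hbd s ⟨hs.1, by linarith [hs.2]⟩)
    have h2 : ‖(1 : A) - δ⁻¹ • M δ‖ < 1 := by
      have e1 : (1 : A) - δ⁻¹ • M δ = -(δ⁻¹ • (M δ - δ • (1 : A))) := by
        rw [smul_sub, smul_smul, inv_mul_cancel₀ hδ.ne', one_smul]; abel
      rw [e1, norm_neg, norm_smul, norm_inv, Real.norm_of_nonneg hδ.le,
        inv_mul_lt_iff₀ hδ]
      linarith
    have h3 : IsUnit (δ⁻¹ • M δ) := by simpa using isUnit_one_sub_of_norm_lt_one h2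
    have e2 : M δ = algebraMap ℝ A δ * (δ⁻¹ • M δ) := by
      rw [← Algebra.smul_def, smul_smul, mul_inv_cancel₀ hδ.ne', one_smul]
    rw [e2]
    exact ((IsUnit.mk0 δ hδ.ne').map (algebraMap ℝ A)).mul h3
  -- By the semigroup law both sides equal the integral of f over [0, t + δ] minus those over [0, t]
  -- and [0, δ]. Inverting `M δ` gives f t - 1 = M t · L.
  have hmul : ∀ t ∈ Icc 0 δ, (f t - 1) * M δ = M t * (f δ - 1) := by
    intro t ht
    have hta : t ∈ Icc 0 a := ⟨ht.1, by linarith [ht.2]⟩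
    have hδI : δ ∈ Icc 0 a := ⟨hδ.le, by linarith⟩
    have h0I : (0 : ℝ) ∈ Icc 0 a := ⟨le_rfl, ha.le⟩
    have htδ : t + δ ∈ Icc 0 a := ⟨by linarith [ht.1], by linarith [ht.2]⟩
    have e1 : f t * M δ = ∫ s in t..(t + δ), f s := by
      have h1 := (ContinuousLinearMap.mul ℝ A (f t)).intervalIntegral_comp_comm
        (hint 0 δ h0I hδI)
      simp only [ContinuousLinearMap.mul_apply'] at h1
      simp only [M]
      rw [← h1]
      have h2 := intervalIntegral.integral_comp_add_left (a := 0) (b := δ) f t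
      rw [add_zero] at h2
      rw [← h2]
      refine intervalIntegral.integral_congr fun s hs => ?_
      rw [uIcc_of_le hδ.le] at hs
      exact (hf t s ht.1 hs.1).symm
    have e2 : M t * f δ = ∫ s in δ..(t + δ), f s := by
      have h1 := ((ContinuousLinearMap.mul ℝ A).flip (f δ)).intervalIntegral_comp_comm
        (hint 0 t h0I hta)
      simp only [ContinuousLinearMap.flip_apply, ContinuousLinearMap.mul_apply'] at h1
      simp only [M]
      rw [← h1]
      have h2 := intervalIntegral.integral_comp_add_right (a := 0) (b := t) f δ
      rw [zero_add] at h2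
      rw [← h2]
      refine intervalIntegral.integral_congr fun s hs => ?_
      rw [uIcc_of_le ht.1] at hs
      exact (hf s δ hs.1 hδ.le).symm
    rw [sub_mul, mul_sub, e1, e2, one_mul, mul_one]
    have h3 := intervalIntegral.integral_add_adjacent_intervals (hint 0 t h0I hta)
      (hint t (t + δ) hta htδ)
    have h4 := intervalIntegral.integral_add_adjacent_intervals (hint 0 δ h0I hδI)
      (hint δ (t + δ) hδI htδ)
    simp only [M]
    rw [sub_eq_sub_iff_add_eq_add, add_comm, h3, ← h4, add_comm]
  obtain ⟨m, hm⟩ := hunit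
  let L : A := (f δ - 1) * (↑m⁻¹ : A)
  have hgen : ∀ t ∈ Icc 0 δ, f t - 1 = M t * L := by
    intro t ht
    have h1 := hmul t ht
    rw [← hm] at h1
    simp only [L]
    rw [← mul_assoc, ← h1, mul_assoc, Units.mul_inv, mul_one]
  have hMle : ∀ t ∈ Icc 0 δ, ‖M t‖ ≤ C * t := by
    intro t ht
    have h2 := intervalIntegral.norm_integral_le_of_norm_le_const (a := (0 : ℝ)) (b := t)
      (f := f) (C := C) (fun s hs => by
        rw [uIoc_of_le ht.1] at hs
        exact hC s ⟨hs.1.le, by linarith [hs.2, ht.2]⟩)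
    rwa [sub_zero, abs_of_nonneg ht.1] at h2
  refine ⟨L, C * ‖L‖ * ‖L‖, δ, by positivity, hδ, fun t ht => ?_⟩
  -- Bootstrap: f s - 1 = M s · L is already O(s), and integrating it gives the quadratic error.
  have h1 : ‖M t - t • (1 : A)‖ ≤ (C * t * ‖L‖) * t := by
    refine hMnear t ⟨ht.1, by linarith [ht.2]⟩ _ fun s hs => ?_
    have hs' : s ∈ Icc 0 δ := ⟨hs.1, hs.2.trans ht.2⟩
    rw [hgen s hs']
    refine (norm_mul_le _ _).trans ?_
    have := (hMle s hs').trans (mul_le_mul_of_nonneg_left hs.2 hC0)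
    gcongr
  rw [hgen t ht, show M t * L - t • L = (M t - t • (1 : A)) * L by rw [sub_mul, smul_one_mul]]
  refine (norm_mul_le _ _).trans ((mul_le_mul_of_nonneg_right h1 (norm_nonneg _)).trans (le_of_eq ?_))
  ring

end Semigroup

/-! ### The bounded generator in finite dimensions -/

lemma norm_le_toReal_traceNorm {X : H →L[ℂ] H} (h : traceNorm X ≠ ⊤) :
    ‖X‖ ≤ (traceNorm X).toReal := by
  have h1 := norm_le_toReal_posTrace (A := CFC.abs X)
    ((ContinuousLinearMap.nonneg_iff_isPositive _).1 (CFC.abs_nonneg X)) h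
  rwa [CFC.norm_abs] at h1

section FiniteDimensional

variable [FiniteDimensional ℂ H] {T : ℝ → traceClass H →ₗ[ℂ] traceClass H}

/-- In finite dimensions a quantum dynamical semigroup has a bounded generator. -/
theorem IsLindbladSemigroup.exists_generator (hT : IsLindbladSemigroup T) :
    ∃ (G : traceClass H →ₗ[ℂ] traceClass H) (δ : ℝ), 0 < δ ∧ ∀ ω : traceClass H,
      ∃ K : ℝ, 0 ≤ K ∧ ∀ t ∈ Icc 0 δ,
        ‖((T t ω : traceClass H) : H →L[ℂ] H) - ω - (t : ℂ) • (G ω : H →L[ℂ] H)‖ ≤ K * t ^ 2 := by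
  let f : ℝ → (traceClass H →L[ℂ] traceClass H) := fun t => LinearMap.toContinuousLinearMap (T t)
  have hlim : Tendsto f (𝓝[>] 0) (𝓝 1) := by
    -- Phrased as continuity, with the value 1 inserted at 0, so that pointwise convergence gives
    -- norm convergence through `continuousWithinAt_clm_apply`.
    have h1 : ContinuousWithinAt (Function.update f 0 1) (Ioi 0) 0 := by
      rw [continuousWithinAt_clm_apply]
      intro ω
      have h2 := hT.continuous ω
      rw [ContinuousWithinAt]
      simp only [Function.update_self]
      rw [tendsto_iff_norm_sub_tendsto_zero]
      have h3 : ∀ᶠ t in 𝓝[>] (0 : ℝ), traceNorm ((T t ω - ω : traceClass H) : H →L[ℂ] H) ≠ ⊤ := by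
        filter_upwards [h2.eventually (gt_mem_nhds ENNReal.zero_lt_top)] with t ht using ht.ne
      have h4 : Tendsto (fun t : ℝ => (traceNorm ((T t ω - ω : traceClass H) : H →L[ℂ] H)).toReal)
          (𝓝[>] 0) (𝓝 0) := by
        have h5 := (ENNReal.tendsto_toReal ENNReal.zero_ne_top).comp h2
        rwa [ENNReal.toReal_zero] at h5
      refine squeeze_zero' (Eventually.of_forall fun _ => norm_nonneg _) ?_ h4
      filter_upwards [h3, self_mem_nhdsWithin] with t ht ht0
      rw [Function.update_of_ne (ne_of_gt ht0)]
      exact norm_le_toReal_traceNorm ht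
    rw [ContinuousWithinAt, Function.update_self] at h1
    refine h1.congr' ?_
    filter_upwards [self_mem_nhdsWithin] with t ht0
    rw [Function.update_of_ne (ne_of_gt ht0)]
  obtain ⟨L, K, δ, hK, hδ, h⟩ := exists_generator_of_semigroup (f := f)
    (fun s t hs ht => by ext1 ω; simp [f, hT.add s t hs ht])
    (by ext1 ω; simp [f, hT.zero]) hlim
  refine ⟨L, δ, hδ, fun ω => ⟨K * ‖ω‖, by positivity, fun t ht => ?_⟩⟩
  have h1 := (f t - 1 - t • L).le_opNorm ω
  have h2 : (f t - 1 - t • L) ω = T t ω - ω - (t : ℂ) • L ω := by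
    have h3 : (t • L) ω = (t : ℂ) • L ω := rfl
    simp only [sub_apply, h3]
    simp [f]
  rw [h2] at h1
  calc _ = ‖T t ω - ω - (t : ℂ) • L ω‖ := rfl
    _ ≤ _ := h1
    _ ≤ K * t ^ 2 * ‖ω‖ := by gcongr; exact h t ht
    _ = _ := by ring

end FiniteDimensional

/-! ### Finite-dimensional traces and Klein's inequality -/

section FiniteTrace

/-- The real part of the trace of an operator on a finite-dimensional space. -/
def reTrace (A : H →L[ℂ] H) : ℝ := (LinearMap.trace ℂ H (A : H →ₗ[ℂ] H)).re

lemma reTrace_add (A B : H →L[ℂ] H) : reTrace (A + B) = reTrace A + reTrace B := by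
  simp [reTrace]

lemma reTrace_sub (A B : H →L[ℂ] H) : reTrace (A - B) = reTrace A - reTrace B := by
  simp [reTrace]

lemma reTrace_smul (c : ℝ) (A : H →L[ℂ] H) : reTrace ((c : ℂ) • A) = c * reTrace A := by
  simp [reTrace]

lemma reTrace_mul_comm (A B : H →L[ℂ] H) : reTrace (A * B) = reTrace (B * A) := by
  simp only [reTrace]
  exact congrArg Complex.re (LinearMap.trace_mul_comm ℂ (A : H →ₗ[ℂ] H) (B : H →ₗ[ℂ] H))

lemma reTrace_eq_sum {ι : Type*} [Fintype ι] (b : HilbertBasis ι ℂ H) (A : H →L[ℂ] H) :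
    reTrace A = ∑ i, (⟪b i, A (b i)⟫_ℂ).re := by
  rw [reTrace, LinearMap.trace_eq_sum_inner _ b.toOrthonormalBasis, Complex.re_sum]
  simp

lemma finite_of_hilbertBasis [FiniteDimensional ℂ H] {ι : Type*} (b : HilbertBasis ι ℂ H) :
    Finite ι :=
  b.orthonormal.linearIndependent.finite

lemma card_of_hilbertBasis {ι : Type*} [Fintype ι] (b : HilbertBasis ι ℂ H) :
    Fintype.card ι = Module.finrank ℂ H :=
  (Module.finrank_eq_card_basis b.toOrthonormalBasis.toBasis).symm

variable [FiniteDimensional ℂ H]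

lemma abs_reTrace_le (A : H →L[ℂ] H) : |reTrace A| ≤ Module.finrank ℂ H * ‖A‖ := by
  rw [reTrace, LinearMap.trace_eq_sum_inner _ (stdOrthonormalBasis ℂ H), Complex.re_sum]
  refine (Finset.abs_sum_le_sum_abs _ _).trans ?_
  have h : ∀ i ∈ Finset.univ, |(⟪stdOrthonormalBasis ℂ H i,
      (A : H →ₗ[ℂ] H) (stdOrthonormalBasis ℂ H i)⟫_ℂ).re| ≤ ‖A‖ := by
    intro i _
    refine (Complex.abs_re_le_norm _).trans ((norm_inner_le_norm _ _).trans ?_)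
    have h1 := A.le_opNorm (stdOrthonormalBasis ℂ H i)
    rw [(stdOrthonormalBasis ℂ H).orthonormal.1 i, mul_one] at h1
    rw [(stdOrthonormalBasis ℂ H).orthonormal.1 i, one_mul]
    exact h1
  refine (Finset.sum_le_sum h).trans ?_
  simp

lemma reTrace_mul_nonneg {A B : H →L[ℂ] H} (hA : A.IsPositive) (hB : B.IsPositive) :
    0 ≤ reTrace (A * B) := by
  obtain ⟨S, hS, rfl⟩ := exists_isSelfAdjoint_mul_self hA
  rw [mul_assoc, reTrace_mul_comm]
  have hpos : (S * B * S).IsPositive := by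
    have := hB.conj_adjoint S
    rw [← ContinuousLinearMap.star_eq_adjoint, hS.star_eq] at this
    exact this
  rw [reTrace, LinearMap.trace_eq_sum_inner _ (stdOrthonormalBasis ℂ H), Complex.re_sum]
  exact Finset.sum_nonneg fun i _ => isPositive_re_nonneg hpos _

lemma eq_zero_of_reTrace_eq_zero {A : H →L[ℂ] H} (hA : A.IsPositive) (h : reTrace A ≤ 0) :
    A = 0 := by
  obtain ⟨S, hS, rfl⟩ := exists_isSelfAdjoint_mul_self hA
  have hS0 : S = 0 := by
    rw [reTrace, LinearMap.trace_eq_sum_inner _ (stdOrthonormalBasis ℂ H), Complex.re_sum] at h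
    have h1 : ∀ i, (⟪stdOrthonormalBasis ℂ H i, ((S * S : H →L[ℂ] H) : H →ₗ[ℂ] H)
        (stdOrthonormalBasis ℂ H i)⟫_ℂ).re = ‖S (stdOrthonormalBasis ℂ H i)‖ ^ 2 := by
      intro i
      have := inner_mul_self_apply hS (stdOrthonormalBasis ℂ H i)
      rw [ContinuousLinearMap.coe_coe, this, Complex.ofReal_re]
    simp only [h1] at h
    have h2 := (Finset.sum_eq_zero_iff_of_nonneg (fun i _ => sq_nonneg _)).1
      (le_antisymm h (Finset.sum_nonneg fun i _ => sq_nonneg _))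
    have h3 : (S : H →ₗ[ℂ] H) = 0 := by
      refine (stdOrthonormalBasis ℂ H).toBasis.ext fun i => ?_
      have := h2 i (Finset.mem_univ _)
      simpa using this
    ext v
    exact LinearMap.congr_fun h3 v
  rw [hS0, mul_zero]

lemma finite_spectrum (A : H →L[ℂ] H) : (spectrum ℝ A).Finite := by
  have h1 : (spectrum ℂ A).Finite := by
    have h := Module.End.finite_spectrum (A : H →ₗ[ℂ] H)
    rw [← AlgEquiv.spectrum_eq (Module.End.toContinuousLinearMap (𝕜 := ℂ) H)] at h
    exact h
  rw [← spectrum.preimage_algebraMap ℂ]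
  exact h1.preimage (FaithfulSMul.algebraMap_injective ℝ ℂ).injOn

/-- The spectrum is finite, so the functional calculus is meaningful even for `Real.log` at singular
states, where it sends the kernel to 0. -/
lemma continuousOn_spectrum (f : ℝ → ℝ) (A : H →L[ℂ] H) : ContinuousOn f (spectrum ℝ A) :=
  (finite_spectrum A).continuousOn f

variable {ω σ : traceClass H}

lemma IsState.exists_finite_eigenbasis (hω : IsState ω) :
    ∃ (ι : Type u) (_ : Fintype ι) (b : HilbertBasis ι ℂ H) (p : ι → ℝ),
      IsEigenbasis (ω : H →L[ℂ] H) b p := by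
  obtain ⟨ι, b, p, hb⟩ := hω.exists_isEigenbasis
  have := finite_of_hilbertBasis b
  exact ⟨ι, Fintype.ofFinite ι, b, p, hb⟩

lemma entropy_ne_top (hω : IsState ω) : entropy ω ≠ ⊤ := by
  obtain ⟨ι, _, b, p, hb⟩ := hω.exists_finite_eigenbasis
  rw [entropy_eq_tsum hω hb, tsum_fintype]
  exact ENNReal.sum_ne_top.2 fun i _ => ENNReal.ofReal_ne_top

lemma IsEigenbasis.toReal_entropy (hω : IsState ω) {ι : Type*} [Fintype ι]
    {b : HilbertBasis ι ℂ H} {p : ι → ℝ} (hb : IsEigenbasis (ω : H →L[ℂ] H) b p) :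
    (entropy ω).toReal = ∑ i, -(p i * Real.log (p i)) := by
  rw [entropy_eq_tsum hω hb, tsum_fintype, ENNReal.toReal_sum fun i _ => ENNReal.ofReal_ne_top]
  refine Finset.sum_congr rfl fun i _ => ?_
  rw [ENNReal.toReal_ofReal (Real.negMulLog_nonneg (hb.nonneg hω.1 i) (hb.le_one hω i)),
    Real.negMulLog]
  ring

/-- The regularized logarithm `log (σ + c)`. -/
def regLog (c : ℝ) (A : H →L[ℂ] H) : H →L[ℂ] H := cfc (fun x => Real.log (x + c)) A

lemma regLog_isSelfAdjoint (c : ℝ) (A : H →L[ℂ] H) : IsSelfAdjoint (regLog c A) :=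
  cfc_predicate _ _

lemma regLog_apply_eigenvector {A : H →L[ℂ] H} (hA : IsSelfAdjoint A) (c : ℝ) {v : H} {p : ℝ}
    (hv : A v = (p : ℂ) • v) : regLog c A v = (Real.log (p + c) : ℂ) • v :=
  cfc_apply_eigenvector hA (continuousOn_spectrum _ _) hv

/-- The Klein inequality, in the form of an upper bound of entropy differences. -/
lemma entropy_sub_le (hω : IsState ω) (hσ : IsState σ) {c : ℝ} (hc : 0 < c) :
    (entropy ω).toReal - (entropy σ).toReal ≤
      -reTrace (((ω : H →L[ℂ] H) - (σ : H →L[ℂ] H)) * regLog c (σ : H →L[ℂ] H)) + Module.finrank ℂ H * c := by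
  obtain ⟨ι, _, b, p, hb⟩ := hω.exists_finite_eigenbasis
  obtain ⟨κ, _, f, q, hf⟩ := hσ.exists_finite_eigenbasis
  have hq : ∀ j, 0 < q j + c := fun j => by linarith [hf.nonneg hσ.1 j]
  have hp1 : ∑ i, p i = 1 := (hasSum_fintype p).unique (hb.hasSum_one hω)
  have hq1 : ∑ j, q j = 1 := (hasSum_fintype q).unique (hf.hasSum_one hσ)
  let w : ι → κ → ℝ := fun i j => ‖⟪b i, f j⟫_ℂ‖ ^ 2
  have hwj : ∀ j, ∑ i, w i j = 1 := fun j => by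
    have h := (hasSum_fintype _).unique (hasSum_norm_inner_sq b (f j))
    simpa [f.orthonormal.1 j] using h
  have hwi : ∀ i, ∑ j, w i j = 1 := fun i => by
    have h := (hasSum_fintype _).unique (hasSum_norm_inner_sq f (b i))
    simpa only [w, norm_inner_symm (b i), b.orthonormal.1 i, one_pow] using h
  have hωf : ∀ j, (⟪f j, (ω : H →L[ℂ] H) (f j)⟫_ℂ).re = ∑ i, p i * w i j := fun j =>
    ((hasSum_fintype _).unique (hb.hasSum_re_inner hω.1 (f j))).symm
  have htr : reTrace (((ω : H →L[ℂ] H) - (σ : H →L[ℂ] H)) * regLog c (σ : H →L[ℂ] H)) =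
      ∑ j, Real.log (q j + c) * (∑ i, p i * w i j - q j) := by
    rw [reTrace_eq_sum f]
    refine Finset.sum_congr rfl fun j _ => ?_
    rw [mul_apply_eq_comp, regLog_apply_eigenvector hσ.1.isSelfAdjoint c (hf j),
      map_smul, inner_smul_right, Complex.re_ofReal_mul, sub_apply, inner_sub_right,
      Complex.sub_re, hωf, hf.re_inner_self]
  -- Nonnegativity of the relative entropy of ω with respect to σ + c. The excess trace of σ + c is
  -- the term dim · c of the statement.
  have hkl : 0 ≤ ∑ i, ∑ j, w i j * klTerm (p i) (q j + c) :=
    Finset.sum_nonneg fun i _ => Finset.sum_nonneg fun j _ => mul_nonneg (by positivity)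
      (klTerm_nonneg (hb.nonneg hω.1 i) (hq j).le fun h => absurd h (hq j).ne')
  have hexp : ∑ i, ∑ j, w i j * klTerm (p i) (q j + c) =
      ∑ i, p i * Real.log (p i) - ∑ j, Real.log (q j + c) * ∑ i, p i * w i j +
        Module.finrank ℂ H * c := by
    have e1 : ∑ i, ∑ j, w i j * klTerm (p i) (q j + c) =
        ∑ i, ∑ j, w i j * (p i * Real.log (p i) - p i) -
        ∑ i, ∑ j, Real.log (q j + c) * (p i * w i j) + ∑ i, ∑ j, w i j * (q j + c) := by
      rw [← Finset.sum_sub_distrib, ← Finset.sum_add_distrib]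
      refine Finset.sum_congr rfl fun i _ => ?_
      rw [← Finset.sum_sub_distrib, ← Finset.sum_add_distrib]
      refine Finset.sum_congr rfl fun j _ => ?_
      rw [klTerm]; ring
    rw [e1, Finset.sum_comm (f := fun i j => Real.log (q j + c) * (p i * w i j)),
      Finset.sum_comm (f := fun i j => w i j * (q j + c))]
    simp only [← Finset.sum_mul, ← Finset.mul_sum, hwi, hwj, one_mul, Finset.sum_add_distrib,
      Finset.sum_sub_distrib, hp1, hq1]
    rw [Finset.sum_const, Finset.card_univ, card_of_hilbertBasis f, nsmul_eq_mul]
    ring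
  have hσ' : ∑ j, q j * Real.log (q j) ≤ ∑ j, Real.log (q j + c) * q j := by
    refine Finset.sum_le_sum fun j _ => ?_
    rw [mul_comm]
    rcases (hf.nonneg hσ.1 j).eq_or_lt with h | h
    · simp [← h]
    · exact mul_le_mul_of_nonneg_right (Real.log_le_log h (by linarith)) h.le
  rw [hb.toReal_entropy hω, hf.toReal_entropy hσ, htr]
  simp only [mul_sub, Finset.sum_sub_distrib, Finset.sum_neg_distrib]
  rw [hexp] at hkl
  linarith

end FiniteTrace

/-! ### Limits of the logarithm regularized by t² -/

section RegularizedLog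

lemma abs_log_add_sq_le {t x : ℝ} (ht : 0 < t) (ht1 : t ≤ 1) (hx : x ∈ Icc (0 : ℝ) 1) :
    |Real.log (x + t ^ 2)| ≤ 1 - 2 * Real.log t := by
  have h0 : 0 < x + t ^ 2 := by have := hx.1; positivity
  have h1 : Real.log t ≤ 0 := Real.log_nonpos ht.le ht1
  rw [abs_le]
  constructor
  · have h2 : Real.log (t ^ 2) ≤ Real.log (x + t ^ 2) :=
      Real.log_le_log (by positivity) (by linarith [hx.1])
    rw [Real.log_pow] at h2
    push_cast at h2
    linarith
  · have h2 := Real.log_le_sub_one_of_pos h0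
    have h3 : t ^ 2 ≤ 1 := pow_le_one₀ ht.le ht1
    linarith [hx.2]

/-- For x + t² ≥ p/2 the logarithm is Lipschitz; otherwise |x - p| ≥ p/2 and the crude logarithmic
bound suffices. The shift t² costs only dim · t² = o(t) in Klein's inequality, while the prefactor
grows only like ln(1/t). -/
lemma abs_log_add_sq_sub_le {t x p : ℝ} (ht : 0 < t) (ht1 : t ≤ 1) (hp : 0 < p)
    (hx : x ∈ Icc (0 : ℝ) 1) :
    |Real.log (x + t ^ 2) - Real.log p| ≤
      (1 - 2 * Real.log t + |Real.log p|) * (2 / p) * (|x - p| + t ^ 2) := by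
  have h0 : 0 < x + t ^ 2 := by have := hx.1; positivity
  have h1 : Real.log t ≤ 0 := Real.log_nonpos ht.le ht1
  set N := 1 - 2 * Real.log t + |Real.log p| with hN
  have hN1 : 1 ≤ N := by have := abs_nonneg (Real.log p); linarith
  rcases le_or_gt (p / 2) (x + t ^ 2) with h | h
  · have h2 : |Real.log (x + t ^ 2) - Real.log p| ≤ 2 / p * |x + t ^ 2 - p| := by
      rw [abs_le]
      have h3 := Real.log_le_sub_one_of_pos (div_pos h0 hp)
      have h4 := Real.log_le_sub_one_of_pos (div_pos hp h0)
      rw [Real.log_div h0.ne' hp.ne'] at h3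
      rw [Real.log_div hp.ne' h0.ne'] at h4
      have h5 : (x + t ^ 2) / p - 1 ≤ 2 / p * |x + t ^ 2 - p| := by
        have e : (x + t ^ 2) / p - 1 = 1 / p * (x + t ^ 2 - p) := by field_simp
        rw [e]
        refine (mul_le_mul_of_nonneg_left (le_abs_self _) (by positivity)).trans
          (mul_le_mul_of_nonneg_right ?_ (abs_nonneg _))
        gcongr
        norm_num
      have h6 : p / (x + t ^ 2) - 1 ≤ 2 / p * |x + t ^ 2 - p| := by
        have e : p / (x + t ^ 2) - 1 = 1 / (x + t ^ 2) * (p - (x + t ^ 2)) := by field_simp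
        rw [e, abs_sub_comm]
        refine (mul_le_mul_of_nonneg_left (le_abs_self _) (by positivity)).trans
          (mul_le_mul_of_nonneg_right ?_ (abs_nonneg _))
        rw [div_le_div_iff₀ h0 hp]; linarith
      constructor <;> linarith
    have h3 : |x + t ^ 2 - p| ≤ |x - p| + t ^ 2 := by
      have := abs_add_le (x - p) (t ^ 2)
      rw [abs_of_nonneg (sq_nonneg t)] at this
      rwa [show x + t ^ 2 - p = x - p + t ^ 2 by ring]
    calc _ ≤ 2 / p * |x + t ^ 2 - p| := h2
      _ ≤ 2 / p * (|x - p| + t ^ 2) := by gcongr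
      _ = 1 * (2 / p) * (|x - p| + t ^ 2) := by ring
      _ ≤ _ := by gcongr
  · have h2 : p / 2 ≤ |x - p| := by
      rw [abs_sub_comm]
      refine le_trans ?_ (le_abs_self _)
      have := sq_nonneg t
      linarith
    have h3 : |Real.log (x + t ^ 2) - Real.log p| ≤ N := by
      refine (abs_sub _ _).trans ?_
      have := abs_log_add_sq_le ht ht1 hx
      linarith
    calc _ ≤ N := h3
      _ = N * (2 / p) * (p / 2) := by field_simp
      _ ≤ _ := by gcongr; nlinarith [sq_nonneg t]

variable [FiniteDimensional ℂ H] {ω σ : traceClass H}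

lemma norm_regLog_le (hσ : IsState σ) {t : ℝ} (ht : 0 < t) (ht1 : t ≤ 1) :
    ‖regLog (t ^ 2) (σ : H →L[ℂ] H)‖ ≤ 1 - 2 * Real.log t := by
  refine norm_cfc_le (by linarith [Real.log_nonpos ht.le ht1]) fun x hx => ?_
  exact abs_log_add_sq_le ht ht1 (hσ.spectrum_subset hx)

/-- A scalar bound becomes a vector bound by expanding in an eigenbasis of σ. The vector need not be
an eigenvector of σ: only how far it is from one matters. -/
lemma norm_cfc_apply_sub_sq_le (hσ : IsState σ) {f : ℝ → ℝ} {a b c p : ℝ}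
    (h : ∀ x ∈ Icc (0 : ℝ) 1, |f x - c| ≤ a * (|x - p| + b)) (v : H) :
    ‖cfc f (σ : H →L[ℂ] H) v - (c : ℂ) • v‖ ^ 2 ≤
      2 * a ^ 2 * (‖(σ : H →L[ℂ] H) v - (p : ℂ) • v‖ ^ 2 + b ^ 2 * ‖v‖ ^ 2) := by
  obtain ⟨ι, _, e, q, he⟩ := hσ.exists_finite_eigenbasis
  have hpars : ∀ w : H, ‖w‖ ^ 2 = ∑ i, ‖⟪e i, w⟫_ℂ‖ ^ 2 := fun w =>
    ((hasSum_fintype _).unique (hasSum_norm_inner_sq e w)).symm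
  have hin : ∀ i, ⟪e i, cfc f (σ : H →L[ℂ] H) v - (c : ℂ) • v⟫_ℂ =
      ((f (q i) - c : ℝ) : ℂ) * ⟪e i, v⟫_ℂ := by
    intro i
    rw [inner_sub_right, inner_smul_right, inner_apply_comm (cfc_predicate f _),
      cfc_apply_eigenvector hσ.1.isSelfAdjoint (continuousOn_spectrum _ _) (he i),
      inner_smul_left, Complex.conj_ofReal]
    push_cast; ring
  have hin2 : ∀ i, ⟪e i, (σ : H →L[ℂ] H) v - (p : ℂ) • v⟫_ℂ =
      ((q i - p : ℝ) : ℂ) * ⟪e i, v⟫_ℂ := by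
    intro i
    rw [inner_sub_right, inner_smul_right, he.inner_apply hσ.1]
    push_cast; ring
  rw [hpars (cfc f (σ : H →L[ℂ] H) v - (c : ℂ) • v), hpars ((σ : H →L[ℂ] H) v - (p : ℂ) • v),
    hpars v, Finset.mul_sum, ← Finset.sum_add_distrib, Finset.mul_sum]
  refine Finset.sum_le_sum fun i _ => ?_
  rw [hin, hin2, norm_mul, norm_mul, Complex.norm_real, Complex.norm_real, mul_pow, mul_pow,
    Real.norm_eq_abs, Real.norm_eq_abs]
  have h1 := h (q i) ⟨he.nonneg hσ.1 i, he.le_one hσ i⟩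
  have h2 : |f (q i) - c| ^ 2 ≤ 2 * a ^ 2 * (|q i - p| ^ 2 + b ^ 2) := by
    calc |f (q i) - c| ^ 2 ≤ (a * (|q i - p| + b)) ^ 2 := pow_le_pow_left₀ (abs_nonneg _) h1 2
      _ ≤ _ := by nlinarith [sq_nonneg (a * (|q i - p| - b))]
  nlinarith [sq_nonneg ‖⟪e i, v⟫_ℂ‖]

lemma tendsto_mul_const_sub_log (c : ℝ) :
    Tendsto (fun t : ℝ => t * (c - 2 * Real.log t)) (𝓝[>] 0) (𝓝 0) := by
  have h1 : Tendsto (fun t : ℝ => t * Real.log t) (𝓝[>] 0) (𝓝 0) := by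
    have := Real.continuous_mul_log.tendsto 0
    simp only [zero_mul] at this
    exact this.mono_left nhdsWithin_le_nhds
  have h2 : Tendsto (fun t : ℝ => t) (𝓝[>] 0) (𝓝 0) := tendsto_id.mono_left nhdsWithin_le_nhds
  have h3 := (h2.mul_const c).sub (h1.const_mul 2)
  simp only [zero_mul, mul_zero, sub_zero] at h3
  exact h3.congr fun t => by ring

lemma eventually_mem_Ioc {a : ℝ} (ha : 0 < a) : ∀ᶠ t in 𝓝[>] (0 : ℝ), t ∈ Ioc 0 a := by
  filter_upwards [Ioo_mem_nhdsGT ha] with t ht using ⟨ht.1, ht.2.le⟩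

variable {γ : ℝ → traceClass H} {K : ℝ}

/-- An eigenvector of ω is an O(t)-approximate eigenvector of γ(t), and O(t) times the prefactor
O(ln(1/t)) vanishes. -/
lemma tendsto_regLog_apply (hγ : ∀ᶠ t in 𝓝[>] 0, IsState (γ t))
    (hK : ∀ᶠ t in 𝓝[>] 0, ‖(γ t : H →L[ℂ] H) - (ω : H →L[ℂ] H)‖ ≤ K * t) {v : H} {p : ℝ}
    (hp : 0 < p) (hv : (ω : H →L[ℂ] H) v = (p : ℂ) • v) :
    Tendsto (fun t => regLog (t ^ 2) (γ t : H →L[ℂ] H) v) (𝓝[>] 0)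
      (𝓝 ((Real.log p : ℂ) • v)) := by
  rw [tendsto_iff_norm_sub_tendsto_zero]
  have hlim := ((tendsto_mul_const_sub_log (1 + |Real.log p|)).mul_const (2 / p)).const_mul
    (2 * (K ^ 2 + 1) * ‖v‖)
  rw [zero_mul, mul_zero] at hlim
  refine squeeze_zero' (Eventually.of_forall fun _ => norm_nonneg _) ?_ hlim
  filter_upwards [hγ, hK, eventually_mem_Ioc one_pos] with t hσ hKt ht
  have hlog : Real.log t ≤ 0 := Real.log_nonpos ht.1.le ht.2
  set a := (1 - 2 * Real.log t + |Real.log p|) * (2 / p) with ha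
  have ha0 : 0 ≤ a := by
    have := abs_nonneg (Real.log p)
    exact mul_nonneg (by linarith) (by positivity)
  have h1 := norm_cfc_apply_sub_sq_le hσ (f := fun x => Real.log (x + t ^ 2)) (b := t ^ 2)
    (c := Real.log p) (p := p) (fun x hx => abs_log_add_sq_sub_le ht.1 ht.2 hp hx) v
  have h2 : ‖(γ t : H →L[ℂ] H) v - (p : ℂ) • v‖ ≤ K * t * ‖v‖ := by
    rw [← hv]
    exact (((γ t : H →L[ℂ] H) - (ω : H →L[ℂ] H)).le_opNorm v).trans (by gcongr)
  have e : 2 * (K ^ 2 + 1) * ‖v‖ * (t * (1 + |Real.log p| - 2 * Real.log t) * (2 / p)) =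
      2 * (K ^ 2 + 1) * ‖v‖ * (t * a) := by rw [ha]; ring
  rw [e]
  have ht0 := ht.1
  refine (pow_le_pow_iff_left₀ (norm_nonneg _) (by positivity) two_ne_zero).1 (h1.trans ?_)
  have h3 := pow_le_pow_left₀ (norm_nonneg _) h2 2
  have h4 : (t ^ 2) ^ 2 ≤ t ^ 2 := by nlinarith [pow_le_one₀ (n := 2) ht.1.le ht.2, sq_nonneg t]
  have h5 : ‖(γ t : H →L[ℂ] H) v - (p : ℂ) • v‖ ^ 2 + (t ^ 2) ^ 2 * ‖v‖ ^ 2 ≤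
      (K ^ 2 + 1) * (t ^ 2 * ‖v‖ ^ 2) := by
    have := mul_le_mul_of_nonneg_right h4 (sq_nonneg ‖v‖)
    nlinarith
  have h6 : 2 * (K ^ 2 + 1) ≤ (2 * (K ^ 2 + 1)) ^ 2 := by nlinarith [sq_nonneg K]
  calc _ ≤ 2 * a ^ 2 * ((K ^ 2 + 1) * (t ^ 2 * ‖v‖ ^ 2)) := by gcongr
    _ = 2 * (K ^ 2 + 1) * (‖v‖ * (t * a)) ^ 2 := by ring
    _ ≤ (2 * (K ^ 2 + 1)) ^ 2 * (‖v‖ * (t * a)) ^ 2 := by gcongr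
    _ = _ := by ring

/-- The regularized logarithm converges to the logarithm on the support. -/
lemma tendsto_reTrace_mul_regLog (hω : IsState ω) (hγ : ∀ᶠ t in 𝓝[>] 0, IsState (γ t))
    (hK : ∀ᶠ t in 𝓝[>] 0, ‖(γ t : H →L[ℂ] H) - (ω : H →L[ℂ] H)‖ ≤ K * t) {C : H →L[ℂ] H}
    (hC : ∀ u w, (ω : H →L[ℂ] H) u = 0 → (ω : H →L[ℂ] H) w = 0 → ⟪u, C w⟫_ℂ = 0) :
    Tendsto (fun t => reTrace (C * regLog (t ^ 2) (γ t : H →L[ℂ] H))) (𝓝[>] 0)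
      (𝓝 (reTrace (C * cfc Real.log (ω : H →L[ℂ] H)))) := by
  obtain ⟨ι, _, b, p, hb⟩ := hω.exists_finite_eigenbasis
  have hlogb : ∀ i, cfc Real.log (ω : H →L[ℂ] H) (b i) = (Real.log (p i) : ℂ) • b i := fun i =>
    cfc_apply_eigenvector hω.1.isSelfAdjoint (continuousOn_spectrum _ _) (hb i)
  have hexp : ∀ (R : H →L[ℂ] H) i, ⟪b i, (C * R) (b i)⟫_ℂ =
      ∑ k, ⟪C.adjoint (b i), b k⟫_ℂ * ⟪b k, R (b i)⟫_ℂ := by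
    intro R i
    rw [mul_apply_eq_comp, ← ContinuousLinearMap.adjoint_inner_left]
    exact ((hasSum_fintype _).unique (b.hasSum_inner_mul_inner _ _)).symm
  simp only [reTrace_eq_sum b, hexp]
  refine tendsto_finsetSum _ fun i _ => (Complex.continuous_re.tendsto _).comp ?_
  refine tendsto_finsetSum _ fun k _ => ?_
  have hz : ∀ j, p j = 0 → (ω : H →L[ℂ] H) (b j) = 0 := fun j hj => by rw [hb j, hj]; simp
  -- The kernel-kernel matrix elements of C vanish by `hC`. In all others an eigenvector with
  -- positive eigenvalue is available, on the left or on the right, for the regularized logarithm to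
  -- act on.
  rcases (hb.nonneg hω.1 i).eq_or_lt with hi | hi
  · rcases (hb.nonneg hω.1 k).eq_or_lt with hk | hk
    · rw [ContinuousLinearMap.adjoint_inner_left, hC _ _ (hz i hi.symm) (hz k hk.symm)]
      simp
    · refine Tendsto.const_mul _ ?_
      have h1 := (tendsto_regLog_apply hγ hK hk (hb k)).inner (𝕜 := ℂ)
        (tendsto_const_nhds (x := b i))
      rw [inner_apply_comm (cfc_predicate Real.log _), hlogb]
      exact h1.congr fun t => (inner_apply_comm (regLog_isSelfAdjoint _ _) _ _).symm
  · refine Tendsto.const_mul _ ?_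
    rw [hlogb]
    exact tendsto_const_nhds.inner (tendsto_regLog_apply hγ hK hi (hb i))

/-- The tangent line of ln at t, evaluated at x + t². Both sides are functions of σ alone, so the
scalar inequality suffices. -/
lemma regLog_le (hσ : IsState σ) {t : ℝ} (ht : 0 < t) :
    (((Real.log t - 1 + t : ℝ) : ℂ) • (1 : H →L[ℂ] H) + ((1 / t : ℝ) : ℂ) • (σ : H →L[ℂ] H) -
      regLog (t ^ 2) (σ : H →L[ℂ] H)).IsPositive := by
  have e : ((Real.log t - 1 + t : ℝ) : ℂ) • (1 : H →L[ℂ] H) +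
      ((1 / t : ℝ) : ℂ) • (σ : H →L[ℂ] H) - regLog (t ^ 2) (σ : H →L[ℂ] H) =
      cfc (fun x => (Real.log t - 1 + t) + 1 / t * x - Real.log (x + t ^ 2))
        (σ : H →L[ℂ] H) := by
    obtain ⟨ι, _, b, p, hb⟩ := hσ.exists_finite_eigenbasis
    refine ContinuousLinearMap.coe_injective (b.toOrthonormalBasis.toBasis.ext fun i => ?_)
    have h1 := regLog_apply_eigenvector hσ.1.isSelfAdjoint (t ^ 2) (hb i)
    have h2 := cfc_apply_eigenvector hσ.1.isSelfAdjoint (continuousOn_spectrum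
      (fun x => (Real.log t - 1 + t) + 1 / t * x - Real.log (x + t ^ 2)) _) (hb i)
    simp only [OrthonormalBasis.coe_toBasis, HilbertBasis.coe_toOrthonormalBasis,
      ContinuousLinearMap.coe_coe]
    rw [h2, sub_apply, add_apply, h1, smul_apply,
      smul_apply, hb i]
    simp only [one_apply_eq_self, smul_smul, ← add_smul, ← sub_smul]
    push_cast
    ring_nf
  rw [e]
  refine isPositive_cfc fun x hx => ?_
  have hx0 : 0 < x + t ^ 2 := by have := (hσ.spectrum_subset hx).1; positivity
  have h1 := Real.log_le_sub_one_of_pos (div_pos hx0 ht)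
  rw [Real.log_div hx0.ne' ht.ne'] at h1
  have e2 : (x + t ^ 2) / t = 1 / t * x + t := by field_simp
  rw [e2] at h1
  linarith

/-- Since Bω = 0, Bγ(t) = O(t), so the tangent-line bound gives at most tr(B) ln t + O(1), with tr B
> 0. -/
lemma tendsto_reTrace_mul_regLog_atBot (hγ : ∀ᶠ t in 𝓝[>] 0, IsState (γ t))
    (hK : ∀ᶠ t in 𝓝[>] 0, ‖(γ t : H →L[ℂ] H) - (ω : H →L[ℂ] H)‖ ≤ K * t) {B : H →L[ℂ] H}
    (hB : B.IsPositive) (hBω : B * (ω : H →L[ℂ] H) = 0) (hB0 : B ≠ 0) :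
    Tendsto (fun t => reTrace (B * regLog (t ^ 2) (γ t : H →L[ℂ] H))) (𝓝[>] 0) atBot := by
  have htr : 0 < reTrace B := not_le.1 fun h => hB0 (eq_zero_of_reTrace_eq_zero hB h)
  have hlim : Tendsto (fun t : ℝ => reTrace B * Real.log t +
      (reTrace B + Module.finrank ℂ H * (‖B‖ * K))) (𝓝[>] 0) atBot :=
    tendsto_atBot_add_const_right _ _ (Real.tendsto_log_nhdsGT_zero.const_mul_atBot htr)
  refine tendsto_atBot_mono' _ ?_ hlim
  filter_upwards [hγ, hK, eventually_mem_Ioc one_pos] with t hσ hKt ht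
  have h1 := reTrace_mul_nonneg hB (regLog_le hσ ht.1)
  have ht0 : t ≠ 0 := ht.1.ne'
  have e : B * (((Real.log t - 1 + t : ℝ) : ℂ) • (1 : H →L[ℂ] H) +
      ((1 / t : ℝ) : ℂ) • (γ t : H →L[ℂ] H) - regLog (t ^ 2) (γ t : H →L[ℂ] H)) =
      ((Real.log t - 1 + t : ℝ) : ℂ) • B + ((1 / t : ℝ) : ℂ) •
        (B * ((γ t : H →L[ℂ] H) - (ω : H →L[ℂ] H))) -
        B * regLog (t ^ 2) (γ t : H →L[ℂ] H) := by
    rw [mul_sub B (γ t : H →L[ℂ] H), hBω, sub_zero]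
    simp only [mul_sub, mul_add, mul_smul_comm, mul_one]
  rw [e, reTrace_sub, reTrace_add, reTrace_smul, reTrace_smul] at h1
  have h2 : reTrace (B * ((γ t : H →L[ℂ] H) - (ω : H →L[ℂ] H))) ≤
      Module.finrank ℂ H * (‖B‖ * (K * t)) := by
    refine (le_abs_self _).trans ((abs_reTrace_le _).trans ?_)
    gcongr
    exact (norm_mul_le _ _).trans (by gcongr)
  have h3 : 1 / t * reTrace (B * ((γ t : H →L[ℂ] H) - (ω : H →L[ℂ] H))) ≤
      Module.finrank ℂ H * (‖B‖ * K) := by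
    rw [one_div, inv_mul_le_iff₀ ht.1]
    refine h2.trans (le_of_eq (by ring))
  nlinarith [ht.2]

end RegularizedLog

/-! ### The projection onto the kernel -/

section KernelProjection

/-- The orthogonal projection onto the kernel. -/
abbrev kerProj (A : H →L[ℂ] H) : H →L[ℂ] H := eigenProj A 0

lemma apply_kerProj (A : H →L[ℂ] H) (v : H) : A (kerProj A v) = 0 := by
  have h : (A - ((0 : ℝ) : ℂ) • (1 : H →L[ℂ] H)) (kerProj A v) = 0 :=
    Submodule.starProjection_apply_mem (A - ((0 : ℝ) : ℂ) • (1 : H →L[ℂ] H)).ker v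
  rwa [Complex.ofReal_zero, zero_smul, sub_zero] at h

lemma mul_kerProj (A : H →L[ℂ] H) : A * kerProj A = 0 := by
  ext v; exact apply_kerProj A v

lemma kerProj_mul {A : H →L[ℂ] H} (hA : IsSelfAdjoint A) : kerProj A * A = 0 := by
  have h := congrArg star (mul_kerProj A)
  rwa [star_mul, hA.star_eq, (eigenProj_isSelfAdjoint A 0).star_eq, star_zero] at h

lemma kerProj_apply_eq_self {A : H →L[ℂ] H} {v : H} (hv : A v = 0) : kerProj A v = v :=
  eigenProj_apply_eq_self (by rw [hv]; simp)

lemma inner_compress (A G : H →L[ℂ] H) {u w : H} (hu : A u = 0) (hw : A w = 0) :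
    ⟪u, (kerProj A * G * kerProj A) w⟫_ℂ = ⟪u, G w⟫_ℂ := by
  rw [mul_apply_eq_comp, mul_apply_eq_comp, inner_apply_comm (eigenProj_isSelfAdjoint A 0),
    kerProj_apply_eq_self hu, kerProj_apply_eq_self hw]

end KernelProjection

/-! ### Entropy rates of curves with a first-order expansion -/

section Expansion

/-- `γ t = X + t G + O(t²)` as `t → 0⁺`. -/
def HasExpansion (γ : ℝ → traceClass H) (X G : H →L[ℂ] H) : Prop :=
  ∃ K δ : ℝ, 0 ≤ K ∧ 0 < δ ∧ ∀ t ∈ Ioc 0 δ, ‖(γ t : H →L[ℂ] H) - X - (t : ℂ) • G‖ ≤ K * t ^ 2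

variable {γ : ℝ → traceClass H} {X G : H →L[ℂ] H}

lemma HasExpansion.eventually_norm_sub_le (h : HasExpansion γ X G) :
    ∃ K, ∀ᶠ t in 𝓝[>] 0, ‖(γ t : H →L[ℂ] H) - X‖ ≤ K * t := by
  obtain ⟨K, δ, hK, hδ, h⟩ := h
  refine ⟨K + ‖G‖, ?_⟩
  filter_upwards [eventually_mem_Ioc hδ, eventually_mem_Ioc one_pos] with t ht ht1
  have h1 := norm_add_le ((γ t : H →L[ℂ] H) - X - (t : ℂ) • G) ((t : ℂ) • G)
  rw [sub_add_cancel, norm_smul, Complex.norm_real, Real.norm_of_nonneg ht.1.le] at h1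
  have h2 : K * t ^ 2 ≤ K * t := by
    have := ht1.1
    gcongr
    nlinarith [ht1.2]
  have := h t ht
  linarith

/-- As Y X Y = 0, Y G Y is the limit of the positive operators Y γ(t) Y / t. -/
lemma HasExpansion.isPositive_compress (h : HasExpansion γ X G)
    (hpos : ∀ᶠ t in 𝓝[>] 0, (γ t : H →L[ℂ] H).IsPositive) {Y : H →L[ℂ] H}
    (hY : IsSelfAdjoint Y) (hXY : X * Y = 0) : (Y * G * Y).IsPositive := by
  obtain ⟨K, δ, hK, hδ, h⟩ := h
  have hlim : Tendsto (fun t : ℝ => ((1 / t : ℝ) : ℂ) • (Y * (γ t : H →L[ℂ] H) * Y)) (𝓝[>] 0)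
      (𝓝 (Y * G * Y)) := by
    rw [tendsto_iff_norm_sub_tendsto_zero]
    have h0 : Tendsto (fun t : ℝ => ‖Y‖ * (K * t) * ‖Y‖) (𝓝[>] 0) (𝓝 0) := by
      have h1 : Tendsto (fun t : ℝ => t) (𝓝[>] 0) (𝓝 0) :=
        tendsto_id.mono_left nhdsWithin_le_nhds
      simpa using ((h1.const_mul K).const_mul ‖Y‖).mul_const ‖Y‖
    refine squeeze_zero' (Eventually.of_forall fun _ => norm_nonneg _) ?_ h0
    filter_upwards [eventually_mem_Ioc hδ] with t ht
    have htc : (t : ℂ) ≠ 0 := by exact_mod_cast ht.1.ne'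
    have e : ((1 / t : ℝ) : ℂ) • (Y * (γ t : H →L[ℂ] H) * Y) - Y * G * Y =
        Y * (((1 / t : ℝ) : ℂ) • ((γ t : H →L[ℂ] H) - X - (t : ℂ) • G)) * Y := by
      simp only [smul_sub, smul_smul, mul_sub, sub_mul, mul_smul_comm, smul_mul_assoc]
      rw [mul_assoc Y X Y, hXY]
      push_cast
      rw [one_div, inv_mul_cancel₀ htc]
      simp
    rw [e]
    refine (norm_mul_le _ _).trans (mul_le_mul_of_nonneg_right ((norm_mul_le _ _).trans
      (mul_le_mul_of_nonneg_left ?_ (norm_nonneg _))) (norm_nonneg _))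
    rw [norm_smul, Complex.norm_real, Real.norm_of_nonneg (by have := ht.1; positivity), one_div,
      inv_mul_le_iff₀ ht.1]
    exact (h t ht).trans (le_of_eq (by ring))
  rw [← ContinuousLinearMap.nonneg_iff_isPositive]
  refine CStarAlgebra.isClosed_nonneg.mem_of_tendsto hlim ?_
  filter_upwards [hpos, self_mem_nhdsWithin] with t ht ht0
  refine (ContinuousLinearMap.nonneg_iff_isPositive _).2
    (isPositive_real_smul ?_ (by have : (0 : ℝ) < t := ht0
                                 positivity))
  have := ht.conj_adjoint Y
  rw [← ContinuousLinearMap.star_eq_adjoint, hY.star_eq] at this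
  exact this

variable [FiniteDimensional ℂ H] {ω : traceClass H}

/-- The O(t²) error meets a logarithm of norm O(ln(1/t)); divided by t, it vanishes. -/
lemma HasExpansion.tendsto_remainder (h : HasExpansion γ X G) {σ : ℝ → traceClass H}
    (hσ : ∀ᶠ t in 𝓝[>] 0, IsState (σ t)) :
    Tendsto (fun t : ℝ => reTrace (((γ t : H →L[ℂ] H) - X) *
      regLog (t ^ 2) (σ t : H →L[ℂ] H)) / t - reTrace (G * regLog (t ^ 2) (σ t : H →L[ℂ] H)))
      (𝓝[>] 0) (𝓝 0) := by
  obtain ⟨K, δ, hK, hδ, h⟩ := h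
  have hlim := (tendsto_mul_const_sub_log 1).const_mul (Module.finrank ℂ H * K)
  rw [mul_zero] at hlim
  refine squeeze_zero_norm' ?_ hlim
  filter_upwards [hσ, eventually_mem_Ioc hδ, eventually_mem_Ioc one_pos] with t hσt ht ht1
  set R := regLog (t ^ 2) (σ t : H →L[ℂ] H) with hR
  have ht0 : t ≠ 0 := ht.1.ne'
  have e : reTrace (((γ t : H →L[ℂ] H) - X) * R) / t - reTrace (G * R) =
      reTrace (((γ t : H →L[ℂ] H) - X - (t : ℂ) • G) * R) / t := by
    rw [sub_mul (_ - X), reTrace_sub, smul_mul_assoc, reTrace_smul]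
    field_simp
  rw [e, norm_div, Real.norm_of_nonneg ht.1.le, div_le_iff₀ ht.1]
  refine (abs_reTrace_le _).trans ?_
  have h1 : ‖((γ t : H →L[ℂ] H) - X - (t : ℂ) • G) * R‖ ≤
      K * t ^ 2 * (1 - 2 * Real.log t) :=
    (norm_mul_le _ _).trans (mul_le_mul (h t ht) (norm_regLog_le hσt ht1.1 ht1.2)
      (norm_nonneg _) (by positivity))
  calc _ ≤ Module.finrank ℂ H * (K * t ^ 2 * (1 - 2 * Real.log t)) := by gcongr
    _ = _ := by ring

/-- If the generator has no component in the kernel, the entropy has a finite right derivative. -/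
theorem HasExpansion.hasRightDerivAtZero_entropy (h : HasExpansion γ ω G) (h0 : γ 0 = ω)
    (hγ : ∀ t, 0 ≤ t → IsState (γ t))
    (hG : kerProj (ω : H →L[ℂ] H) * G * kerProj (ω : H →L[ℂ] H) = 0) :
    HasRightDerivAtZero (fun t => (entropy (γ t) : EReal))
      ((-reTrace (G * cfc Real.log (ω : H →L[ℂ] H)) : ℝ) : EReal) := by
  have hω : IsState ω := h0 ▸ hγ 0 le_rfl
  have hst : ∀ᶠ t in 𝓝[>] 0, IsState (γ t) := by
    filter_upwards [self_mem_nhdsWithin] with t ht using hγ t (le_of_lt ht)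
  rw [hasRightDerivAtZero_iff (by rw [h0]; exact entropy_ne_top hω)
    (hst.mono fun t ht => entropy_ne_top ht), EReal.tendsto_coe, h0]
  obtain ⟨K, hK⟩ := h.eventually_norm_sub_le
  have hC : ∀ u w, (ω : H →L[ℂ] H) u = 0 → (ω : H →L[ℂ] H) w = 0 → ⟪u, G w⟫_ℂ = 0 := by
    intro u w hu hw
    rw [← inner_compress _ G hu hw, hG]; simp
  -- Klein's inequality is used in both directions: the logarithm at ω bounds the difference
  -- quotient above, the logarithm at γ(t) bounds it below, and both limits agree.
  have hup := (h.tendsto_remainder (σ := fun _ => ω) (Eventually.of_forall fun _ => hω)).add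
    (tendsto_reTrace_mul_regLog (γ := fun _ => ω) (K := 0) hω (Eventually.of_forall fun _ => hω)
      (Eventually.of_forall fun t => by simp) hC)
  have hlo := (h.tendsto_remainder hst).add (tendsto_reTrace_mul_regLog hω hst hK hC)
  have hid : Tendsto (fun t : ℝ => (Module.finrank ℂ H : ℝ) * t) (𝓝[>] 0) (𝓝 0) := by
    have h1 : Tendsto (fun t : ℝ => t) (𝓝[>] 0) (𝓝 0) := tendsto_id.mono_left nhdsWithin_le_nhds
    simpa using h1.const_mul (Module.finrank ℂ H : ℝ)
  have hup' := hup.neg.add hid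
  have hlo' := hlo.neg.sub hid
  simp only [sub_add_cancel, zero_add, add_zero, sub_zero] at hup' hlo'
  refine tendsto_of_tendsto_of_tendsto_of_le_of_le' hlo' hup' ?_ ?_
  · filter_upwards [hst, self_mem_nhdsWithin] with t hγt ht
    have ht : (0 : ℝ) < t := ht
    have h1 := entropy_sub_le hω hγt (c := t ^ 2) (by positivity)
    rw [← neg_sub (γ t : H →L[ℂ] H), neg_mul, ← zero_sub (_ * _), reTrace_sub] at h1
    have hz : reTrace (0 : H →L[ℂ] H) = 0 := by simp [reTrace]
    rw [hz] at h1
    rw [le_div_iff₀ ht]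
    have e : (-(reTrace (((γ t : H →L[ℂ] H) - (ω : H →L[ℂ] H)) *
        regLog (t ^ 2) (γ t : H →L[ℂ] H)) / t) - Module.finrank ℂ H * t) * t =
        -reTrace (((γ t : H →L[ℂ] H) - (ω : H →L[ℂ] H)) *
        regLog (t ^ 2) (γ t : H →L[ℂ] H)) - Module.finrank ℂ H * t ^ 2 := by
      field_simp
    rw [e]
    linarith
  · filter_upwards [hst, self_mem_nhdsWithin] with t hγt ht
    have ht : (0 : ℝ) < t := ht
    have h1 := entropy_sub_le hγt hω (c := t ^ 2) (by positivity)
    rw [div_le_iff₀ ht]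
    refine h1.trans (le_of_eq ?_)
    field_simp

/-- If the generator has a component in the kernel, the entropy grows with infinite slope. -/
theorem HasExpansion.hasRightDerivAtZero_entropy_top (h : HasExpansion γ ω G) (h0 : γ 0 = ω)
    (hγ : ∀ t, 0 ≤ t → IsState (γ t))
    (hG : kerProj (ω : H →L[ℂ] H) * G * kerProj (ω : H →L[ℂ] H) ≠ 0) :
    HasRightDerivAtZero (fun t => (entropy (γ t) : EReal)) ⊤ := by
  have hω : IsState ω := h0 ▸ hγ 0 le_rfl
  have hst : ∀ᶠ t in 𝓝[>] 0, IsState (γ t) := by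
    filter_upwards [self_mem_nhdsWithin] with t ht using hγ t (le_of_lt ht)
  rw [hasRightDerivAtZero_iff (by rw [h0]; exact entropy_ne_top hω)
    (hst.mono fun t ht => entropy_ne_top ht), EReal.tendsto_coe_nhds_top_iff, h0]
  obtain ⟨K, hK⟩ := h.eventually_norm_sub_le
  set B := kerProj (ω : H →L[ℂ] H) * G * kerProj (ω : H →L[ℂ] H) with hB
  have hBpos : B.IsPositive := h.isPositive_compress (hst.mono fun t ht => ht.1)
    (eigenProj_isSelfAdjoint _ _) (mul_kerProj _)
  have hC : ∀ u w, (ω : H →L[ℂ] H) u = 0 → (ω : H →L[ℂ] H) w = 0 → ⟪u, (G - B) w⟫_ℂ = 0 := by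
    intro u w hu hw
    rw [sub_apply, inner_sub_right, hB, inner_compress _ G hu hw, sub_self]
  have hBω : B * (ω : H →L[ℂ] H) = 0 := by
    rw [hB, mul_assoc, kerProj_mul hω.1.isSelfAdjoint, mul_zero]
  have hid : Tendsto (fun t : ℝ => (Module.finrank ℂ H : ℝ) * t) (𝓝[>] 0) (𝓝 0) := by
    have h1 : Tendsto (fun t : ℝ => t) (𝓝[>] 0) (𝓝 0) := tendsto_id.mono_left nhdsWithin_le_nhds
    simpa using h1.const_mul (Module.finrank ℂ H : ℝ)
  -- Split G = (G - B) + B: the first part converges, the kernel block B drives the lower bound to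
  -- +∞.
  have h1 := (((h.tendsto_remainder hst).add
    (tendsto_reTrace_mul_regLog hω hst hK hC)).neg.sub hid).add_atTop
    (tendsto_neg_atBot_atTop.comp (tendsto_reTrace_mul_regLog_atBot hst hK hBpos hBω hG))
  refine tendsto_atTop_mono' _ ?_ h1
  filter_upwards [hst, self_mem_nhdsWithin] with t hγt ht
  have ht : (0 : ℝ) < t := ht
  have h1 := entropy_sub_le hω hγt (c := t ^ 2) (by positivity)
  have e1 : (((ω : H →L[ℂ] H) - (γ t : H →L[ℂ] H)) * regLog (t ^ 2) (γ t : H →L[ℂ] H)) =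
      ((-1 : ℝ) : ℂ) • (((γ t : H →L[ℂ] H) - (ω : H →L[ℂ] H)) *
        regLog (t ^ 2) (γ t : H →L[ℂ] H)) := by
    rw [← neg_sub (γ t : H →L[ℂ] H), neg_mul]; simp
  rw [e1, reTrace_smul] at h1
  simp only [Function.comp_apply]
  rw [sub_mul G, reTrace_sub, le_div_iff₀ ht]
  set x := reTrace (((γ t : H →L[ℂ] H) - (ω : H →L[ℂ] H)) * regLog (t ^ 2) (γ t : H →L[ℂ] H))
  set y := reTrace (G * regLog (t ^ 2) (γ t : H →L[ℂ] H))
  set z := reTrace (B * regLog (t ^ 2) (γ t : H →L[ℂ] H))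
  have e : (-(x / t - y + (y - z)) - Module.finrank ℂ H * t + -z) * t =
      -x - Module.finrank ℂ H * t ^ 2 := by
    field_simp
    ring
  rw [e]
  linarith

lemma HasExpansion.exists_rate (h : HasExpansion γ ω G) (h0 : γ 0 = ω)
    (hγ : ∀ t, 0 ≤ t → IsState (γ t)) :
    ∃ x : EReal, x ≠ ⊥ ∧ HasRightDerivAtZero (fun t => (entropy (γ t) : EReal)) x := by
  by_cases hG : kerProj (ω : H →L[ℂ] H) * G * kerProj (ω : H →L[ℂ] H) = 0
  · exact ⟨_, EReal.coe_ne_bot _, h.hasRightDerivAtZero_entropy h0 hγ hG⟩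
  · exact ⟨⊤, by simp, h.hasRightDerivAtZero_entropy_top h0 hγ hG⟩

end Expansion

/-! ### Domination, supports and a uniform spectral gap -/

section SupportGap

variable [FiniteDimensional ℂ H] {φ ρ : traceClass H}

/-- The nonzero eigenvalues of a state are bounded away from zero. -/
lemma IsState.exists_gap (hφ : IsState φ) : ∃ m : ℝ, 0 < m ∧ ∀ u : H,
    m * ‖u - kerProj (φ : H →L[ℂ] H) u‖ ^ 2 ≤ (⟪u, (φ : H →L[ℂ] H) u⟫_ℂ).re := by
  obtain ⟨ι, _, b, r, hb⟩ := hφ.exists_finite_eigenbasis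
  have hm : ∀ᶠ m in 𝓝[>] (0 : ℝ), ∀ i, 0 = r i ∨ m ≤ r i := by
    refine eventually_all.2 fun i => ?_
    rcases (hb.nonneg hφ.1 i).eq_or_lt with h | h
    · exact Eventually.of_forall fun _ => Or.inl h
    · filter_upwards [eventually_mem_Ioc h] with m hm using Or.inr hm.2
  obtain ⟨m, hm, hm0⟩ := (hm.and self_mem_nhdsWithin).exists
  have hm0 : 0 < m := hm0
  refine ⟨m, hm0, fun u => ?_⟩
  rw [← (hasSum_fintype _).unique (hasSum_norm_inner_sq b _),
    ← (hasSum_fintype _).unique (hb.hasSum_re_inner hφ.1 u), Finset.mul_sum]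
  refine Finset.sum_le_sum fun i _ => ?_
  rw [inner_sub_right, inner_apply_comm (eigenProj_isSelfAdjoint _ _),
    hb.eigenProj_apply hφ.1.isSelfAdjoint]
  rcases hm i with h | h
  · rw [if_pos h, sub_self, ← h]; simp
  · rw [if_neg (by linarith), inner_zero_left, sub_zero]
    gcongr

/-- With m the gap of φ and K its kernel projection, φ ≥ m(1 - K) ≥ mρ, because ρ ≤ 1 and ρ vanishes
on ker φ. -/
lemma dominates_of_ker_le (hφ : IsState φ) (hρ : IsState ρ)
    (hker : ∀ v, (φ : H →L[ℂ] H) v = 0 → (ρ : H →L[ℂ] H) v = 0) : Dominates φ ρ := by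
  obtain ⟨m, hm, h⟩ := hφ.exists_gap
  refine ⟨m, hm, (ContinuousLinearMap.le_def _ _).2 (isPositive_of_forall_eq_re fun v => ?_)⟩
  refine ⟨(⟪v, (φ : H →L[ℂ] H) v⟫_ℂ).re - m * (⟪v, (ρ : H →L[ℂ] H) v⟫_ℂ).re, ?_, ?_⟩
  · set w := v - kerProj (φ : H →L[ℂ] H) v with hw
    have hρw : (ρ : H →L[ℂ] H) w = (ρ : H →L[ℂ] H) v := by
      rw [hw, map_sub, hker _ (apply_kerProj _ _), sub_zero]
    have h1 : ⟪v, (ρ : H →L[ℂ] H) v⟫_ℂ = ⟪w, (ρ : H →L[ℂ] H) w⟫_ℂ := by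
      rw [hρw, inner_apply_comm hρ.1.isSelfAdjoint, ← hρw,
        ← inner_apply_comm hρ.1.isSelfAdjoint, hρw]
    have h2 : (⟪w, (ρ : H →L[ℂ] H) w⟫_ℂ).re ≤ ‖w‖ ^ 2 := by
      refine (Complex.re_le_norm _).trans ((norm_inner_le_norm _ _).trans ?_)
      have h3 := ((ρ : H →L[ℂ] H).le_opNorm w).trans
        (mul_le_mul_of_nonneg_right hρ.norm_le_one (norm_nonneg _))
      rw [sq]
      gcongr
      linarith
    have h3 := h v
    rw [h1]
    nlinarith
  · rw [sub_apply, inner_sub_right, smul_apply, inner_smul_right,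
      isPositive_inner_eq_re hφ.1 v, isPositive_inner_eq_re hρ.1 v]
    push_cast
    simp

lemma dominates_iff_relEntropy_lt_top (hφ : IsState φ) (hρ : IsState ρ) :
    Dominates φ ρ ↔ relEntropy ρ φ < ⊤ := by
  constructor
  · rintro ⟨α, hα, hle⟩
    have h := (relEntropy_add_entropy_mix hα hle hφ hρ (entropy_ne_top hφ) (l := 0)
      (by linarith) zero_le_one).1
    exact lt_top_iff_ne_top.2 (ne_top_of_le_ne_top h le_self_add)
  · intro h
    refine dominates_of_ker_le hφ hρ (supp_le_iff.1 ?_)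
    by_contra hs
    rw [relEntropy, if_neg hs] at h
    exact lt_irrefl _ h

lemma half_le_mix {α : ℝ} (hα : 0 < α) (hle : (α : ℂ) • (ρ : H →L[ℂ] H) ≤ (φ : H →L[ℂ] H))
    (hφ : IsState φ) (hρ : IsState ρ) {l : ℝ} (hl : |l| ≤ min α 1 / 2) :
    ((1 / 2 : ℝ) : ℂ) • (φ : H →L[ℂ] H) ≤ (mix φ ρ l : H →L[ℂ] H) := by
  have h1 : min α 1 ≤ α := min_le_left _ _
  have h2 : min α 1 ≤ 1 := min_le_right _ _
  obtain ⟨hl1, hl2⟩ := abs_le.1 hl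
  rw [ContinuousLinearMap.le_def]
  rcases le_total 0 l with h | h
  · have e : (mix φ ρ l : H →L[ℂ] H) - ((1 / 2 : ℝ) : ℂ) • (φ : H →L[ℂ] H) =
        ((1 / 2 - l : ℝ) : ℂ) • (φ : H →L[ℂ] H) + (l : ℂ) • (ρ : H →L[ℂ] H) := by
      rw [coe_mix]; push_cast; module
    rw [e]
    exact (isPositive_real_smul hφ.1 (by linarith)).add (isPositive_real_smul hρ.1 h)
  · have hαc : (α : ℂ) ≠ 0 := by exact_mod_cast hα.ne'
    have hc : 0 ≤ 1 / 2 - l + l / α := by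
      have : -(1 / 2) ≤ l / α := by rw [le_div_iff₀ hα]; linarith
      linarith
    have e : (mix φ ρ l : H →L[ℂ] H) - ((1 / 2 : ℝ) : ℂ) • (φ : H →L[ℂ] H) =
        ((1 / 2 - l + l / α : ℝ) : ℂ) • (φ : H →L[ℂ] H) +
        ((-l / α : ℝ) : ℂ) • ((φ : H →L[ℂ] H) - (α : ℂ) • (ρ : H →L[ℂ] H)) := by
      rw [coe_mix]; push_cast
      match_scalars
      · field_simp; ring
      · field_simp
    rw [e]
    exact (isPositive_real_smul hφ.1 hc).add
      (isPositive_real_smul ((ContinuousLinearMap.le_def _ _).1 hle)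
        (div_nonneg (by linarith) hα.le))

lemma exists_eigenvector_of_mem_spectrum {A : H →L[ℂ] H} {x : ℝ} (hx : x ∈ spectrum ℝ A) :
    ∃ u : H, u ≠ 0 ∧ A u = (x : ℂ) • u := by
  have h1 : (x : ℂ) ∈ spectrum ℂ A := (spectrum.algebraMap_mem_iff ℂ).2 hx
  have h2 : (x : ℂ) ∈ spectrum ℂ (A : H →ₗ[ℂ] H) := by
    rw [← AlgEquiv.spectrum_eq (Module.End.toContinuousLinearMap (𝕜 := ℂ) H)]
    exact h1
  obtain ⟨u, hu⟩ := (Module.End.hasEigenvalue_iff_mem_spectrum.2 h2).exists_hasEigenvector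
  exact ⟨u, hu.2, hu.apply_eq_smul⟩

/-- An eigenvector of φ(l) with nonzero eigenvalue is orthogonal to ker φ. There φ ≥ m, and φ(l) ≥
φ/2 gives the bound m/2 uniformly in l. -/
lemma exists_spectrum_mix_subset {α : ℝ} (hα : 0 < α)
    (hle : (α : ℂ) • (ρ : H →L[ℂ] H) ≤ (φ : H →L[ℂ] H)) (hφ : IsState φ) (hρ : IsState ρ) :
    ∃ m : ℝ, 0 < m ∧ ∀ l : ℝ, |l| ≤ min α 1 / 2 →
      spectrum ℝ (mix φ ρ l : H →L[ℂ] H) ⊆ {0} ∪ Icc m 2 := by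
  obtain ⟨m, hm, h⟩ := hφ.exists_gap
  refine ⟨m / 2, by positivity, fun l hl x hx => ?_⟩
  have h1 : min α 1 ≤ α := min_le_left _ _
  have h2 : min α 1 ≤ 1 := min_le_right _ _
  obtain ⟨hl1, hl2⟩ := abs_le.1 hl
  have hψ : IsState (mix φ ρ l) := mix_isState hα hle hφ hρ (by linarith) (by linarith)
  by_cases hx0 : x = 0
  · exact Or.inl hx0
  right
  refine ⟨?_, by linarith [(hψ.spectrum_subset hx).2]⟩
  obtain ⟨u, hu0, hu⟩ := exists_eigenvector_of_mem_spectrum hx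
  have hxc : (x : ℂ) ≠ 0 := by exact_mod_cast hx0
  have hk : kerProj (φ : H →L[ℂ] H) u = 0 := by
    have h3 : (mix φ ρ l : H →L[ℂ] H) * kerProj (φ : H →L[ℂ] H) = 0 := by
      ext v
      have h4 := apply_kerProj (φ : H →L[ℂ] H) v
      have h5 := Dominates.ker_le ⟨α, hα, hle⟩ hρ.1 _ h4
      rw [mul_apply_eq_comp, coe_mix, add_apply, smul_apply, smul_apply, h4, h5]
      simp
    have h4 := congrArg star h3
    rw [star_mul, hψ.1.isSelfAdjoint.star_eq, (eigenProj_isSelfAdjoint _ _).star_eq,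
      star_zero] at h4
    have h5 : kerProj (φ : H →L[ℂ] H) ((mix φ ρ l : H →L[ℂ] H) u) = 0 :=
      congrArg (fun A : H →L[ℂ] H => A u) h4
    rw [hu, map_smul] at h5
    exact (smul_eq_zero.1 h5).resolve_left hxc
  have h3 := h u
  rw [hk, sub_zero] at h3
  have h4 := isPositive_re_nonneg ((ContinuousLinearMap.le_def _ _).1
    (half_le_mix hα hle hφ hρ hl)) u
  rw [sub_apply, inner_sub_right, hu, smul_apply, inner_smul_right, inner_smul_right,
    Complex.sub_re, Complex.re_ofReal_mul, Complex.re_ofReal_mul,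
    inner_self_eq_norm_sq_to_K] at h4
  have h5 : ((((‖u‖ : ℝ) : ℂ)) ^ 2).re = ‖u‖ ^ 2 := by norm_cast
  have h6 : 0 < ‖u‖ ^ 2 := by positivity
  erw [h5] at h4
  nlinarith

end SupportGap

/-! ### Differentiability of the logarithm along mixtures -/

section LogDerivative

variable [FiniteDimensional ℂ H] {φ ρ : traceClass H}

/-- The divided difference of ln at r, applied to A alone. It avoids differentiating a function of
noncommuting operators. -/
lemma cfc_log_apply_sub {A : H →L[ℂ] H} (hA : IsSelfAdjoint A) (r : ℝ) (v : H) :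
    cfc Real.log A v = (Real.log r : ℂ) • v + cfc (dslope Real.log r) A (A v - (r : ℂ) • v) := by
  have h1 : Real.log = fun x => Real.log r + dslope Real.log r x * (x - r) := by
    ext x
    have := sub_smul_dslope Real.log r x
    rw [smul_eq_mul] at this
    linarith
  have h2 : cfc Real.log A = algebraMap ℝ (H →L[ℂ] H) (Real.log r) +
      cfc (dslope Real.log r) A * (A - algebraMap ℝ (H →L[ℂ] H) r) := by
    conv_lhs => rw [h1]
    rw [cfc_add (a := A) (fun _ => Real.log r) (fun x => dslope Real.log r x * (x - r))
        (continuousOn_spectrum _ _) (continuousOn_spectrum _ _),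
      cfc_mul (a := A) (dslope Real.log r) (fun x => x - r) (continuousOn_spectrum _ _)
        (continuousOn_spectrum _ _),
      cfc_sub (a := A) (fun x => x) (fun _ => r) (continuousOn_spectrum _ _)
        (continuousOn_spectrum _ _), cfc_const _ A hA, cfc_const _ A hA, cfc_id' ℝ A hA]
  rw [h2, add_apply, mul_apply_eq_comp, sub_apply, Algebra.algebraMap_eq_smul_one,
    Algebra.algebraMap_eq_smul_one]
  rfl

/-- For φ v = r v with r > 0, (φ(l) - r)v = l(ρ - φ)v, so the difference quotient is the divided
difference of φ(l) applied to a fixed vector, and continuity in l suffices. For r = 0 the curve is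
constantly 0. -/
lemma differentiableAt_cfc_log_mix_apply {α : ℝ} (hα : 0 < α)
    (hle : (α : ℂ) • (ρ : H →L[ℂ] H) ≤ (φ : H →L[ℂ] H)) (hφ : IsState φ) (hρ : IsState ρ)
    {v : H} {r : ℝ} (hr : 0 ≤ r) (hv : (φ : H →L[ℂ] H) v = (r : ℂ) • v) :
    DifferentiableAt ℝ (fun l : ℝ => cfc Real.log (mix φ ρ l : H →L[ℂ] H) v) 0 := by
  have hsa : ∀ l : ℝ, IsSelfAdjoint (mix φ ρ l : H →L[ℂ] H) := fun l => by
    rw [coe_mix]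
    refine IsSelfAdjoint.add (IsSelfAdjoint.smul ?_ hφ.1.isSelfAdjoint)
      (IsSelfAdjoint.smul ?_ hρ.1.isSelfAdjoint) <;> exact Complex.conj_ofReal _
  rcases hr.eq_or_lt with rfl | hr
  · have h0 : ∀ l : ℝ, cfc Real.log (mix φ ρ l : H →L[ℂ] H) v = 0 := by
      intro l
      have hv0 : (φ : H →L[ℂ] H) v = 0 := by simpa using hv
      have hv1 : (ρ : H →L[ℂ] H) v = 0 := Dominates.ker_le ⟨α, hα, hle⟩ hρ.1 v hv0
      rw [cfc_apply_eigenvector (hsa l) (continuousOn_spectrum _ _) (p := 0)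
        (by rw [coe_mix, add_apply, smul_apply, smul_apply, hv0, hv1]; simp)]
      simp
    simp only [h0]
    exact differentiableAt_const _
  obtain ⟨m, hm, hspec⟩ := exists_spectrum_mix_subset hα hle hφ hρ
  set w : H := (ρ : H →L[ℂ] H) v - (φ : H →L[ℂ] H) v with hw
  have hsub : ∀ l : ℝ, (mix φ ρ l : H →L[ℂ] H) v - (r : ℂ) • v = (l : ℂ) • w := by
    intro l
    rw [hw, coe_mix, add_apply, smul_apply, smul_apply, hv]
    push_cast
    module
  have hev : ∀ᶠ l in 𝓝 (0 : ℝ), |l| ≤ min α 1 / 2 := by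
    have h1 : Tendsto (fun l : ℝ => |l|) (𝓝 0) (𝓝 0) := by
      simpa using (continuous_abs.tendsto (0 : ℝ))
    have h2 : 0 < min α 1 / 2 := by positivity
    filter_upwards [h1.eventually (gt_mem_nhds h2)] with l hl using hl.le
  have hcomp : IsCompact ({0} ∪ Icc m 2 : Set ℝ) := isCompact_singleton.union isCompact_Icc
  -- The jump of `Real.log` at 0 does no harm, since 0 is isolated in this set.
  have hcont : ContinuousOn (dslope Real.log r) ({0} ∪ Icc m 2) := by
    refine ContinuousOn.union_of_isClosed (continuousOn_singleton _ _) ?_ isClosed_singleton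
      isClosed_Icc
    intro x hx
    refine ContinuousAt.continuousWithinAt ?_
    by_cases hxr : x = r
    · rw [hxr, continuousAt_dslope_same]
      exact Real.differentiableAt_log hr.ne'
    · rw [continuousAt_dslope_of_ne hxr]
      exact Real.continuousAt_log (by linarith [hx.1])
  have hmixcont : Tendsto (fun l : ℝ => (mix φ ρ l : H →L[ℂ] H)) (𝓝 0)
      (𝓝 (φ : H →L[ℂ] H)) := by
    have h1 : Continuous fun l : ℝ => (mix φ ρ l : H →L[ℂ] H) := by
      simp only [coe_mix]
      fun_prop
    have h2 := h1.tendsto 0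
    rwa [mix_zero] at h2
  have hlim : Tendsto (fun l : ℝ => cfc (dslope Real.log r) (mix φ ρ l : H →L[ℂ] H)) (𝓝 0)
      (𝓝 (cfc (dslope Real.log r) (φ : H →L[ℂ] H))) := by
    refine Tendsto.cfc hcomp _ hmixcont (hev.mono hspec) (Eventually.of_forall hsa) ?_
      hφ.1.isSelfAdjoint hcont
    have := hspec 0 (by rw [abs_zero]; positivity)
    rwa [mix_zero] at this
  have hlim2 : Tendsto (fun l : ℝ => cfc (dslope Real.log r) (mix φ ρ l : H →L[ℂ] H) w) (𝓝 0)
      (𝓝 (cfc (dslope Real.log r) (φ : H →L[ℂ] H) w)) :=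
    ((ContinuousLinearMap.apply ℂ H w).continuous.tendsto _).comp hlim
  refine HasDerivAt.differentiableAt
    (f' := cfc (dslope Real.log r) (φ : H →L[ℂ] H) w) ?_
  rw [hasDerivAt_iff_tendsto_slope_zero]
  refine (hlim2.mono_left nhdsWithin_le_nhds).congr' ?_
  filter_upwards [self_mem_nhdsWithin] with l hl
  have hl0 : l ≠ 0 := hl
  rw [zero_add, cfc_log_apply_sub (hsa l) r v, cfc_log_apply_sub (hsa 0) r v, hsub, hsub]
  have e : ∀ x : H, l⁻¹ • ((l : ℂ) • x) = x := fun x => by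
    rw [Complex.coe_smul, smul_smul, inv_mul_cancel₀ hl0, one_smul]
  rw [map_smul, map_smul, Complex.ofReal_zero, zero_smul, add_zero, add_sub_cancel_left, e]

lemma differentiableAt_reTrace_mul_cfc_log_mix {α : ℝ} (hα : 0 < α)
    (hle : (α : ℂ) • (ρ : H →L[ℂ] H) ≤ (φ : H →L[ℂ] H)) (hφ : IsState φ) (hρ : IsState ρ)
    (G : H →L[ℂ] H) :
    DifferentiableAt ℝ (fun l : ℝ => reTrace (G * cfc Real.log (mix φ ρ l : H →L[ℂ] H))) 0 := by
  obtain ⟨ι, _, b, r, hb⟩ := hφ.exists_finite_eigenbasis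
  simp only [reTrace_eq_sum b]
  refine DifferentiableAt.fun_sum fun i _ => ?_
  let Λ : H →L[ℝ] ℝ := Complex.reCLM.comp (((innerSL ℂ (b i)).comp G).restrictScalars ℝ)
  exact Λ.differentiableAt.comp (0 : ℝ)
    (differentiableAt_cfc_log_mix_apply hα hle hφ hρ (hb.nonneg hφ.1 i) (hb i))

end LogDerivative

/-! ### The identity in finite dimensions -/

section Identity

variable [FiniteDimensional ℂ H] [TopologicalSpace.SeparableSpace H]
  {T : ℝ → traceClass H →ₗ[ℂ] traceClass H} {Q : traceClass H → EReal} {φ ρ : traceClass H}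

lemma compress_eq_zero_of_ker_le {A B G : H →L[ℂ] H} (hker : ∀ v, B v = 0 → A v = 0)
    (h : kerProj A * G * kerProj A = 0) : kerProj B * G * kerProj B = 0 := by
  have h1 : kerProj A * kerProj B = kerProj B := by
    ext v
    exact kerProj_apply_eq_self (hker _ (apply_kerProj B v))
  have h2 : kerProj B * kerProj A = kerProj B := by
    have := congrArg star h1
    rwa [star_mul, (eigenProj_isSelfAdjoint _ _).star_eq,
      (eigenProj_isSelfAdjoint _ _).star_eq] at this
  calc kerProj B * G * kerProj B
      = kerProj B * kerProj A * G * (kerProj A * kerProj B) := by rw [h1, h2]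
    _ = kerProj B * (kerProj A * G * kerProj A) * kerProj B := by noncomm_ring
    _ = 0 := by rw [h]; simp

lemma exists_hasExpansion (hT : IsLindbladSemigroup T) :
    ∃ G : traceClass H →ₗ[ℂ] traceClass H, ∀ ω : traceClass H,
      HasExpansion (fun t => T t ω) ω (G ω) := by
  obtain ⟨G, δ, hδ, h⟩ := hT.exists_generator
  refine ⟨G, fun ω => ?_⟩
  obtain ⟨K, hK, h⟩ := h ω
  exact ⟨K, δ, hK, hδ, fun t ht => h t ⟨ht.1.le, ht.2⟩⟩

/-- If the generator at `φ` has no component in the kernel of `φ`, the same holds for every state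
dominated by `φ`. -/
lemma compress_eq_zero_of_dominates (hT : IsLindbladSemigroup T)
    {G : traceClass H →ₗ[ℂ] traceClass H}
    (hG : ∀ ω : traceClass H, HasExpansion (fun t => T t ω) ω (G ω)) (hρ : IsState ρ)
    (hdom : Dominates φ ρ)
    (h : kerProj (φ : H →L[ℂ] H) * (G φ : H →L[ℂ] H) * kerProj (φ : H →L[ℂ] H) = 0) :
    kerProj (φ : H →L[ℂ] H) * (G ρ : H →L[ℂ] H) * kerProj (φ : H →L[ℂ] H) = 0 := by
  have hker := hdom.ker_le hρ.1
  obtain ⟨α, hα, hle⟩ := hdom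
  have hρk : (ρ : H →L[ℂ] H) * kerProj (φ : H →L[ℂ] H) = 0 := by
    ext v; exact hker _ (apply_kerProj _ v)
  have hpos : ∀ X : traceClass H, (X : H →L[ℂ] H).IsPositive →
      ∀ᶠ t in 𝓝[>] (0 : ℝ), (T t X : H →L[ℂ] H).IsPositive := by
    intro X hX
    filter_upwards [self_mem_nhdsWithin] with t ht
    exact (hT.completelyPositive t (le_of_lt ht)).isPositive hX
  have h1 := (hG ρ).isPositive_compress (hpos ρ hρ.1)
    (eigenProj_isSelfAdjoint (φ : H →L[ℂ] H) 0) hρk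
  have h2 := (hG (φ - (α : ℂ) • ρ)).isPositive_compress
    (hpos _ ((ContinuousLinearMap.le_def _ _).1 hle))
    (eigenProj_isSelfAdjoint (φ : H →L[ℂ] H) 0) (by
      rw [Submodule.coe_sub, Submodule.coe_smul, sub_mul, smul_mul_assoc, hρk, mul_kerProj]
      simp)
  have e : kerProj (φ : H →L[ℂ] H) * (G (φ - (α : ℂ) • ρ) : H →L[ℂ] H) *
      kerProj (φ : H →L[ℂ] H) = ((-α : ℝ) : ℂ) • (kerProj (φ : H →L[ℂ] H) *
        (G ρ : H →L[ℂ] H) * kerProj (φ : H →L[ℂ] H)) := by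
    rw [map_sub, map_smul, Submodule.coe_sub, Submodule.coe_smul, mul_sub, sub_mul, h,
      mul_smul_comm, smul_mul_assoc]
    simp
  rw [e] at h2
  -- Both the block of G(ρ) and -α times it are positive, so its trace, and hence the block,
  -- vanishes.
  have h3 := reTrace_mul_nonneg h2 ContinuousLinearMap.isPositive_one
  rw [mul_one, reTrace_smul] at h3
  exact eq_zero_of_reTrace_eq_zero h1 (by nlinarith)

/-- The mismatch cost identity in finite dimensions. -/
theorem mismatchCostIdentity_of_finiteDimensional (hT : IsLindbladSemigroup T)
    (hQ : IsLinearOnStates Q) {P : Set (H →L[ℂ] H)} (hmin : IsEPRateMinimizer T Q (statesOf P) φ)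
    (hρP : ρ ∈ statesOf P) (hφtop : epRate T Q φ < ⊤) (hdom : Dominates φ ρ) :
    IsFinite (epRate T Q φ) ∧ MismatchCostIdentity T Q φ ρ := by
  have hφ : IsState φ := hmin.1.1
  have hρ : IsState ρ := hρP.1
  obtain ⟨G, hG⟩ := exists_hasExpansion hT
  have hT0 : ∀ ω, T 0 ω = ω := fun ω => by rw [hT.zero]; rfl
  -- A nonzero kernel block would make the entropy rate, and with it the EP rate, infinite at φ.
  have hBφ : kerProj (φ : H →L[ℂ] H) * (G φ : H →L[ℂ] H) * kerProj (φ : H →L[ℂ] H) = 0 := by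
    by_contra hne
    have h1 := (hG φ).hasRightDerivAtZero_entropy_top (hT0 φ)
      (fun t ht => hT.isState ht hφ) hne
    rw [epRate, entropyRate_eq h1, EReal.top_add_of_ne_bot (hQ.1 _ hφ)] at hφtop
    exact lt_irrefl _ hφtop
  have hrate := (hG φ).hasRightDerivAtZero_entropy (hT0 φ) (fun t ht => hT.isState ht hφ) hBφ
  have hQφ : Q φ ≠ ⊤ := by
    intro h
    rw [epRate, h, entropyRate_eq hrate, EReal.coe_add_top] at hφtop
    exact lt_irrefl _ hφtop
  have hfin : IsFinite (epRate T Q φ) := by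
    refine ⟨?_, hφtop.ne⟩
    rw [epRate, entropyRate_eq hrate, ← EReal.coe_toReal hQφ (hQ.1 _ hφ), ← EReal.coe_add]
    exact EReal.coe_ne_bot _
  have hBρ := compress_eq_zero_of_dominates hT hG hρ hdom hBφ
  obtain ⟨x, hx, hρx⟩ := (hG ρ).exists_rate (hT0 ρ) (fun t ht => hT.isState ht hρ)
  obtain ⟨α, hα, hle⟩ := id hdom
  refine ⟨hfin, ?_⟩
  have hε : 0 < min α 1 / 2 := by positivity
  let e : ℝ → ℝ := fun l =>
    -reTrace ((G (mix φ ρ l) : H →L[ℂ] H) * cfc Real.log (mix φ ρ l : H →L[ℂ] H))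
  have he : ∀ l, |l| < min α 1 / 2 →
      HasRightDerivAtZero (fun t => (entropy (T t (mix φ ρ l)) : EReal)) (e l) := by
    intro l hl
    have h1 : min α 1 ≤ α := min_le_left _ _
    have h2 : min α 1 ≤ 1 := min_le_right _ _
    obtain ⟨hl1, hl2⟩ := abs_le.1 hl.le
    have hψ : IsState (mix φ ρ l) := mix_isState hα hle hφ hρ (by linarith) (by linarith)
    refine (hG (mix φ ρ l)).hasRightDerivAtZero_entropy (hT0 _)
      (fun t ht => hT.isState ht hψ) ?_
    -- φ(l) ≥ φ/2 puts ker φ(l) inside ker φ, where the block of G(φ(l)) vanishes by linearity.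
    refine compress_eq_zero_of_ker_le (A := (φ : H →L[ℂ] H))
      (Dominates.ker_le ⟨1 / 2, by norm_num, half_le_mix hα hle hφ hρ hl.le⟩ hφ.1) ?_
    rw [map_mix, coe_mix, mul_add, add_mul, mul_smul_comm, mul_smul_comm, smul_mul_assoc,
      smul_mul_assoc, hBφ, hBρ]
    simp
  have hde : DifferentiableAt ℝ e 0 := by
    have h1 : e = fun l => -((1 - l) * reTrace ((G φ : H →L[ℂ] H) *
        cfc Real.log (mix φ ρ l : H →L[ℂ] H)) + l * reTrace ((G ρ : H →L[ℂ] H) *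
        cfc Real.log (mix φ ρ l : H →L[ℂ] H))) := by
      ext l
      simp only [e]
      rw [map_mix, coe_mix (G φ), add_mul, smul_mul_assoc, smul_mul_assoc, reTrace_add,
        reTrace_smul, reTrace_smul]
    rw [h1]
    have h2 := differentiableAt_reTrace_mul_cfc_log_mix hα hle hφ hρ (G φ : H →L[ℂ] H)
    have h3 := differentiableAt_reTrace_mul_cfc_log_mix hα hle hφ hρ (G ρ : H →L[ℂ] H)
    exact (((differentiableAt_id.const_sub 1).mul h2).add (differentiableAt_id.mul h3)).neg
  exact mismatchCostIdentity_of_entropyRates hT hQ hmin hρP hdom hQφ hε he hde hx hρx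

end Identity

end EPRate

end

theorem mainTheorem8 {H : Type*} [NormedAddCommGroup H] [InnerProductSpace ℂ H] [CompleteSpace H]
    [TopologicalSpace.SeparableSpace H]
    (T : ℝ → EPRate.traceClass H →ₗ[ℂ] EPRate.traceClass H) (hT : EPRate.IsLindbladSemigroup T)
    (Q : EPRate.traceClass H → EReal) (hQ : EPRate.IsLinearOnStates Q)
    (P : Set (H →L[ℂ] H)) (hP : EPRate.IsOrthogonalProjectionSet P)
    (φ ρ : EPRate.traceClass H)
    (hφ : EPRate.IsEPRateMinimizer T Q (EPRate.statesOf P) φ)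
    (hρ : ρ ∈ EPRate.statesOf P) :
    -- arbitrary dimension
    (EPRate.epRate T Q ρ < ⊤ → EPRate.Dominates φ ρ →
      EPRate.SymmetricDerivatives T Q φ ρ → EPRate.SmoothNearMinimizer T Q φ ρ →
      EPRate.IsFinite (EPRate.epRate T Q ρ) ∧ EPRate.IsFinite (EPRate.epRate T Q φ) ∧
        EPRate.MismatchCostIdentity T Q φ ρ) ∧
    -- finite dimension
    (FiniteDimensional ℂ H →
      (EPRate.Dominates φ ρ ↔ EPRate.relEntropy ρ φ < ⊤) ∧
      (EPRate.epRate T Q φ < ⊤ → EPRate.relEntropy ρ φ < ⊤ →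
        EPRate.IsFinite (EPRate.epRate T Q φ) ∧ EPRate.MismatchCostIdentity T Q φ ρ)) := by
  refine ⟨fun h1 h2 _ h4 => EPRate.mismatchCostIdentity_of_smooth hT hQ hφ hρ h1 h2 h4,
    fun _ => ?_⟩
  have hiff := EPRate.dominates_iff_relEntropy_lt_top hφ.1.1 hρ.1
  exact ⟨hiff, fun h1 h2 =>
    EPRate.mismatchCostIdentity_of_finiteDimensional hT hQ hφ hρ h1 (hiff.2 h2)⟩
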